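/- **Notation.** Let $\mu,\nu\in\mathbb C$ and put $i=\sqrt{-1}$. For $g=\begin{pmatrix}a&b\\c&d\end{pmatrix}\in SL(2,\mathbb R)$ and $z$ in the upper half plane put $J(g,z)=cz+d$. Let $\widetilde G=\{(g,\theta)\in SL(2,\mathbb R)\times\mathbb R : J(g,i)e^{i\theta}=|J(g,i)|\}$ be the universal covering group of $SL(2,\mathbb R)$, with product $(g_1,\theta_1)(g_2,\theta_2)=\bigl(g_1g_2,\theta_1+\theta_2-\arg\frac{J(g_1,g_2i)}{J(g_1,i)}\bigr)$ (principal argument). Write $\tilde u(x)=\bigl(\begin{pmatrix}1&x\\0&1\end{pmatrix},0\bigr)$, $\tilde a(y)=\bigl(\mathrm{diag}(\sqrt y,1/\sqrt y),0\bigr)$ for $y>0$, $\tilde k(\theta)=\bigl(\begin{pmatrix}\cos\theta&\sin\theta\\-\sin\theta&\cos\theta\end{pmatrix},\theta\bigr)$, $\tilde w=\tilde k(-\pi/2)$, and let $\rho$ denote right translation of functions on $\widetilde G$ and the derived action of $U(\mathfrak{sl}_2(\mathbb C))$. Let $I^\infty_{\mu,\nu}$ be the space of smooth functions $F$ on $\widetilde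 G$ with $F(\tilde u(x)\tilde a(y)\tilde k(m\pi)\tilde g)=e^{\pi m i\mu}y^{\nu+1/2}F(\tilde g)$ for $x\in\mathbb R$, $y>0$, $m\in\mathbb Z$, $\tilde g\in\widetilde G$, topologized by the seminorms $\sup_{-\pi\le\theta<\pi}|(\rho(X)F)(\tilde k(\theta))|$, $X\in U(\mathfrak{sl}_2(\mathbb C))$. A distribution on $I^\infty_{\mu,\nu}$ is a continuous linear functional on it. Put $F_\infty=e^{\pi i\mu/2}\rho(\tilde w)F$. For $f\in C_0^\infty(\mathbb R)$ let $\iota(f)\in I^\infty_{\mu,\nu}$ be the function given, at $(g,\theta)$ with $g=\begin{pmatrix}a&b\\c&d\end{pmatrix}$, by $e^{i\mu(\theta+\arg(J(g,i)/c))}|c|^{-2\nu-1}f(-d/c)$ if $c\ne0$ and by $0$ if $c=0$ (it is characterized by $\iota(f)(\tilde w\tilde u(-x))=f(x)$), and for a distribution $\lambda$ put $T^\lambda(f)=\lambda(\iota(f))$. A shifted lattice is a set $L=u_1+u_2\mathbb Z\subset\mathbb R$ with $u_1\in\mathbb R$, $u_2\in\mathbb R\setminus\{0\}$. Let $L^\vee=\{t\in\mathbb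 R: (l_1-l_2)t\in\mathbb Z\ \text{for all}\ l_1,l_2\in L\}$, and $\omega_L(t)=e^{2\pi i lt}$ for $t\in L^\vee$ (any $l\in L$). A distribution $\lambda$ on $I^\infty_{\mu,\nu}$ is quasi-$L$-periodic if $T^\lambda$ is a distribution on $\mathbb R$ with $T^\lambda(f(\cdot+t))=\omega_L(-t)T^\lambda(f)$ for all $t\in L^\vee$, $f\in C_0^\infty(\mathbb R)$. Let $\mathfrak M(L)$ be the space of functions $\alpha:L\to\mathbb C$ with $\alpha(l)=O(|l|^r)$ as $|l|\to\infty$ for some $r\in\mathbb R$, and $\mathfrak N(\mathbb Z_{\ge0})$ the space of finitely supported functions $\beta:\mathbb Z_{\ge0}\to\mathbb C$. With $\mathcal F(f)(y)=\int_{\mathbb R}f(x)e^{2\pi ixy}\,dx$, put $T_\alpha(f)=\sum_{l\in L}\alpha(l)\mathcal F(f)(l)$ for $f\in C_0^\infty(\mathbb R)$. For $f\in C_0^\infty(\mathbb R)$ put $\delta^{(n)}(f)=(-1)^nf^{(n)}(0)$ and $f_{\mu,s,\infty}(x)=e^{-\mathrm{sgn}(x)\pi i\mu/2}|x|^{-2s-1}f(-1/x)$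 ($x\ne0$). For $y\in\mathbb R$ the function $s\mapsto\mathcal F(f_{\mu,s,\infty})(y)$, holomorphic on $\mathrm{Re}(s)>0$, has a continuation to $\mathbb C$, entire if $y\ne0$ and meromorphic with possible poles only at $s\in-\tfrac12\mathbb Z_{\ge0}$ if $y=0$; let $\mathcal F_{\mu,\nu,\infty}(f)(y)$ be its value at $s=\nu$ if $y\neq0$ or $-2\nu\notin\mathbb Z_{\ge0}$, and if $y=0$ and $-2\nu=n\in\mathbb Z_{\ge0}$ put $$\mathcal F_{\mu,\nu,\infty}(f)(0)=\lim_{s\to-n/2}\Bigl(\mathcal F(f_{\mu,s,\infty})(0)-i^n\frac{2\cos(\pi(n+\mu)/2)}{n!\,(2s+n)}\delta^{(n)}(f)\Bigr).$$ Every $F\in I^\infty_{\mu,\nu}$ can be written as $F=\iota(f_1)+\iota(f_2)_\infty$ with $f_1,f_2\in C_0^\infty(\mathbb R)$; for $l\in\mathbb R$ the (continued) Jacquet integral is $\mathcal J_l(F)=\mathcal F(f_1)(l)+\mathcal F_{\mu,\nu,\infty}(f_2)(l)$, independently of the choice of $(f_1,f_2)$; for $\mathrm{Re}(\nu)>0$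 it equals $\int_{\mathbb R}F(\tilde w\tilde u(-x))e^{2\pi ilx}\,dx$. Finally let $\delta_\infty^{(m)}(F)=(\rho(E_+)^mF_\infty)(\tilde w)$ with $E_+=\begin{pmatrix}0&1\\0&0\end{pmatrix}$, $m\in\mathbb Z_{\ge0}$. **Proposition.** Let $L$ be a shifted lattice and $\mu,\nu\in\mathbb C$. For $\alpha\in\mathfrak M(L)$ and $\beta\in\mathfrak N(\mathbb Z_{\ge0})$ the series $T_\alpha(f)$ ($f\in C_0^\infty(\mathbb R)$) and $\sum_{l\in L}\alpha(l)\mathcal J_l(F)$ ($F\in I^\infty_{\mu,\nu}$) converge absolutely, and $$\lambda_{\alpha,\beta}(F)=\sum_{l\in L}\alpha(l)\mathcal J_l(F)+\sum_{m=0}^\infty\beta(m)\delta^{(m)}_\infty(F)\qquad(F\in I^\infty_{\mu,\nu})$$ defines a quasi-$L$-periodic distribution $\lambda_{\alpha,\beta}$ on $I^\infty_{\mu,\nu}$ with $T^{\lambda_{\alpha,\beta}}=T_\alpha$. Moreover, the map $(\alpha,\beta)\mapsto\lambda_{\alpha,\beta}$ is a $\mathbb C$-linear bijection from $\mathfrak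 M(L)\times\mathfrak N(\mathbb Z_{\ge0})$ onto the space of quasi-$L$-periodic distributions on $I^\infty_{\mu,\nu}$. -/

import Mathlib

open scoped MatrixGroups ContDiff Topology

noncomputable section

namespace QuasiAuto

/-! ### The universal covering group of `SL(2, ℝ)` -/

/-- The factor of automorphy `J(g, z) = c z + d`. -/
def autJ (g : SL(2, ℝ)) (z : UpperHalfPlane) : ℂ := (g 1 0 : ℂ) * (z : ℂ) + (g 1 1 : ℂ)

lemma autJ_eq_denom (g : SL(2, ℝ)) (z : UpperHalfPlane) :
    autJ g z = UpperHalfPlane.denom (g : GL (Fin 2) ℝ) z := by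
  simp [autJ, UpperHalfPlane.denom]

lemma autJ_ne_zero (g : SL(2, ℝ)) (z : UpperHalfPlane) : autJ g z ≠ 0 := by
  rw [autJ_eq_denom]; exact UpperHalfPlane.denom_ne_zero _ _

lemma autJ_mul (g h : SL(2, ℝ)) (z : UpperHalfPlane) :
    autJ (g * h) z = autJ g (h • z) * autJ h z := by
  rw [autJ_eq_denom, autJ_eq_denom, autJ_eq_denom]
  have := UpperHalfPlane.denom_cocycle_σ (g : GL (Fin 2) ℝ) (h : GL (Fin 2) ℝ) z
  have h2 : ∀ w, UpperHalfPlane.σ (h : GL (Fin 2) ℝ) w = w := by simp [UpperHalfPlane.σ]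
  rw [h2] at this
  rw [map_mul]
  exact this

/-- The universal covering group of `SL(2, ℝ)`: the pairs `(g, θ)` with
`J(g, i) e^{iθ} = |J(g, i)|`. -/
def Cover : Type :=
  {p : SL(2, ℝ) × ℝ //
    autJ p.1 UpperHalfPlane.I * Complex.exp (Complex.I * p.2) = (‖autJ p.1 UpperHalfPlane.I‖ : ℂ)}

/-- The matrix component of an element of the covering group. -/
def Cover.mat (g : Cover) : SL(2, ℝ) := g.1.1

/-- The angular component of an element of the covering group. -/
def Cover.ang (g : Cover) : ℝ := g.1.2

lemma exp_neg_arg (z : ℂ) (hz : z ≠ 0) :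
    Complex.exp (-(Complex.I * (z.arg : ℂ))) = (‖z‖ : ℂ) / z := by
  have h := Complex.norm_mul_exp_arg_mul_I z
  rw [eq_div_iff hz, Complex.exp_neg, mul_comm Complex.I]
  nth_rewrite 2 [← h]
  field_simp [Complex.exp_ne_zero]

/-- The group operation
`(g₁, θ₁) (g₂, θ₂) = (g₁ g₂, θ₁ + θ₂ - arg (J(g₁, g₂ i) / J(g₁, i)))`. -/
instance : Mul Cover where
  mul a b := ⟨(a.mat * b.mat, a.ang + b.ang -
      Complex.arg (autJ a.mat (b.mat • UpperHalfPlane.I) / autJ a.mat UpperHalfPlane.I)), by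
    have ha := a.2
    have hb := b.2
    change autJ a.mat UpperHalfPlane.I * Complex.exp (Complex.I * a.ang)
      = (‖autJ a.mat UpperHalfPlane.I‖ : ℂ) at ha
    change autJ b.mat UpperHalfPlane.I * Complex.exp (Complex.I * b.ang)
      = (‖autJ b.mat UpperHalfPlane.I‖ : ℂ) at hb
    have h1 := autJ_ne_zero a.mat UpperHalfPlane.I
    have h2 := autJ_ne_zero a.mat (b.mat • UpperHalfPlane.I)
    have h3 : (‖autJ a.mat UpperHalfPlane.I‖ : ℂ) ≠ 0 := by simpa using h1
    have he := exp_neg_arg _ (div_ne_zero h2 h1)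
    simp only [autJ_mul]
    push_cast
    rw [show ∀ p q r : ℂ, Complex.I * (p + q - r)
      = Complex.I * p + Complex.I * q + -(Complex.I * r) by intros; ring,
      Complex.exp_add, Complex.exp_add, he, norm_mul, norm_div]
    push_cast
    rw [← hb]
    field_simp
    rw [← ha]
    ring⟩

lemma Cover.mul_mat (a b : Cover) : (a * b).mat = a.mat * b.mat := rfl

lemma Cover.mul_ang (a b : Cover) : (a * b).ang = a.ang + b.ang -
    Complex.arg (autJ a.mat (b.mat • UpperHalfPlane.I) / autJ a.mat UpperHalfPlane.I) := rfl

/-- `u(x) = (1, x; 0, 1)`. -/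
def uMat (x : ℝ) : SL(2, ℝ) := ⟨!![1, x; 0, 1], by simp⟩

/-- `ū(x) = (1, 0; x, 1)`. -/
def ubMat (x : ℝ) : SL(2, ℝ) := ⟨!![1, 0; x, 1], by simp⟩

/-- `a(y) = (√y, 0; 0, 1/√y)` for `y > 0`. -/
def aMat (y : ℝ) (hy : 0 < y) : SL(2, ℝ) :=
  ⟨!![Real.sqrt y, 0; 0, 1 / Real.sqrt y], by
    have := (Real.sqrt_pos.2 hy).ne'
    simp [this]⟩

/-- `k(θ) = (cos θ, sin θ; -sin θ, cos θ)`. -/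
def kMat (θ : ℝ) : SL(2, ℝ) :=
  ⟨!![Real.cos θ, Real.sin θ; -Real.sin θ, Real.cos θ], by
    simp [Matrix.det_fin_two, ← sq]⟩

/-- `ũ(x) = (u(x), 0)`. -/
def uT (x : ℝ) : Cover := ⟨(uMat x, 0), by simp [autJ, uMat]⟩

/-- `ã(y) = (a(y), 0)`. -/
def aT (y : ℝ) (hy : 0 < y) : Cover := ⟨(aMat y hy, 0), by
  simp [autJ, aMat, abs_of_pos (Real.sqrt_pos.2 hy)]⟩

lemma autJ_kMat (θ : ℝ) :
    autJ (kMat θ) UpperHalfPlane.I = Complex.exp (-(Complex.I * θ)) := by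
  rw [show -(Complex.I * (θ : ℂ)) = ((-θ : ℝ) : ℂ) * Complex.I by push_cast; ring,
    Complex.exp_mul_I]
  simp [autJ, kMat]
  ring

/-- `k̃(θ) = (k(θ), θ)`. -/
def kT (θ : ℝ) : Cover := ⟨(kMat θ, θ), by
  simp only [autJ_kMat]
  rw [← Complex.exp_add, Complex.norm_exp]
  simp⟩

/-- The lift `(ū(x), -arg (1 + i x))` of `ū(x)`, which is `w̃ ũ(-x) w̃⁻¹`. -/
def ubT (x : ℝ) : Cover := ⟨(ubMat x, -Complex.arg (1 + Complex.I * x)), by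
  have h : autJ (ubMat x) UpperHalfPlane.I = 1 + Complex.I * x := by
    simp [autJ, ubMat]; ring
  have h0 : (1 + Complex.I * x : ℂ) ≠ 0 := h ▸ autJ_ne_zero _ _
  simp only [h]
  push_cast
  rw [mul_neg, exp_neg_arg _ h0]
  field_simp⟩

/-- `w̃ = k̃(-π/2)`, a lift of `w = (0, -1; 1, 0)`. -/
def wT : Cover := kT (-(Real.pi / 2))

/-! ### The action of the enveloping algebra and the principal series -/

/-- A function on the covering group is smooth if it is smooth in the Iwasawa coordinates
`(x, s, θ) ↦ ũ(x) ã(e^s) k̃(θ)`, a global chart `ℝ³ → Cover`. -/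
def IsSmooth (F : Cover → ℂ) : Prop :=
  ContDiff ℝ ∞ (fun p : ℝ × ℝ × ℝ =>
    F (uT p.1 * aT (Real.exp p.2.1) (Real.exp_pos _) * kT p.2.2))

/-- The standard basis `H, E₊, E₋` of `sl(2, ℝ)`. -/
inductive Gen
  | H
  | Ep
  | Em

/-- The one-parameter subgroups `exp(tH) = ã(e^{2t})`, `exp(tE₊) = ũ(t)`, `exp(tE₋) = ū(t)` of the
covering group. -/
def expGen : Gen → ℝ → Cover
  | .H, t => aT (Real.exp (2 * t)) (Real.exp_pos _)
  | .Ep, t => uT t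
  | .Em, t => ubT t

/-- `(ρ(X) F)(g) = d/dt F(g exp(tX))` at `t = 0`. -/
def rhoGen (X : Gen) (F : Cover → ℂ) : Cover → ℂ :=
  fun g => deriv (fun t : ℝ => F (g * expGen X t)) 0

/-- `ρ(X₁ ⋯ Xₖ) F = ρ(X₁) (⋯ (ρ(Xₖ) F))` for a word `X₁ ⋯ Xₖ` in `H, E₊, E₋`. -/
def rhoWord (w : List Gen) (F : Cover → ℂ) : Cover → ℂ := w.foldr rhoGen F

/-- The action `ρ(X)` of an element of the enveloping algebra `U(sl(2, ℂ))`; as this algebra is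
generated by `H, E₊, E₋`, its elements are given by finite `ℂ`-linear combinations of words. -/
def rhoEnv (X : List Gen →₀ ℂ) (F : Cover → ℂ) : Cover → ℂ :=
  fun g => X.sum fun w a => a * rhoWord w F g

/-- The seminorm `Q_X(F) = sup_{-π ≤ θ < π} |(ρ(X) F)(k̃(θ))|`. -/
def seminormQ (X : List Gen →₀ ℂ) (F : Cover → ℂ) : ℝ :=
  ⨆ θ : Set.Ico (-Real.pi) Real.pi, ‖rhoEnv X F (kT θ)‖

/-- The space `I^∞_{μ,ν}` of smooth functions `F` on the covering group with
`F(ũ(x) ã(y) k̃(mπ) g) = e^{π m i μ} y^{ν + 1/2} F(g)`. -/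
def PSeries (μ ν : ℂ) : Submodule ℂ (Cover → ℂ) where
  carrier := {F | IsSmooth F ∧ ∀ (x y : ℝ) (hy : 0 < y) (m : ℤ) (g : Cover),
    F (uT x * aT y hy * kT (m * Real.pi) * g) =
      Complex.exp (Real.pi * m * Complex.I * μ) * (y : ℂ) ^ (ν + 1 / 2) * F g}
  zero_mem' := ⟨by simpa [IsSmooth] using contDiff_const, by simp⟩
  add_mem' := by
    rintro F G ⟨hF, hF'⟩ ⟨hG, hG'⟩
    refine ⟨ContDiff.add hF hG, fun x y hy m g => ?_⟩
    simp only [Pi.add_apply, hF', hG']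
    ring
  smul_mem' := by
    rintro c F ⟨hF, hF'⟩
    refine ⟨ContDiff.const_smul c hF, fun x y hy m g => ?_⟩
    simp only [Pi.smul_apply, hF', smul_eq_mul]
    ring

/-- Continuity of a linear functional on `I^∞_{μ,ν}` with respect to the topology defined by the
seminorms `Q_X`, `X ∈ U(sl(2, ℂ))`. -/
def IsPSDistribution {μ ν : ℂ} (lam : PSeries μ ν →ₗ[ℂ] ℂ) : Prop :=
  ∃ c : ℝ, 0 < c ∧ ∃ S : Finset (List Gen →₀ ℂ), ∀ F : PSeries μ ν,
    ‖lam F‖ ≤ c * ∑ X ∈ S, seminormQ X F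

/-- The involution `F ↦ F_∞ = e^{π i μ / 2} ρ(w̃) F`. -/
def invol (μ : ℂ) (F : Cover → ℂ) : Cover → ℂ :=
  fun g => Complex.exp (Real.pi * Complex.I * μ / 2) * F (g * wT)

/-! ### Distributions on `ℝ` -/

/-- The space `C₀^∞(ℝ)` of complex-valued smooth functions with compact support. -/
abbrev TestFn : Type := TestFunction (⊤ : TopologicalSpace.Opens ℝ) ℂ ⊤

/-- A linear functional on `C₀^∞(ℝ)` is a distribution if on functions supported in `[-u, u]` it is
bounded by finitely many sup norms of derivatives. -/
def IsDistribution (T : TestFn →ₗ[ℂ] ℂ) : Prop :=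
  ∀ u : ℝ, 0 < u → ∃ (m : ℕ) (c : ℝ), 0 < c ∧ ∀ f : TestFn,
    tsupport (f : ℝ → ℂ) ⊆ {x | |x| ≤ u} →
      ‖T f‖ ≤ c * ∑ i ∈ Finset.range (m + 1), ⨆ x : ℝ, ‖iteratedDeriv i f x‖

/-- The translate `x ↦ f(x + t)`. -/
def shift (t : ℝ) (f : TestFn) : TestFn :=
  ⟨fun x => f (x + t), f.contDiff.comp (contDiff_id.add contDiff_const),
    f.hasCompactSupport.comp_homeomorph (Homeomorph.addRight t), fun _ _ => trivial⟩

/-- `L = u₁ + u₂ ℤ` with `u₂ ≠ 0`. -/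
def IsShiftedLattice (L : Set ℝ) : Prop :=
  ∃ u₁ u₂ : ℝ, u₂ ≠ 0 ∧ L = Set.range fun n : ℤ => u₁ + u₂ * n

/-- The dual lattice `L^∨ = {t | (l₁ - l₂) t ∈ ℤ for all l₁, l₂ ∈ L}`. -/
def dualLattice (L : Set ℝ) : Set ℝ :=
  {t | ∀ l₁ ∈ L, ∀ l₂ ∈ L, ∃ n : ℤ, (l₁ - l₂) * t = n}

/-- Membership in `D'(L^∨ \ ℝ; ω_L)`: a distribution `T` with `T(f(· + t)) = ω_L(-t) T(f)` for
`t ∈ L^∨`, where `ω_L(-t) = e^{-2π i l t}` for any `l ∈ L`. -/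
def IsQuasiPeriodic (L : Set ℝ) (T : TestFn →ₗ[ℂ] ℂ) : Prop :=
  IsDistribution T ∧ ∀ t ∈ dualLattice L, ∀ l ∈ L, ∀ f : TestFn,
    T (shift t f) = Complex.exp (-(2 * Real.pi * Complex.I * l * t)) * T f

/-- The Fourier transform `∫ f(x) e^{2π i x y} dx`. -/
def fourierT (f : ℝ → ℂ) (y : ℝ) : ℂ :=
  ∫ x : ℝ, f x * Complex.exp (2 * Real.pi * Complex.I * x * y)

/-- The space `M(L)` of functions on `L` of polynomial growth: `α(l) = O(|l|^r)` as `|l| → ∞` for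
some real `r`. -/
def polyGrowth (L : Set ℝ) : Submodule ℂ (L → ℂ) where
  carrier := {α | ∃ r : ℝ, α =O[Filter.comap (fun l : L => |(l : ℝ)|) Filter.atTop]
    fun l : L => |(l : ℝ)| ^ r}
  zero_mem' := ⟨0, Asymptotics.isBigO_zero _ _⟩
  add_mem' := by
    rintro α β ⟨r, hα⟩ ⟨s, hβ⟩
    have key : ∀ a b : ℝ, a ≤ b →
        (fun l : L => |(l : ℝ)| ^ a) =O[Filter.comap (fun l : L => |(l : ℝ)|) Filter.atTop]
          fun l : L => |(l : ℝ)| ^ b := by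
      intro a b hab
      refine Asymptotics.IsBigO.of_bound 1 ?_
      filter_upwards [Filter.tendsto_comap.eventually (Filter.eventually_ge_atTop (1 : ℝ))]
        with l hl
      rw [one_mul, Real.norm_of_nonneg (by positivity), Real.norm_of_nonneg (by positivity)]
      exact Real.rpow_le_rpow_of_exponent_le hl hab
    exact ⟨max r s, (hα.trans (key _ _ (le_max_left _ _))).add
      (hβ.trans (key _ _ (le_max_right _ _)))⟩
  smul_mem' := by
    rintro c α ⟨r, hα⟩
    exact ⟨r, hα.const_smul_left c⟩

/-- `T_α(f) = ∑_{l ∈ L} α(l) F(f)(l)`. -/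
def fourierSeries {L : Set ℝ} (α : L → ℂ) (f : TestFn) : ℂ :=
  ∑' l : L, α l * fourierT f l

/-! ### The embedding `ι` of `C₀^∞(ℝ)` in the principal series -/

/-- `ι(f)(g, θ) = e^{i μ (θ + arg (J(g, i) / c))} |c|^{-2ν-1} f(-d/c)` if `c ≠ 0`, and `0` if
`c = 0`, for `g = (a, b; c, d)`. -/
def iotaFun (μ ν : ℂ) (f : ℝ → ℂ) (g : Cover) : ℂ :=
  if g.mat 1 0 = 0 then 0
  else Complex.exp (Complex.I * μ *
      (g.ang + Complex.arg (autJ g.mat UpperHalfPlane.I / (g.mat 1 0 : ℂ)))) *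
    ((|g.mat 1 0| : ℝ) : ℂ) ^ (-2 * ν - 1) * f (-(g.mat 1 1) / g.mat 1 0)

lemma autJ_I (g : SL(2, ℝ)) :
    autJ g UpperHalfPlane.I = (g 1 0 : ℂ) * Complex.I + (g 1 1 : ℂ) := by
  simp [autJ]

lemma mul_row (g h : SL(2, ℝ)) (j : Fin 2) :
    (g * h) 1 j = g 1 0 * h 0 j + g 1 1 * h 1 j := by
  rw [Matrix.SpecialLinearGroup.coe_mul, Matrix.mul_apply, Fin.sum_univ_two]

lemma parabolic_ne (z : Cover) (hz : z.mat 1 0 = 0) : z.mat 1 1 ≠ 0 := by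
  intro h
  have := autJ_ne_zero z.mat UpperHalfPlane.I
  rw [autJ_I, hz, h] at this
  simp at this

lemma parabolic_mul_ang (z g : Cover) (hz : z.mat 1 0 = 0) :
    (z * g).ang = z.ang + g.ang := by
  have h : ∀ w, autJ z.mat w = (z.mat 1 1 : ℂ) := fun w => by simp [autJ, hz]
  have h1 : (z.mat 1 1 : ℂ) ≠ 0 := by exact_mod_cast parabolic_ne z hz
  rw [Cover.mul_ang, h, h, div_self h1]
  simp

lemma parabolic_mul_mat (z g : Cover) (hz : z.mat 1 0 = 0) (j : Fin 2) :
    (z * g).mat 1 j = z.mat 1 1 * g.mat 1 j := by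
  rw [Cover.mul_mat, mul_row, hz]
  simp

lemma ua_c (x y : ℝ) (hy : 0 < y) : (uT x * aT y hy).mat 1 0 = 0 := by
  rw [parabolic_mul_mat _ _ (by simp [uT, uMat, Cover.mat])]
  simp [aT, aMat, Cover.mat]

lemma ua_d (x y : ℝ) (hy : 0 < y) : (uT x * aT y hy).mat 1 1 = 1 / Real.sqrt y := by
  rw [parabolic_mul_mat _ _ (by simp [uT, uMat, Cover.mat])]
  simp [uT, uMat, aT, aMat, Cover.mat]

lemma ua_ang (x y : ℝ) (hy : 0 < y) : (uT x * aT y hy).ang = 0 := by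
  rw [parabolic_mul_ang _ _ (by simp [uT, uMat, Cover.mat])]
  simp [uT, aT, Cover.ang]

lemma uak_ang (x y : ℝ) (hy : 0 < y) (θ : ℝ) : (uT x * aT y hy * kT θ).ang = θ := by
  rw [parabolic_mul_ang _ _ (ua_c x y hy), ua_ang]
  simp [kT, Cover.ang]

lemma uak_c (x y : ℝ) (hy : 0 < y) (θ : ℝ) :
    (uT x * aT y hy * kT θ).mat 1 0 = 1 / Real.sqrt y * -Real.sin θ := by
  rw [parabolic_mul_mat _ _ (ua_c x y hy), ua_d]
  rfl

lemma uak_d (x y : ℝ) (hy : 0 < y) (θ : ℝ) :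
    (uT x * aT y hy * kT θ).mat 1 1 = 1 / Real.sqrt y * Real.cos θ := by
  rw [parabolic_mul_mat _ _ (ua_c x y hy), ua_d]
  rfl

lemma iotaFun_equivariant (μ ν : ℂ) (f : ℝ → ℂ) (x y : ℝ) (hy : 0 < y) (m : ℤ) (g : Cover) :
    iotaFun μ ν f (uT x * aT y hy * kT (m * Real.pi) * g) =
      Complex.exp (Real.pi * m * Complex.I * μ) * (y : ℂ) ^ (ν + 1 / 2) * iotaFun μ ν f g := by
  set z := uT x * aT y hy * kT (m * Real.pi) with hz
  have hc : z.mat 1 0 = 0 := by rw [hz, uak_c, Real.sin_int_mul_pi]; simp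
  have hd : z.mat 1 1 ≠ 0 := parabolic_ne z hc
  have hdC : (z.mat 1 1 : ℂ) ≠ 0 := by exact_mod_cast hd
  have hcos : |Real.cos (m * Real.pi)| = 1 := by
    rw [Real.abs_cos_int_mul_pi]
  have habs : |z.mat 1 1| = 1 / Real.sqrt y := by
    rw [hz, uak_d, abs_mul, hcos, abs_of_pos (by positivity), mul_one]
  have hang : z.ang = m * Real.pi := by rw [hz, uak_ang]
  unfold iotaFun
  rw [autJ_I, autJ_I, parabolic_mul_mat _ _ hc, parabolic_mul_mat _ _ hc,
    parabolic_mul_ang _ _ hc, hang, abs_mul, habs]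
  by_cases h0 : g.mat 1 0 = 0
  · simp [h0]
  have h0C : (g.mat 1 0 : ℂ) ≠ 0 := by exact_mod_cast h0
  rw [if_neg h0, if_neg (mul_ne_zero hd h0)]
  have e1 : ((((z.mat 1 1 * g.mat 1 0 : ℝ)) : ℂ) * Complex.I + ((z.mat 1 1 * g.mat 1 1 : ℝ) : ℂ)) /
      ((z.mat 1 1 * g.mat 1 0 : ℝ) : ℂ) =
      ((g.mat 1 0 : ℂ) * Complex.I + (g.mat 1 1 : ℂ)) / (g.mat 1 0 : ℂ) := by
    push_cast
    field_simp
  have e2 : -(z.mat 1 1 * g.mat 1 1) / (z.mat 1 1 * g.mat 1 0) =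
      -(g.mat 1 1) / g.mat 1 0 := by
    field_simp
  have e3 : ((1 / Real.sqrt y : ℝ) : ℂ) ^ (-2 * ν - 1) = (y : ℂ) ^ (ν + 1 / 2) := by
    have hs : 0 < 1 / Real.sqrt y := by positivity
    have hyC : (y : ℂ) ≠ 0 := by exact_mod_cast hy.ne'
    have hsC : ((1 / Real.sqrt y : ℝ) : ℂ) ≠ 0 := by exact_mod_cast hs.ne'
    rw [Complex.cpow_def_of_ne_zero hyC, Complex.cpow_def_of_ne_zero hsC,
      ← Complex.ofReal_log hy.le, ← Complex.ofReal_log hs.le, one_div, Real.log_inv,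
      Real.log_sqrt hy.le]
    congr 1
    push_cast
    ring
  rw [e1, e2, Complex.ofReal_mul, Complex.mul_cpow_ofReal_nonneg (by positivity) (abs_nonneg _), e3]
  push_cast
  rw [show ∀ a : ℂ, Complex.I * μ * (m * Real.pi + g.ang + a) =
    Real.pi * m * Complex.I * μ + Complex.I * μ * (g.ang + a) by intro a; ring, Complex.exp_add]
  ring

lemma iotaFun_smooth (μ ν : ℂ) (f : TestFn) : IsSmooth (iotaFun μ ν f) := by
  unfold IsSmooth iotaFun
  simp only [autJ_I, uak_c, uak_d, uak_ang]
  rw [contDiff_iff_contDiffAt]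
  intro p
  set c : ℝ × ℝ × ℝ → ℝ := fun p => 1 / Real.sqrt (Real.exp p.2.1) * -Real.sin p.2.2 with hc
  set d : ℝ × ℝ × ℝ → ℝ := fun p => 1 / Real.sqrt (Real.exp p.2.1) * Real.cos p.2.2 with hd
  have hr : ContDiff ℝ ∞ fun p : ℝ × ℝ × ℝ => 1 / Real.sqrt (Real.exp p.2.1) := by
    have h1 : ContDiff ℝ ∞ fun p : ℝ × ℝ × ℝ => Real.exp (-(p.2.1 / 2)) := by fun_prop
    have h2 : (fun p : ℝ × ℝ × ℝ => 1 / Real.sqrt (Real.exp p.2.1)) =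
        fun p : ℝ × ℝ × ℝ => Real.exp (-(p.2.1 / 2)) := by
      funext q
      rw [Real.exp_neg, Real.exp_half, one_div]
    rw [h2]
    exact h1
  have hcs : ContDiff ℝ ∞ c := hr.mul (Real.contDiff_sin.comp (by fun_prop)).neg
  have hds : ContDiff ℝ ∞ d := hr.mul (Real.contDiff_cos.comp (by fun_prop))
  change ContDiffAt ℝ ∞ (fun p : ℝ × ℝ × ℝ => if c p = 0 then 0 else
    Complex.exp (Complex.I * μ *
      (p.2.2 + Complex.arg (((c p : ℂ) * Complex.I + (d p : ℂ)) / (c p : ℂ)))) *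
    ((|c p| : ℝ) : ℂ) ^ (-2 * ν - 1) * f (-(d p) / c p)) p
  by_cases h0 : c p = 0
  · have hd0 : d p ≠ 0 := by
      have hpos : 0 < 1 / Real.sqrt (Real.exp p.2.1) := by positivity
      have hs : Real.sin p.2.2 = 0 := by
        rcases mul_eq_zero.1 h0 with h | h
        · exact absurd h hpos.ne'
        · exact neg_eq_zero.1 h
      have hcos : Real.cos p.2.2 ≠ 0 := by
        intro h
        have := Real.sin_sq_add_cos_sq p.2.2
        rw [hs, h] at this
        norm_num at this
      exact mul_ne_zero hpos.ne' hcos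
    obtain ⟨R, hR⟩ := f.hasCompactSupport.isCompact.isBounded.subset_closedBall (0 : ℝ)
    have hev : ∀ᶠ q in 𝓝 p, |c q| * R < |d q| := by
      refine ContinuousAt.eventually_lt ?_ ?_ ?_
      · exact (hcs.continuous.abs.mul continuous_const).continuousAt
      · exact hds.continuous.abs.continuousAt
      · simpa [h0] using hd0
    refine (contDiffAt_const (c := (0 : ℂ))).congr_of_eventuallyEq ?_
    filter_upwards [hev] with q hq
    split_ifs with hq0
    · rfl
    · have : f (-(d q) / c q) = 0 := by
        by_contra hne
        have hmem := hR (subset_tsupport _ hne)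
        rw [Metric.mem_closedBall, dist_zero_right, Real.norm_eq_abs, abs_div, abs_neg,
          div_le_iff₀ (abs_pos.2 hq0)] at hmem
        linarith
      rw [this, mul_zero]
  · have h0C : (c p : ℂ) ≠ 0 := by exact_mod_cast h0
    have hcC : ContDiff ℝ ∞ fun q => (c q : ℂ) := Complex.ofRealCLM.contDiff.comp hcs
    have hdC : ContDiff ℝ ∞ fun q => (d q : ℂ) := Complex.ofRealCLM.contDiff.comp hds
    have hev : ∀ᶠ q in 𝓝 p, c q ≠ 0 := hcs.continuous.continuousAt.eventually_ne h0
    have hlog : ContDiffAt ℝ ∞ (fun q =>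
        Complex.log (((c q : ℂ) * Complex.I + (d q : ℂ)) / (c q : ℂ))) p := by
      have hin : ContDiffAt ℝ ∞ (fun q =>
          ((c q : ℂ) * Complex.I + (d q : ℂ)) / (c q : ℂ)) p := by
        simp only [div_eq_mul_inv]
        exact ((hcC.mul contDiff_const).add hdC).contDiffAt.mul (hcC.contDiffAt.inv h0C)
      have hmem : ((c p : ℂ) * Complex.I + (d p : ℂ)) / (c p : ℂ) ∈ Complex.slitPlane := by
        right
        rw [add_div, mul_div_right_comm, div_self h0C, one_mul, ← Complex.ofReal_div]
        simp
      exact (((Complex.contDiffAt_log hmem).restrict_scalars ℝ).comp p hin :)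
    have harg : ContDiffAt ℝ ∞ (fun q =>
        ((Complex.log (((c q : ℂ) * Complex.I + (d q : ℂ)) / (c q : ℂ))).im : ℂ)) p :=
      (Complex.ofRealCLM.contDiff.comp Complex.imCLM.contDiff).contDiffAt.comp p hlog
    have hlc : ContDiffAt ℝ ∞ (fun q => (Real.log (c q) : ℂ)) p :=
      Complex.ofRealCLM.contDiff.contDiffAt.comp p (hcs.contDiffAt.log h0)
    have hexp : ContDiff ℝ ∞ Complex.exp := Complex.contDiff_exp
    have hth : ContDiff ℝ ∞ fun q : ℝ × ℝ × ℝ => (q.2.2 : ℂ) :=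
      Complex.ofRealCLM.contDiff.comp (by fun_prop)
    have hmain : ContDiffAt ℝ ∞ (fun q : ℝ × ℝ × ℝ =>
        Complex.exp (Complex.I * μ * (q.2.2 +
          ((Complex.log (((c q : ℂ) * Complex.I + (d q : ℂ)) / (c q : ℂ))).im : ℂ))) *
        Complex.exp ((Real.log (c q) : ℂ) * (-2 * ν - 1)) * f (-(d q) / c q)) p := by
      refine ((hexp.contDiffAt.comp p (contDiffAt_const.mul (hth.contDiffAt.add harg))).mul
        (hexp.contDiffAt.comp p (hlc.mul contDiffAt_const))).mul ?_
      exact ContDiffAt.comp p (g := (f : ℝ → ℂ)) f.contDiff.contDiffAt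
        (hds.neg.contDiffAt.div hcs.contDiffAt h0)
    refine hmain.congr_of_eventuallyEq ?_
    filter_upwards [hev] with q hq
    have hq' : ((|c q| : ℝ) : ℂ) ≠ 0 := by exact_mod_cast (abs_pos.2 hq).ne'
    rw [if_neg hq, Complex.log_im, Complex.cpow_def_of_ne_zero hq',
      ← Complex.ofReal_log (abs_nonneg _), Real.log_abs]

/-- The embedding `ι : C₀^∞(ℝ) → I^∞_{μ,ν}`. -/
def iota (μ ν : ℂ) : TestFn →ₗ[ℂ] PSeries μ ν where
  toFun f := ⟨iotaFun μ ν f, iotaFun_smooth μ ν f, iotaFun_equivariant μ ν f⟩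
  map_add' f g := by
    ext x
    change iotaFun μ ν (fun x => f x + g x) x = iotaFun μ ν f x + iotaFun μ ν g x
    unfold iotaFun
    split_ifs <;> ring
  map_smul' a f := by
    ext x
    change iotaFun μ ν (fun x => a * f x) x = a * iotaFun μ ν f x
    unfold iotaFun
    split_ifs <;> ring

/-- `T^λ(f) = λ(ι(f))`. -/
def restr {μ ν : ℂ} (lam : PSeries μ ν →ₗ[ℂ] ℂ) : TestFn →ₗ[ℂ] ℂ := lam ∘ₗ iota μ ν

/-! ### The Jacquet integrals and the delta functionals -/

/-- `f_{μ,ν,∞}(x) = e^{-sgn(x) π i μ / 2} |x|^{-2ν-1} f(-1/x)` for `x ≠ 0`, extended by `0`. -/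
def fInf (μ ν : ℂ) (f : ℝ → ℂ) (x : ℝ) : ℂ :=
  if x = 0 then 0
  else Complex.exp (-(Real.sign x * Real.pi * Complex.I * μ / 2)) *
    ((|x| : ℝ) : ℂ) ^ (-2 * ν - 1) * f (-1 / x)

open Classical in
/-- The holomorphic continuation to `U` of a function `φ` given on `Re s > 0`. It is used for open
connected sets `U` containing this half plane, where it is unique; the value is `0` if there is no
continuation. -/
def holoExt (U : Set ℂ) (φ : ℂ → ℂ) : ℂ → ℂ :=
  if h : ∃ Φ : ℂ → ℂ, DifferentiableOn ℂ Φ U ∧ ∀ s : ℂ, 0 < s.re → Φ s = φ s then h.choose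
  else 0

/-- The complement of the possible poles `0, -1/2, -1, -3/2, …` of `s ↦ F(f_{μ,s,∞})(0)`. -/
def regularSet : Set ℂ := {s | ∀ n : ℕ, -2 * s ≠ n}

/-- The derivatives `δ^{(n)}(f) = (-1)^n f^{(n)}(0)` of the Dirac distribution. -/
def deltaDeriv (n : ℕ) (f : TestFn) : ℂ := (-1) ^ n * iteratedDeriv n f 0

open Classical in
/-- The twisted Fourier transform of `f` at `y`: the value at `ν` of the continuation of
`s ↦ F(f_{μ,s,∞})(y)`, which is entire if `y ≠ 0` and meromorphic if `y = 0`. If `y = 0` and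
`-2ν = n` is a natural number, it is the limit at `ν` of this continuation minus its polar term
`i^n 2 cos(π(n + μ)/2) / (n! (2s + n)) δ^{(n)}(f)`. -/
def twistedFourier (μ ν : ℂ) (f : TestFn) (y : ℝ) : ℂ :=
  if y ≠ 0 then holoExt Set.univ (fun s => fourierT (fInf μ s f) y) ν
  else if h : ∃ n : ℕ, -2 * ν = n then
    Filter.limUnder (𝓝[≠] ν) fun s =>
      holoExt regularSet (fun s => fourierT (fInf μ s f) 0) s -
        Complex.I ^ h.choose * (2 * Complex.cos (Real.pi * (h.choose + μ) / 2) /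
          (h.choose.factorial * (2 * s + h.choose))) * deltaDeriv h.choose f
  else holoExt regularSet (fun s => fourierT (fInf μ s f) 0) ν

/-- `(f₁, f₂)` is a partition of `F` if `ι(f₁) + ι(f₂)_∞ = F`. -/
def IsPartition (μ ν : ℂ) (F : Cover → ℂ) (f : TestFn × TestFn) : Prop :=
  iotaFun μ ν f.1 + invol μ (iotaFun μ ν f.2) = F

open Classical in
/-- The Jacquet integral, continued to all `ν`: it is `F(f₁)(l) + F_{μ,ν,∞}(f₂)(l)` for any
partition `(f₁, f₂)` of `F`, and does not depend on the partition. -/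
def jacquet (μ ν : ℂ) (l : ℝ) (F : Cover → ℂ) : ℂ :=
  if h : ∃ f : TestFn × TestFn, IsPartition μ ν F f then
    fourierT h.choose.1 l + twistedFourier μ ν h.choose.2 l
  else 0

/-- `δ_∞^{(m)}(F) = (ρ(E₊)^m F_∞)(w̃)`. -/
def deltaInf (μ : ℂ) (m : ℕ) (F : Cover → ℂ) : ℂ :=
  rhoWord (List.replicate m Gen.Ep) (invol μ F) wT

/-- `λ_{α,β}(F) = ∑_{l ∈ L} α(l) J_l(F) + ∑_m β(m) δ_∞^{(m)}(F)`. -/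
def fourierExpansion (μ ν : ℂ) {L : Set ℝ} (α : L → ℂ) (β : ℕ →₀ ℂ) (F : Cover → ℂ) : ℂ :=
  (∑' l : L, α l * jacquet μ ν l F) + β.sum fun m b => b * deltaInf μ m F

/-! ### Quasi-`L`-periodic distributions on `I^∞_{μ,ν}` -/

lemma seminormQ_nonneg (X : List Gen →₀ ℂ) (F : Cover → ℂ) : 0 ≤ seminormQ X F :=
  Real.iSup_nonneg fun _ => norm_nonneg _

lemma IsPSDistribution.zero {μ ν : ℂ} : IsPSDistribution (0 : PSeries μ ν →ₗ[ℂ] ℂ) :=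
  ⟨1, one_pos, ∅, by simp⟩

lemma IsPSDistribution.add {μ ν : ℂ} {l₁ l₂ : PSeries μ ν →ₗ[ℂ] ℂ}
    (h₁ : IsPSDistribution l₁) (h₂ : IsPSDistribution l₂) : IsPSDistribution (l₁ + l₂) := by
  classical
  obtain ⟨c₁, hc₁, S₁, H₁⟩ := h₁
  obtain ⟨c₂, hc₂, S₂, H₂⟩ := h₂
  refine ⟨c₁ + c₂, by positivity, S₁ ∪ S₂, fun F => ?_⟩
  have e₁ : ∑ X ∈ S₁, seminormQ X F ≤ ∑ X ∈ S₁ ∪ S₂, seminormQ X F :=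
    Finset.sum_le_sum_of_subset_of_nonneg Finset.subset_union_left
      fun _ _ _ => seminormQ_nonneg _ _
  have e₂ : ∑ X ∈ S₂, seminormQ X F ≤ ∑ X ∈ S₁ ∪ S₂, seminormQ X F :=
    Finset.sum_le_sum_of_subset_of_nonneg Finset.subset_union_right
      fun _ _ _ => seminormQ_nonneg _ _
  calc ‖l₁ F + l₂ F‖ ≤ ‖l₁ F‖ + ‖l₂ F‖ := norm_add_le _ _
    _ ≤ c₁ * ∑ X ∈ S₁ ∪ S₂, seminormQ X F + c₂ * ∑ X ∈ S₁ ∪ S₂, seminormQ X F :=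
      add_le_add ((H₁ F).trans (mul_le_mul_of_nonneg_left e₁ hc₁.le))
        ((H₂ F).trans (mul_le_mul_of_nonneg_left e₂ hc₂.le))
    _ = _ := by ring

lemma IsPSDistribution.smul {μ ν : ℂ} (a : ℂ) {l : PSeries μ ν →ₗ[ℂ] ℂ}
    (h : IsPSDistribution l) : IsPSDistribution (a • l) := by
  obtain ⟨c, hc, S, H⟩ := h
  refine ⟨(‖a‖ + 1) * c, by positivity, S, fun F => ?_⟩
  have hS : 0 ≤ ∑ X ∈ S, seminormQ X F := Finset.sum_nonneg fun _ _ => seminormQ_nonneg _ _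
  calc ‖a * l F‖ = ‖a‖ * ‖l F‖ := norm_mul _ _
    _ ≤ (‖a‖ + 1) * (c * ∑ X ∈ S, seminormQ X F) :=
      mul_le_mul (by linarith) (H F) (norm_nonneg _) (by positivity)
    _ = _ := by ring

lemma supNorm_nonneg (i : ℕ) (f : TestFn) : 0 ≤ ⨆ x : ℝ, ‖iteratedDeriv i f x‖ :=
  Real.iSup_nonneg fun _ => norm_nonneg _

lemma IsDistribution.zero : IsDistribution 0 := by
  refine fun u _ => ⟨0, 1, one_pos, fun f _ => ?_⟩
  have := supNorm_nonneg 0 f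
  simpa using this

lemma IsDistribution.add {T₁ T₂ : TestFn →ₗ[ℂ] ℂ} (h₁ : IsDistribution T₁)
    (h₂ : IsDistribution T₂) : IsDistribution (T₁ + T₂) := by
  intro u hu
  obtain ⟨m₁, c₁, hc₁, H₁⟩ := h₁ u hu
  obtain ⟨m₂, c₂, hc₂, H₂⟩ := h₂ u hu
  refine ⟨max m₁ m₂, c₁ + c₂, by positivity, fun f hf => ?_⟩
  have key : ∀ m, m ≤ max m₁ m₂ →
      ∑ i ∈ Finset.range (m + 1), ⨆ x : ℝ, ‖iteratedDeriv i f x‖ ≤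
        ∑ i ∈ Finset.range (max m₁ m₂ + 1), ⨆ x : ℝ, ‖iteratedDeriv i f x‖ := fun m hm =>
    Finset.sum_le_sum_of_subset_of_nonneg (Finset.range_mono (by omega))
      fun _ _ _ => supNorm_nonneg _ _
  calc ‖T₁ f + T₂ f‖ ≤ ‖T₁ f‖ + ‖T₂ f‖ := norm_add_le _ _
    _ ≤ _ := add_le_add
      ((H₁ f hf).trans (mul_le_mul_of_nonneg_left (key _ (le_max_left _ _)) hc₁.le))
      ((H₂ f hf).trans (mul_le_mul_of_nonneg_left (key _ (le_max_right _ _)) hc₂.le))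
    _ = _ := by ring

lemma IsDistribution.smul (a : ℂ) {T : TestFn →ₗ[ℂ] ℂ} (h : IsDistribution T) :
    IsDistribution (a • T) := by
  intro u hu
  obtain ⟨m, c, hc, H⟩ := h u hu
  refine ⟨m, (‖a‖ + 1) * c, by positivity, fun f hf => ?_⟩
  have hS : 0 ≤ ∑ i ∈ Finset.range (m + 1), ⨆ x : ℝ, ‖iteratedDeriv i f x‖ :=
    Finset.sum_nonneg fun _ _ => supNorm_nonneg _ _
  calc ‖a * T f‖ = ‖a‖ * ‖T f‖ := norm_mul _ _
    _ ≤ (‖a‖ + 1) * (c * ∑ i ∈ Finset.range (m + 1), ⨆ x : ℝ, ‖iteratedDeriv i f x‖) :=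
      mul_le_mul (by linarith) (H f hf) (norm_nonneg _) (by positivity)
    _ = _ := by ring

/-- The space of quasi-`L`-periodic distributions on `I^∞_{μ,ν}`: the continuous functionals `λ`
such that `T^λ` is in `D'(L^∨ \ ℝ; ω_L)`. -/
def quasiPeriodic (μ ν : ℂ) (L : Set ℝ) : Submodule ℂ (PSeries μ ν →ₗ[ℂ] ℂ) where
  carrier := {lam | IsPSDistribution lam ∧ IsQuasiPeriodic L (restr lam)}
  zero_mem' := ⟨IsPSDistribution.zero, IsDistribution.zero, by simp [restr]⟩
  add_mem' := by
    rintro l₁ l₂ ⟨h₁, h₁', h₁''⟩ ⟨h₂, h₂', h₂''⟩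
    refine ⟨h₁.add h₂, h₁'.add h₂', fun t ht l hl f => ?_⟩
    change restr l₁ (shift t f) + restr l₂ (shift t f) = _ * (restr l₁ f + restr l₂ f)
    rw [h₁'' t ht l hl, h₂'' t ht l hl, mul_add]
  smul_mem' := by
    rintro a l₁ ⟨h₁, h₁', h₁''⟩
    refine ⟨h₁.smul a, h₁'.smul a, fun t ht l hl f => ?_⟩
    change a * restr l₁ (shift t f) = _ * (a * restr l₁ f)
    rw [h₁'' t ht l hl]
    ring

end QuasiAuto
end

namespace QuasiAuto

/-! ### Differential operators along a map -/

/-! A function `F` in the principal series is determined by `φ(θ) = F(k̃(θ))`, and exactly the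
smooth `φ` with `φ(θ + π) = e^{πiμ} φ(θ)` occur (`PSeries.eq_lift`, `PSeries.isQP`, `lift_mem`). The
generators act on `φ` by first-order operators (`rhoGen_lift`), and `E₊ - E₋` acts as `d/dθ`, so the
seminorms `Q_X` define the topology of uniform convergence of all derivatives over one period
(`isPSDistribution_iff`). The circle of angles modulo `π` is covered by two charts, each isomorphic
to `ℝ` and missing one point: `ι` embeds `C₀^∞(ℝ)` through the standard chart, and the involution
exchanges it with the chart around the point at infinity, the change of coordinates being `x ↦
-1/x`. Fixed cutoffs write each `F` as `ι(f₁) + ι(f₂)_∞` with `f₁, f₂` depending continuously on `F`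
(`isPartition_part`, `testNorm_partFst_le`, `testNorm_partSnd_le`).

Convergence and continuity. The point is a bound for `J_l(F)` by any negative power of `1 + |l|`
times a seminorm of `F` (`norm_jacquet_le`). For `f₁` this is the usual decay of Fourier transforms.
For `f₂` and `l ≠ 0`, repeated partial integration continues the transform in `s` and gives the
decay in `l` at the same time (`partInt_bound`). The value `l = 0` is a Mellin transform, continued
by subtracting a Taylor polynomial (`twistedFourier_zero`). Since the nonzero points of a shifted
lattice stay away from `0`, the bounds are uniform on `L` and beat the polynomial growth of `α`.

Restriction and injectivity. `J_l(ι(f))` is the Fourier transform of `f`, and `ι(f)` vanishes near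
infinity, so the delta functionals kill it; this gives the Fourier series of `T^λ`. Modulated bumps
recover `α` from this series, and `β` is then read off from functions `ι(f)_∞`, on which the delta
functionals become derivatives of the Dirac distribution at `0`.

Surjectivity. For a quasi-periodic `λ`, the distribution `T^λ` on `ℝ` has a Fourier expansion with
coefficients `α` of polynomial growth (`fourierCoeffs_mem`, `fourierCoeffs_series`). Then `λ -
λ_{α,0}` kills the image of `ι`. Seen in the chart at infinity it is a distribution supported at the
origin, hence a finite combination of derivatives of the Dirac distribution
(`IsDistribution.eq_sum_deltaDeriv`), which supplies `β`. -/

/-- `D` is a linear differential operator with smooth coefficients followed by composition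
with `b`: `D f x = ∑ c_j(x) f^{(j)}(b x)` for smooth `f`. -/
def IsDiffOp (b : ℝ → ℝ) (D : (ℝ → ℂ) → ℝ → ℂ) : Prop :=
  ∃ (n : ℕ) (c : ℕ → ℝ → ℂ), (∀ j, ContDiff ℝ ∞ (c j)) ∧
    ∀ f : ℝ → ℂ, ContDiff ℝ ∞ f → D f = fun x => ∑ j ∈ Finset.range n, c j x * iteratedDeriv j f (b x)

lemma contDiff_iteratedDeriv {f : ℝ → ℂ} (hf : ContDiff ℝ ∞ f) (k : ℕ) :
    ContDiff ℝ ∞ (iteratedDeriv k f) :=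
  iteratedDeriv_eq_iterate (f := f) (n := k) ▸ ContDiff.iterate_deriv k hf

lemma contDiff_deriv {f : ℝ → ℂ} (hf : ContDiff ℝ ∞ f) : ContDiff ℝ ∞ (deriv f) := by
  simpa using contDiff_iteratedDeriv hf 1

lemma hasDerivAt_of_smooth {f : ℝ → ℂ} (hf : ContDiff ℝ ∞ f) (x : ℝ) :
    HasDerivAt f (deriv f x) x :=
  (hf.differentiable (by simp) x).hasDerivAt

lemma IsDiffOp.congr {b : ℝ → ℝ} {D E : (ℝ → ℂ) → ℝ → ℂ} (hD : IsDiffOp b D)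
    (h : ∀ f, ContDiff ℝ ∞ f → E f = D f) : IsDiffOp b E := by
  obtain ⟨n, c, hc, H⟩ := hD
  exact ⟨n, c, hc, fun f hf => (h f hf).trans (H f hf)⟩

/-- Padding with zero coefficients brings two operators to a common order, so that `IsDiffOp.add`
can add coefficientwise. -/
lemma IsDiffOp.extend {b : ℝ → ℝ} {D : (ℝ → ℂ) → ℝ → ℂ} (hD : IsDiffOp b D) :
    ∃ n₀, ∀ n ≥ n₀, ∃ c : ℕ → ℝ → ℂ, (∀ j, ContDiff ℝ ∞ (c j)) ∧ (∀ j, n₀ ≤ j → c j = 0) ∧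
      ∀ f : ℝ → ℂ, ContDiff ℝ ∞ f →
        D f = fun x => ∑ j ∈ Finset.range n, c j x * iteratedDeriv j f (b x) := by
  obtain ⟨n, c, hc, H⟩ := hD
  refine ⟨n, fun N hN => ⟨fun j => if j < n then c j else 0, fun j => ?_, fun j hj => ?_,
    fun f hf => ?_⟩⟩
  · dsimp only
    split_ifs
    · exact hc j
    · exact contDiff_const
  · simp [hj]
  · rw [H f hf]
    funext x
    rw [← Finset.sum_subset (Finset.range_mono hN)]
    · refine Finset.sum_congr rfl fun j hj => ?_
      simp [Finset.mem_range.1 hj]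
    · intro j _ hj
      rw [Finset.mem_range] at hj
      simp [hj]

lemma IsDiffOp.add {b : ℝ → ℝ} {D E : (ℝ → ℂ) → ℝ → ℂ} (hD : IsDiffOp b D) (hE : IsDiffOp b E) :
    IsDiffOp b fun f x => D f x + E f x := by
  obtain ⟨n, hn⟩ := hD.extend
  obtain ⟨m, hm⟩ := hE.extend
  obtain ⟨c, hc, -, hc'⟩ := hn (max n m) (le_max_left _ _)
  obtain ⟨d, hd, -, hd'⟩ := hm (max n m) (le_max_right _ _)
  refine ⟨max n m, fun j x => c j x + d j x, fun j => (hc j).add (hd j), fun f hf => ?_⟩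
  funext x
  dsimp only
  rw [hc' f hf, hd' f hf, ← Finset.sum_add_distrib]
  exact Finset.sum_congr rfl fun j _ => by ring

lemma IsDiffOp.mul {b : ℝ → ℝ} {D : (ℝ → ℂ) → ℝ → ℂ} (hD : IsDiffOp b D) {a : ℝ → ℂ}
    (ha : ContDiff ℝ ∞ a) : IsDiffOp b fun f x => a x * D f x := by
  obtain ⟨n, c, hc, H⟩ := hD
  refine ⟨n, fun j x => a x * c j x, fun j => ha.mul (hc j), fun f hf => ?_⟩
  funext x
  dsimp only
  rw [H f hf, Finset.mul_sum]
  exact Finset.sum_congr rfl fun j _ => by ring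

lemma isDiffOp_comp (b : ℝ → ℝ) : IsDiffOp b fun f x => f (b x) :=
  ⟨1, fun _ _ => 1, fun _ => contDiff_const, fun f _ => by simp⟩

lemma isDiffOp_id : IsDiffOp id fun f => f := isDiffOp_comp id

lemma IsDiffOp.deriv {b : ℝ → ℝ} (hb : ContDiff ℝ ∞ b) {D : (ℝ → ℂ) → ℝ → ℂ} (hD : IsDiffOp b D) :
    IsDiffOp b fun f => deriv (D f) := by
  obtain ⟨n, c, hc, H⟩ := hD
  have hbd : ContDiff ℝ ∞ (fun x => ((_root_.deriv b x : ℝ) : ℂ)) :=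
    Complex.ofRealCLM.contDiff.comp (ContDiff.iterate_deriv 1 hb)
  have h1 : IsDiffOp b fun f x => ∑ j ∈ Finset.range n, _root_.deriv (c j) x * iteratedDeriv j f (b x) :=
    ⟨n, fun j => _root_.deriv (c j), fun j => contDiff_deriv (hc j), fun f _ => rfl⟩
  -- The half of the product rule that differentiates `f ∘ b`: it raises the order by one, so the
  -- coefficients are shifted by one index and the new zeroth one is `0`.
  have h2 : IsDiffOp b fun f x => ∑ j ∈ Finset.range n,
      c j x * (_root_.deriv b x : ℝ) * iteratedDeriv (j + 1) f (b x) := by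
    refine ⟨n + 1, fun j x => if j = 0 then 0 else c (j - 1) x * (_root_.deriv b x : ℝ),
      fun j => ?_, fun f _ => ?_⟩
    · dsimp only
      split_ifs
      · exact contDiff_const
      · exact (hc _).mul hbd
    · funext x
      rw [Finset.sum_range_succ']
      simp
  refine (h1.add h2).congr fun f hf => ?_
  funext x
  rw [H f hf, ← Finset.sum_add_distrib]
  refine HasDerivAt.deriv ?_
  refine HasDerivAt.fun_sum fun j _ => ?_
  have e1 := hasDerivAt_of_smooth (hc j) x
  have e2 := hasDerivAt_of_smooth (contDiff_iteratedDeriv hf j) (b x)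
  have e3 : HasDerivAt b (_root_.deriv b x) x := (hb.differentiable (by simp) x).hasDerivAt
  have e4 := e1.mul (e2.scomp x e3)
  refine e4.congr_deriv ?_
  rw [iteratedDeriv_succ, Complex.real_smul]
  simp only [Function.comp]
  ring

lemma IsDiffOp.iteratedDeriv {b : ℝ → ℝ} (hb : ContDiff ℝ ∞ b) {D : (ℝ → ℂ) → ℝ → ℂ}
    (hD : IsDiffOp b D) (k : ℕ) : IsDiffOp b fun f => iteratedDeriv k (D f) := by
  induction k with
  | zero => simpa using hD
  | succ k ih =>
    exact (ih.deriv hb).congr fun f _ => iteratedDeriv_succ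

lemma IsDiffOp.contDiff {b : ℝ → ℝ} (hb : ContDiff ℝ ∞ b) {D : (ℝ → ℂ) → ℝ → ℂ}
    (hD : IsDiffOp b D) {f : ℝ → ℂ} (hf : ContDiff ℝ ∞ f) : ContDiff ℝ ∞ (D f) := by
  obtain ⟨n, c, hc, H⟩ := hD
  rw [H f hf]
  exact ContDiff.sum fun j _ => (hc j).mul ((contDiff_iteratedDeriv hf j).comp hb)

/-- The reason for introducing `IsDiffOp`: the coefficients do not depend on `f` and are bounded on
a compact set, so the constant is uniform in `f`. -/
lemma IsDiffOp.bound {b : ℝ → ℝ} {D : (ℝ → ℂ) → ℝ → ℂ} (hD : IsDiffOp b D) {K : Set ℝ}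
    (hK : IsCompact K) : ∃ (n : ℕ) (C : ℝ), 0 < C ∧ ∀ f : ℝ → ℂ, ContDiff ℝ ∞ f → ∀ x ∈ K,
      ‖D f x‖ ≤ C * ∑ j ∈ Finset.range (n + 1), ‖_root_.iteratedDeriv j f (b x)‖ := by
  obtain ⟨n, c, hc, H⟩ := hD
  have h1 : ∀ j, ∃ C, ∀ x ∈ K, ‖c j x‖ ≤ C := fun j =>
    hK.exists_bound_of_continuousOn (hc j).continuous.continuousOn
  choose C hC using h1
  refine ⟨n, 1 + ∑ j ∈ Finset.range n, |C j|, by positivity, fun f hf x hx => ?_⟩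
  rw [H f hf, Finset.mul_sum]
  refine (norm_sum_le _ _).trans ?_
  refine (Finset.sum_le_sum (f := fun j => ‖c j x * _root_.iteratedDeriv j f (b x)‖) (g := fun j =>
    (1 + ∑ j ∈ Finset.range n, |C j|) * ‖_root_.iteratedDeriv j f (b x)‖) fun j hj => ?_).trans ?_
  · rw [norm_mul]
    refine mul_le_mul_of_nonneg_right ?_ (norm_nonneg _)
    have h2 : |C j| ≤ ∑ j ∈ Finset.range n, |C j| :=
      Finset.single_le_sum (f := fun j => |C j|) (fun i _ => abs_nonneg _) hj
    have := hC j x hx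
    have := le_abs_self (C j)
    linarith
  · exact Finset.sum_le_sum_of_subset_of_nonneg (Finset.range_mono (by omega))
      fun _ _ _ => by positivity

lemma iteratedDeriv_congr_of_eventuallyEq {f g : ℝ → ℂ} {x : ℝ} (h : f =ᶠ[𝓝 x] g) (k : ℕ) :
    iteratedDeriv k f =ᶠ[𝓝 x] iteratedDeriv k g := by
  induction k with
  | zero => simpa using h
  | succ k ih =>
    rw [_root_.iteratedDeriv_succ, _root_.iteratedDeriv_succ]
    exact ih.deriv

lemma IsDiffOp.congr_of_eventuallyEq {b : ℝ → ℝ} (hb : Continuous b) {D : (ℝ → ℂ) → ℝ → ℂ}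
    (hD : IsDiffOp b D) {f g : ℝ → ℂ} (hf : ContDiff ℝ ∞ f) (hg : ContDiff ℝ ∞ g) {x : ℝ}
    (h : f =ᶠ[𝓝 (b x)] g) : D f =ᶠ[𝓝 x] D g := by
  obtain ⟨n, c, hc, H⟩ := hD
  rw [H f hf, H g hg]
  filter_upwards [hb.continuousAt.eventually h.eventuallyEq_nhds] with y hy
  exact Finset.sum_congr rfl fun j _ => by
    rw [(iteratedDeriv_congr_of_eventuallyEq hy j).eq_of_nhds]

/-! ### Functions on the covering group in terms of their restriction to `k̃(θ)` -/

lemma Cover.ext' {g h : Cover} (h₁ : g.mat = h.mat) (h₂ : g.ang = h.ang) : g = h :=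
  Subtype.ext (Prod.ext h₁ h₂)

lemma norm_autJ_pos (g : SL(2, ℝ)) (z : UpperHalfPlane) : 0 < ‖autJ g z‖ :=
  norm_pos_iff.2 (autJ_ne_zero g z)

/-- The defining relation of the cover as a polar form: `-θ` is a lift of the argument of `J(g, i)`.
Hence the pair of `|J(g, i)|` and `θ` encodes the bottom row of the matrix. -/
lemma Cover.autJ_eq (g : Cover) : autJ g.mat UpperHalfPlane.I =
    ‖autJ g.mat UpperHalfPlane.I‖ * Complex.exp (-(Complex.I * g.ang)) := by
  have h := g.2
  change autJ g.mat UpperHalfPlane.I * Complex.exp (Complex.I * g.ang)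
    = (‖autJ g.mat UpperHalfPlane.I‖ : ℂ) at h
  rw [← h, mul_assoc, ← Complex.exp_add]
  simp

lemma exp_neg_I_mul (θ : ℝ) : Complex.exp (-(Complex.I * θ)) =
    (Real.cos θ : ℂ) - Real.sin θ * Complex.I := by
  rw [show -(Complex.I * (θ : ℂ)) = (-θ : ℂ) * Complex.I by ring, Complex.exp_mul_I]
  simp [sub_eq_add_neg]

lemma Cover.c_eq (g : Cover) : g.mat 1 0 = -(‖autJ g.mat UpperHalfPlane.I‖ * Real.sin g.ang) := by
  have h := congrArg Complex.im g.autJ_eq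
  rw [exp_neg_I_mul, Complex.im_ofReal_mul] at h
  simpa [autJ_I, -Complex.ofReal_sin, -Complex.ofReal_cos] using h

lemma Cover.d_eq (g : Cover) : g.mat 1 1 = ‖autJ g.mat UpperHalfPlane.I‖ * Real.cos g.ang := by
  have h := congrArg Complex.re g.autJ_eq
  rw [exp_neg_I_mul, Complex.re_ofReal_mul] at h
  simpa [autJ_I, -Complex.ofReal_sin, -Complex.ofReal_cos] using h

/-- The function `F(g, θ) = |J(g, i)|^{-2ν-1} φ(θ)`. -/
noncomputable def lift (ν : ℂ) (φ : ℝ → ℂ) (g : Cover) : ℂ :=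
  ((‖autJ g.mat UpperHalfPlane.I‖ : ℝ) : ℂ) ^ (-2 * ν - 1) * φ g.ang

lemma lift_kT (ν : ℂ) (φ : ℝ → ℂ) (θ : ℝ) : lift ν φ (kT θ) = φ θ := by
  have : ‖autJ (kT θ).mat UpperHalfPlane.I‖ = 1 := by
    change ‖autJ (kMat θ) UpperHalfPlane.I‖ = 1
    rw [autJ_kMat, Complex.norm_exp]
    simp
  rw [lift, this]
  simp [kT, Cover.ang]

/-- Smooth functions with `φ(θ + π) = e^{π i μ} φ(θ)`. -/
def IsQP (μ : ℂ) (φ : ℝ → ℂ) : Prop :=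
  ContDiff ℝ ∞ φ ∧ ∀ θ, φ (θ + Real.pi) = Complex.exp (Real.pi * Complex.I * μ) * φ θ

lemma IsQP.int {μ : ℂ} {φ : ℝ → ℂ} (h : IsQP μ φ) (m : ℤ) (θ : ℝ) :
    φ (m * Real.pi + θ) = Complex.exp (Real.pi * m * Complex.I * μ) * φ θ := by
  induction m using Int.induction_on with
  | zero => simp
  | succ i ih =>
    have := h.2 (i * Real.pi + θ)
    push_cast at ih ⊢
    rw [show ((i : ℝ) + 1) * Real.pi + θ = i * Real.pi + θ + Real.pi by ring, this, ih, ← mul_assoc,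
      ← Complex.exp_add]
    congr 2
    ring
  | pred i ih =>
    have := h.2 ((-(i : ℝ) - 1) * Real.pi + θ)
    push_cast at ih ⊢
    rw [show (-(i : ℝ) - 1) * Real.pi + θ + Real.pi = -i * Real.pi + θ by ring, ih] at this
    rw [show (Real.pi : ℂ) * (-i - 1) * Complex.I * μ =
      -(Real.pi * Complex.I * μ) + Real.pi * (-i) * Complex.I * μ by ring, Complex.exp_add, mul_assoc,
      this, ← mul_assoc, ← Complex.exp_add]
    simp

lemma sl_mul_apply (g h : SL(2, ℝ)) (i j : Fin 2) :
    (g * h) i j = g i 0 * h 0 j + g i 1 * h 1 j := by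
  rw [Matrix.SpecialLinearGroup.coe_mul, Matrix.mul_apply, Fin.sum_univ_two]

lemma uak_top (x y : ℝ) (hy : 0 < y) (θ : ℝ) :
    (uT x * aT y hy * kT θ).mat 0 0 = Real.sqrt y * Real.cos θ - x / Real.sqrt y * Real.sin θ ∧
    (uT x * aT y hy * kT θ).mat 0 1 = Real.sqrt y * Real.sin θ + x / Real.sqrt y * Real.cos θ := by
  rw [Cover.mul_mat, Cover.mul_mat]
  change (uMat x * aMat y hy * kMat θ) 0 0 = _ ∧ (uMat x * aMat y hy * kMat θ) 0 1 = _
  simp only [sl_mul_apply]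
  simp only [uMat, aMat, kMat]
  constructor <;> simp [-mul_eq_mul_right_iff, -mul_eq_mul_left_iff] <;> ring

lemma mat_eq_of_apply {g h : SL(2, ℝ)} (h00 : g 0 0 = h 0 0) (h01 : g 0 1 = h 0 1)
    (h10 : g 1 0 = h 1 0) (h11 : g 1 1 = h 1 1) : g = h := by
  ext i j
  fin_cases i <;> fin_cases j <;> assumption

/-- The bottom row forces `y = |J(g, i)|⁻²`. Rotating the first row back by the angle leaves the
entry `√y`, by the determinant condition, and an off-diagonal entry from which `x` is read off. -/
lemma Cover.iwasawa (g : Cover) : ∃ (x y : ℝ) (hy : 0 < y),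
    1 / Real.sqrt y = ‖autJ g.mat UpperHalfPlane.I‖ ∧ g = uT x * aT y hy * kT g.ang := by
  set r := ‖autJ g.mat UpperHalfPlane.I‖ with hr
  have hr0 : 0 < r := norm_autJ_pos _ _
  have hc : g.mat 1 0 = -(r * Real.sin g.ang) := g.c_eq
  have hd : g.mat 1 1 = r * Real.cos g.ang := g.d_eq
  have hdet := g.mat.det_coe
  rw [Matrix.det_fin_two] at hdet
  change g.mat 0 0 * g.mat 1 1 - g.mat 0 1 * g.mat 1 0 = 1 at hdet
  rw [hc, hd] at hdet
  have hs := Real.sin_sq_add_cos_sq g.ang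
  have hsq : Real.sqrt (1 / r ^ 2) = 1 / r := by
    rw [Real.sqrt_div zero_le_one, Real.sqrt_sq hr0.le, Real.sqrt_one]
  refine ⟨(g.mat 0 1 * Real.cos g.ang - g.mat 0 0 * Real.sin g.ang) / r, 1 / r ^ 2, by positivity,
    by rw [hsq]; simp, Cover.ext' ?_ (uak_ang _ _ _ _).symm⟩
  have h1 : 1 / r = g.mat 0 0 * Real.cos g.ang + g.mat 0 1 * Real.sin g.ang := by
    field_simp
    linarith
  refine mat_eq_of_apply ?_ ?_ ?_ ?_
  · rw [(uak_top _ _ _ _).1, hsq, h1, ← h1, div_div_div_cancel_right₀ hr0.ne', h1]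
    linear_combination (-g.mat 0 0) * hs
  · rw [(uak_top _ _ _ _).2, hsq, h1, ← h1, div_div_div_cancel_right₀ hr0.ne', h1]
    linear_combination (-g.mat 0 1) * hs
  · rw [uak_c, hsq, hc]
    field_simp
  · rw [uak_d, hsq, hd]
    field_simp

lemma cpow_inv_sqrt (ν : ℂ) {y : ℝ} (hy : 0 < y) :
    ((1 / Real.sqrt y : ℝ) : ℂ) ^ (-2 * ν - 1) = (y : ℂ) ^ (ν + 1 / 2) := by
  have hs : 0 < 1 / Real.sqrt y := by positivity
  have hyC : (y : ℂ) ≠ 0 := by exact_mod_cast hy.ne'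
  have hsC : ((1 / Real.sqrt y : ℝ) : ℂ) ≠ 0 := by exact_mod_cast hs.ne'
  rw [Complex.cpow_def_of_ne_zero hyC, Complex.cpow_def_of_ne_zero hsC,
    ← Complex.ofReal_log hy.le, ← Complex.ofReal_log hs.le, one_div, Real.log_inv,
    Real.log_sqrt hy.le]
  congr 1
  push_cast
  ring

lemma kT_eq_uak (θ : ℝ) : uT 0 * aT (Real.exp 0) (Real.exp_pos _) * kT θ = kT θ := by
  refine Cover.ext' (mat_eq_of_apply ?_ ?_ ?_ ?_) (uak_ang _ _ _ _)
  · rw [(uak_top _ _ _ _).1]; simp [kT, kMat, Cover.mat]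
  · rw [(uak_top _ _ _ _).2]; simp [kT, kMat, Cover.mat]
  · rw [uak_c]; simp [kT, kMat, Cover.mat]
  · rw [uak_d]; simp [kT, kMat, Cover.mat]

/-- Inserts the trivial factor `k̃(0·π)`, so that the equivariance condition can be applied with `m
= 0` to an Iwasawa decomposition. -/
lemma uak_zero_mul (x y : ℝ) (hy : 0 < y) (g : Cover) (hg : g = uT x * aT y hy * kT g.ang) :
    uT x * aT y hy * kT ((0 : ℤ) * Real.pi) * kT g.ang = g := by
  have hz : (uT x * aT y hy * kT ((0 : ℤ) * Real.pi)).mat 1 0 = 0 := by rw [uak_c]; simp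
  conv_rhs => rw [hg]
  refine Cover.ext' ?_ ?_
  · have : kMat (((0 : ℤ) : ℝ) * Real.pi) = 1 :=
      mat_eq_of_apply (by simp [kMat]) (by simp [kMat]) (by simp [kMat]) (by simp [kMat])
    rw [Cover.mul_mat, Cover.mul_mat _ (kT ((0 : ℤ) * Real.pi))]
    change _ * kMat (((0 : ℤ) : ℝ) * Real.pi) * _ = _
    rw [this, mul_one]
    rfl
  · rw [parabolic_mul_ang _ _ hz, uak_ang, uak_ang]
    simp [kT, Cover.ang]

lemma PSeries.eq_lift {μ ν : ℂ} {F : Cover → ℂ} (hF : F ∈ PSeries μ ν) :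
    F = lift ν fun θ => F (kT θ) := by
  funext g
  obtain ⟨x, y, hy, hr, hg⟩ := g.iwasawa
  have := hF.2 x y hy 0 (kT g.ang)
  rw [uak_zero_mul x y hy g hg] at this
  rw [this, lift, ← hr, cpow_inv_sqrt ν hy]
  simp

lemma kT_pi_mul (m : ℤ) (θ : ℝ) :
    uT 0 * aT 1 one_pos * kT (m * Real.pi) * kT θ = kT (m * Real.pi + θ) := by
  have hz : (uT 0 * aT 1 one_pos * kT (m * Real.pi)).mat 1 0 = 0 := by
    rw [uak_c, Real.sin_int_mul_pi]; simp
  refine Cover.ext' ?_ ?_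
  · have h1 : uMat 0 * aMat 1 one_pos = 1 := by
      refine mat_eq_of_apply ?_ ?_ ?_ ?_ <;> simp only [sl_mul_apply] <;> simp [uMat, aMat]
    change uMat 0 * aMat 1 one_pos * kMat (m * Real.pi) * kMat θ = kMat (m * Real.pi + θ)
    rw [h1, one_mul]
    refine mat_eq_of_apply ?_ ?_ ?_ ?_ <;> simp only [sl_mul_apply] <;>
    simp [kMat, Real.cos_add, Real.sin_add]
  · rw [parabolic_mul_ang _ _ hz, uak_ang]
    rfl

lemma PSeries.isQP {μ ν : ℂ} {F : Cover → ℂ} (hF : F ∈ PSeries μ ν) :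
    IsQP μ fun θ => F (kT θ) := by
  constructor
  · have h := hF.1
    unfold IsSmooth at h
    have h2 := h.comp (g := _) (f := fun θ : ℝ => ((0 : ℝ), (0 : ℝ), θ)) (by fun_prop)
    convert! h2 using 1
    funext θ
    simp only [Function.comp]
    rw [kT_eq_uak]
  · intro θ
    have h := hF.2 0 1 one_pos 1 (kT θ)
    rw [kT_pi_mul] at h
    simp only [Int.cast_one, one_mul, Complex.ofReal_one, Complex.one_cpow, mul_one] at h
    rw [add_comm θ]
    exact h

lemma norm_autJ_uak (x y : ℝ) (hy : 0 < y) (θ : ℝ) :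
    ‖autJ (uT x * aT y hy * kT θ).mat UpperHalfPlane.I‖ = 1 / Real.sqrt y := by
  have hs : 0 < 1 / Real.sqrt y := by positivity
  rw [autJ_I, uak_c, uak_d]
  have : (((1 / Real.sqrt y * -Real.sin θ : ℝ) : ℂ) * Complex.I + ((1 / Real.sqrt y * Real.cos θ : ℝ) : ℂ))
      = ((1 / Real.sqrt y : ℝ) : ℂ) * Complex.exp (-(Complex.I * θ)) := by
    rw [exp_neg_I_mul]
    push_cast
    ring
  rw [this, norm_mul, Complex.norm_exp, Complex.norm_real, Real.norm_of_nonneg hs.le]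
  simp

/-- Left multiplication by `ũ(x) ã(y) k̃(mπ)` scales the bottom row by a number of absolute value
`y^{-1/2}` and adds `mπ` to the angle, so the two factors of `lift` transform separately. -/
lemma lift_mem {μ : ℂ} (ν : ℂ) {φ : ℝ → ℂ} (h : IsQP μ φ) : lift ν φ ∈ PSeries μ ν := by
  constructor
  · unfold IsSmooth lift
    simp only [norm_autJ_uak, uak_ang, cpow_inv_sqrt ν (Real.exp_pos _)]
    have : (fun p : ℝ × ℝ × ℝ => ((Real.exp p.2.1 : ℝ) : ℂ) ^ (ν + 1 / 2) * φ p.2.2) =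
        fun p : ℝ × ℝ × ℝ => Complex.exp ((p.2.1 : ℂ) * (ν + 1 / 2)) * φ p.2.2 := by
      funext p
      rw [Complex.cpow_def_of_ne_zero (by exact_mod_cast (Real.exp_pos _).ne'),
        ← Complex.ofReal_log (Real.exp_pos _).le, Real.log_exp]
    rw [this]
    have h1 : ContDiff ℝ ∞ fun p : ℝ × ℝ × ℝ => (p.2.1 : ℂ) :=
      Complex.ofRealCLM.contDiff.comp (by fun_prop)
    exact ((Complex.contDiff_exp.comp (h1.mul contDiff_const))).mul (h.1.comp (by fun_prop))
  · intro x y hy m g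
    have hz : (uT x * aT y hy * kT (m * Real.pi)).mat 1 0 = 0 := by
      rw [uak_c, Real.sin_int_mul_pi]; simp
    set z := uT x * aT y hy * kT (m * Real.pi) with hzz
    have hJ : autJ (z * g).mat UpperHalfPlane.I = z.mat 1 1 * autJ g.mat UpperHalfPlane.I := by
      rw [autJ_I, parabolic_mul_mat _ _ hz, parabolic_mul_mat _ _ hz, autJ_I]
      push_cast
      ring
    have hzJ : ‖(z.mat 1 1 : ℂ)‖ = 1 / Real.sqrt y := by
      rw [← norm_autJ_uak x y hy (m * Real.pi), ← hzz, autJ_I z.mat, hz]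
      simp
    rw [lift, lift, hJ, norm_mul, hzJ, parabolic_mul_ang _ _ hz, uak_ang, h.int, Complex.ofReal_mul,
      Complex.mul_cpow_ofReal_nonneg (by positivity) (norm_nonneg _), cpow_inv_sqrt ν hy]
    ring

/-! ### The action of the generators -/

/-- The logarithmic derivative of `t ↦ J(g exp(tX), i)` at `t = 0`, where `θ` is the angle
of `g`. -/
noncomputable def genDer : Gen → ℝ → ℂ
  | .H, θ => ((Real.sin θ ^ 2 - Real.cos θ ^ 2 : ℝ) : ℂ) -
      ((2 * Real.sin θ * Real.cos θ : ℝ) : ℂ) * Complex.I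
  | .Ep, θ => ((-(Real.sin θ * Real.cos θ) : ℝ) : ℂ) - ((Real.sin θ ^ 2 : ℝ) : ℂ) * Complex.I
  | .Em, θ => ((-(Real.sin θ * Real.cos θ) : ℝ) : ℂ) + ((Real.cos θ ^ 2 : ℝ) : ℂ) * Complex.I

/-- The operator `P_X` with `ρ(X) (lift φ) = lift (P_X φ)`. -/
noncomputable def genOp (ν : ℂ) (X : Gen) (φ : ℝ → ℂ) (θ : ℝ) : ℂ :=
  (-2 * ν - 1) * ((genDer X θ).re : ℂ) * φ θ - ((genDer X θ).im : ℂ) * deriv φ θ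

/-- The chosen one-parameter subgroups lift with the principal argument, which is differentiable
near `t = 0` because `J(exp(tX), i)` starts at `1`. -/
lemma expGen_ang (X : Gen) (t : ℝ) :
    (expGen X t).ang = -Complex.arg (autJ (expGen X t).mat UpperHalfPlane.I) := by
  cases X with
  | H =>
    have : autJ (aMat (Real.exp (2 * t)) (Real.exp_pos _)) UpperHalfPlane.I =
        ((1 / Real.sqrt (Real.exp (2 * t)) : ℝ) : ℂ) := by rw [autJ_I]; simp [aMat]
    change (0 : ℝ) = -Complex.arg (autJ (aMat (Real.exp (2 * t)) (Real.exp_pos _)) UpperHalfPlane.I)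
    rw [this, Complex.arg_ofReal_of_nonneg (by positivity), neg_zero]
  | Ep =>
    change (0 : ℝ) = -Complex.arg (autJ (uMat t) UpperHalfPlane.I)
    rw [autJ_I]
    simp [uMat]
  | Em =>
    change -Complex.arg (1 + Complex.I * t) = -Complex.arg (autJ (ubMat t) UpperHalfPlane.I)
    congr 2
    rw [autJ_I]
    simp [ubMat]
    ring

lemma expGen_zero_mat (X : Gen) : (expGen X 0).mat = 1 := by
  cases X
  · change aMat (Real.exp (2 * 0)) (Real.exp_pos _) = 1
    refine mat_eq_of_apply ?_ ?_ ?_ ?_ <;> simp [aMat]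
  · change uMat 0 = 1
    refine mat_eq_of_apply ?_ ?_ ?_ ?_ <;> simp [uMat]
  · change ubMat 0 = 1
    refine mat_eq_of_apply ?_ ?_ ?_ ?_ <;> simp [ubMat]

lemma sqrt_exp_two_mul (t : ℝ) : Real.sqrt (Real.exp (2 * t)) = Real.exp t := by
  rw [← Real.exp_half]
  congr 1
  ring

/-- The matrix `e` is `X` itself. The second condition differentiates `log J(k(θ) exp(tX), i)` at `t
= 0`: the bottom row of `k(θ)` is `(-sin θ, cos θ)`, and `J(k(θ), i)⁻¹ = e^{iθ}`. -/
lemma hasDerivAt_expGen (X : Gen) : ∃ e : Fin 2 → Fin 2 → ℝ,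
    (∀ i j, HasDerivAt (fun t => (expGen X t).mat i j) (e i j) 0) ∧
    ∀ θ : ℝ, (((-(Real.sin θ * e 0 0) + Real.cos θ * e 1 0 : ℝ) : ℂ) * Complex.I +
      ((-(Real.sin θ * e 0 1) + Real.cos θ * e 1 1 : ℝ) : ℂ)) *
        (Real.cos θ + Real.sin θ * Complex.I) = genDer X θ := by
  have hI := Complex.I_sq
  cases X with
  | H =>
    refine ⟨!![1, 0; 0, -1], fun i j => ?_, fun θ => ?_⟩
    · fin_cases i <;> fin_cases j
      · change HasDerivAt (fun t => Real.sqrt (Real.exp (2 * t))) 1 0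
        simp only [sqrt_exp_two_mul]
        simpa using Real.hasDerivAt_exp 0
      · exact hasDerivAt_const _ _
      · exact hasDerivAt_const _ _
      · change HasDerivAt (fun t => 1 / Real.sqrt (Real.exp (2 * t))) (-1) 0
        simp only [sqrt_exp_two_mul, one_div, ← Real.exp_neg]
        simpa using (hasDerivAt_neg (0 : ℝ)).exp
    · simp [genDer, -Complex.ofReal_sin, -Complex.ofReal_cos]
      linear_combination (-(Real.sin θ : ℂ) ^ 2) * hI
  | Ep =>
    refine ⟨!![0, 1; 0, 0], fun i j => ?_, fun θ => ?_⟩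
    · fin_cases i <;> fin_cases j
      · exact hasDerivAt_const _ _
      · exact hasDerivAt_id _
      · exact hasDerivAt_const _ _
      · exact hasDerivAt_const _ _
    · simp [genDer, -Complex.ofReal_sin, -Complex.ofReal_cos]
      ring
  | Em =>
    refine ⟨!![0, 0; 1, 0], fun i j => ?_, fun θ => ?_⟩
    · fin_cases i <;> fin_cases j
      · exact hasDerivAt_const _ _
      · exact hasDerivAt_const _ _
      · exact hasDerivAt_id _
      · exact hasDerivAt_const _ _
    · simp [genDer, -Complex.ofReal_sin, -Complex.ofReal_cos]
      linear_combination ((Real.sin θ : ℂ) * Real.cos θ) * hI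

lemma hasDerivAt_log_of_one {q : ℝ → ℂ} {q' : ℂ} (hq : HasDerivAt q q' 0) (h0 : q 0 = 1) :
    HasDerivAt (fun t => Complex.log (q t)) q' 0 := by
  simpa [h0] using hq.clog_real (by rw [h0]; exact Complex.one_mem_slitPlane)

lemma hasDerivAt_arg_of_one {q : ℝ → ℂ} {q' : ℂ} (hq : HasDerivAt q q' 0) (h0 : q 0 = 1) :
    HasDerivAt (fun t => Complex.arg (q t)) q'.im 0 := by
  have := (Complex.imCLM.hasFDerivAt.comp_hasDerivAt (0 : ℝ) (hasDerivAt_log_of_one hq h0) :)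
  refine this.congr_of_eventuallyEq (Filter.Eventually.of_forall fun t => ?_)
  exact (Complex.log_im _).symm

/-- The real part of the logarithmic derivative of `J(g exp(tX), i)` changes the norm, hence the
factor `|J|^{-2ν-1}`; minus its imaginary part changes the angle, hence the argument of `φ`. It
depends on `g` only through the angle. -/
lemma rhoGen_lift (ν : ℂ) (X : Gen) {φ : ℝ → ℂ} (hφ : Differentiable ℝ φ) :
    rhoGen X (lift ν φ) = lift ν (genOp ν X φ) := by
  funext g
  obtain ⟨e, he, hrow⟩ := hasDerivAt_expGen X
  set r := ‖autJ g.mat UpperHalfPlane.I‖ with hr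
  have hr0 : 0 < r := norm_autJ_pos _ _
  have hrC : (r : ℂ) ≠ 0 := by exact_mod_cast hr0.ne'
  set J : ℂ := autJ g.mat UpperHalfPlane.I with hJ
  have hJ0 : J ≠ 0 := autJ_ne_zero _ _
  set j : ℝ → ℂ := fun t => autJ (expGen X t).mat UpperHalfPlane.I with hj
  set q : ℝ → ℂ := fun t => autJ (g * expGen X t).mat UpperHalfPlane.I / J with hq
  have hj0 : j 0 = 1 := by simp [hj, expGen_zero_mat, autJ_I]
  have hq0 : q 0 = 1 := by
    simp only [hq, Cover.mul_mat, expGen_zero_mat, mul_one, ← hJ]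
    exact div_self hJ0
  have hjd : HasDerivAt j (e 1 0 * Complex.I + e 1 1) 0 := by
    simp only [hj, autJ_I]
    exact ((he 1 0).ofReal_comp.mul_const _).add (he 1 1).ofReal_comp
  have hqd : HasDerivAt q (genDer X g.ang) 0 := by
    simp only [hq, autJ_I, Cover.mul_mat, sl_mul_apply]
    have h1 : ∀ k, HasDerivAt (fun t => g.mat 1 0 * (expGen X t).mat 0 k +
        g.mat 1 1 * (expGen X t).mat 1 k) (g.mat 1 0 * e 0 k + g.mat 1 1 * e 1 k) 0 := fun k =>
      ((he 0 k).const_mul _).add ((he 1 k).const_mul _)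
    refine ((((h1 0).ofReal_comp.mul_const _).add (h1 1).ofReal_comp).div_const J).congr_deriv ?_
    have hJe : J = r * Complex.exp (-(Complex.I * g.ang)) := g.autJ_eq
    rw [g.c_eq, g.d_eq, ← hJ, ← hr, ← hrow, hJe, exp_neg_I_mul]
    have hcs : ((Real.cos g.ang : ℂ) - Real.sin g.ang * Complex.I) *
        (Real.cos g.ang + Real.sin g.ang * Complex.I) = 1 := by
      have : ((Real.sin g.ang : ℂ)) ^ 2 + (Real.cos g.ang : ℂ) ^ 2 = 1 := by
        exact_mod_cast Real.sin_sq_add_cos_sq g.ang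
      linear_combination this - (Real.sin g.ang : ℂ) ^ 2 * Complex.I_sq
    have hne : ((Real.cos g.ang : ℂ) - Real.sin g.ang * Complex.I) ≠ 0 := left_ne_zero_of_mul_eq_one hcs
    rw [div_eq_iff (mul_ne_zero hrC hne)]
    push_cast [-Complex.ofReal_sin, -Complex.ofReal_cos]
    linear_combination (-(r * ((-(Real.sin g.ang * e 0 0) + Real.cos g.ang * e 1 0) * Complex.I +
      (-(Real.sin g.ang * e 0 1) + Real.cos g.ang * e 1 1) : ℂ))) * hcs
  -- By the cocycle relation, `J(g, exp(tX) i) / J(g, i)` is `q t / j t`. Both `j` and `q / j` equal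
  -- `1` at `t = 0`, so the principal arguments are differentiable there.
  have hang : ∀ t, (g * expGen X t).ang = g.ang + (-Complex.arg (j t) - Complex.arg (q t / j t)) := by
    intro t
    rw [Cover.mul_ang, expGen_ang]
    simp only [hq, hj, Cover.mul_mat, autJ_mul]
    have := autJ_ne_zero (expGen X t).mat UpperHalfPlane.I
    rw [div_right_comm, mul_div_assoc, div_self this, mul_one]
    ring
  have hform : ∀ t, lift ν φ (g * expGen X t) = (r : ℂ) ^ (-2 * ν - 1) *
      (Complex.exp (((Complex.log (q t)).re : ℂ) * (-2 * ν - 1)) *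
        φ (g.ang + (-Complex.arg (j t) - Complex.arg (q t / j t)))) := by
    intro t
    have hn : ‖autJ (g * expGen X t).mat UpperHalfPlane.I‖ = r * ‖q t‖ := by
      simp only [hq, norm_div, ← hr]
      field_simp
    have hqt : ‖q t‖ ≠ 0 := norm_ne_zero_iff.2 (div_ne_zero (autJ_ne_zero _ _) hJ0)
    rw [lift, hn, hang, Complex.ofReal_mul, Complex.mul_cpow_ofReal_nonneg hr0.le (norm_nonneg _),
      Complex.cpow_def_of_ne_zero (x := (‖q t‖ : ℂ)) (by exact_mod_cast hqt),
      ← Complex.ofReal_log (norm_nonneg _), Complex.log_re, mul_assoc]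
  have hlre : HasDerivAt (fun t => (((Complex.log (q t)).re : ℝ) : ℂ)) ((genDer X g.ang).re : ℂ) 0 :=
    HasDerivAt.ofReal_comp
      (Complex.reCLM.hasFDerivAt.comp_hasDerivAt (0 : ℝ) (hasDerivAt_log_of_one hqd hq0) :)
  have hargs : HasDerivAt (fun t => g.ang + (-Complex.arg (j t) - Complex.arg (q t / j t)))
      (-(genDer X g.ang).im) 0 := by
    have h1 := hasDerivAt_arg_of_one hjd hj0
    have h2 := hasDerivAt_arg_of_one (hqd.div hjd (by rw [hj0]; exact one_ne_zero))
      (by simp [hq0, hj0])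
    refine ((h1.neg.sub h2).const_add g.ang).congr_deriv ?_
    rw [hq0, hj0]
    simp
    ring
  have hfin := ((hlre.mul_const (-2 * ν - 1)).cexp.mul
    (HasDerivAt.scomp (0 : ℝ) (hφ _).hasDerivAt hargs)).const_mul ((r : ℂ) ^ (-2 * ν - 1))
  have hz : g.ang + (-Complex.arg (j 0) - Complex.arg (q 0 / j 0)) = g.ang := by simp [hq0, hj0]
  rw [rhoGen, lift, ← hr]
  simp only [hform]
  refine hfin.deriv.trans ?_
  rw [Function.comp_apply, hz, hq0, Complex.log_one, genOp, Complex.real_smul]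
  simp only [Complex.zero_re, Complex.ofReal_zero, zero_mul, Complex.exp_zero, one_mul]
  push_cast
  ring

/-! ### The topology of the principal series in terms of derivatives along `k̃(θ)` -/

/-- The operator `P_w = P_{X₁} ⋯ P_{Xₖ}` for a word `w = X₁ ⋯ Xₖ`. -/
noncomputable def wordOp (ν : ℂ) (w : List Gen) (φ : ℝ → ℂ) : ℝ → ℂ := w.foldr (genOp ν) φ

lemma contDiff_genDer (X : Gen) : ContDiff ℝ ∞ (genDer X) := by
  have h : ∀ f : ℝ → ℝ, ContDiff ℝ ∞ f → ContDiff ℝ ∞ fun x => (f x : ℂ) := fun f hf =>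
    Complex.ofRealCLM.contDiff.comp hf
  have hs := Real.contDiff_sin (n := ∞)
  have hc := Real.contDiff_cos (n := ∞)
  cases X
  · exact (h _ ((hs.pow 2).sub (hc.pow 2))).sub ((h _ ((contDiff_const.mul hs).mul hc)).mul contDiff_const)
  · exact (h _ (hs.mul hc).neg).sub ((h _ (hs.pow 2)).mul contDiff_const)
  · exact (h _ (hs.mul hc).neg).add ((h _ (hc.pow 2)).mul contDiff_const)

lemma IsDiffOp.genOp {D : (ℝ → ℂ) → ℝ → ℂ} (hD : IsDiffOp id D) (ν : ℂ) (X : Gen) :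
    IsDiffOp id fun φ => QuasiAuto.genOp ν X (D φ) := by
  have hre : ContDiff ℝ ∞ fun θ => (((genDer X θ).re : ℝ) : ℂ) :=
    Complex.ofRealCLM.contDiff.comp (Complex.reCLM.contDiff.comp (contDiff_genDer X))
  have him : ContDiff ℝ ∞ fun θ => (((genDer X θ).im : ℝ) : ℂ) :=
    Complex.ofRealCLM.contDiff.comp (Complex.imCLM.contDiff.comp (contDiff_genDer X))
  refine ((hD.mul ((contDiff_const (c := -2 * ν - 1)).mul hre)).add ((hD.deriv contDiff_id).mul him.neg)).congr
    fun φ _ => ?_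
  funext θ
  rw [QuasiAuto.genOp]
  ring

lemma isDiffOp_wordOp (ν : ℂ) (w : List Gen) : IsDiffOp id (wordOp ν w) := by
  induction w with
  | nil => exact isDiffOp_id
  | cons X w ih => exact ih.genOp ν X

lemma contDiff_wordOp (ν : ℂ) (w : List Gen) {φ : ℝ → ℂ} (hφ : ContDiff ℝ ∞ φ) :
    ContDiff ℝ ∞ (wordOp ν w φ) :=
  (isDiffOp_wordOp ν w).contDiff contDiff_id hφ

lemma rhoWord_lift (ν : ℂ) (w : List Gen) {φ : ℝ → ℂ} (hφ : ContDiff ℝ ∞ φ) :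
    rhoWord w (lift ν φ) = lift ν (wordOp ν w φ) := by
  induction w with
  | nil => rfl
  | cons X w ih =>
    change rhoGen X (rhoWord w (lift ν φ)) = _
    rw [ih, rhoGen_lift ν X ((contDiff_wordOp ν w hφ).differentiable (by simp))]
    rfl

lemma bddAbove_Ico {f : ℝ → ℂ} (hf : Continuous f) :
    BddAbove (Set.range fun θ : Set.Ico (-Real.pi) Real.pi => ‖f θ‖) := by
  obtain ⟨C, hC⟩ := isCompact_Icc.exists_bound_of_continuousOn
    (hf.continuousOn (s := Set.Icc (-Real.pi) Real.pi))
  refine ⟨C, ?_⟩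
  rintro _ ⟨θ, rfl⟩
  exact hC θ ⟨θ.2.1, θ.2.2.le⟩

/-- `∑_{k ≤ n} sup_{-π ≤ θ < π} |φ^{(k)}(θ)|`. -/
noncomputable def angNorm (n : ℕ) (φ : ℝ → ℂ) : ℝ :=
  ∑ k ∈ Finset.range (n + 1), ⨆ θ : Set.Ico (-Real.pi) Real.pi, ‖iteratedDeriv k φ θ‖

lemma angNorm_nonneg (n : ℕ) (φ : ℝ → ℂ) : 0 ≤ angNorm n φ :=
  Finset.sum_nonneg fun _ _ => Real.iSup_nonneg fun _ => norm_nonneg _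

lemma angNorm_mono {n m : ℕ} (h : n ≤ m) (φ : ℝ → ℂ) : angNorm n φ ≤ angNorm m φ :=
  Finset.sum_le_sum_of_subset_of_nonneg (Finset.range_mono (by omega))
    fun _ _ _ => Real.iSup_nonneg fun _ => norm_nonneg _

lemma sum_le_angNorm (n : ℕ) {φ : ℝ → ℂ} (hφ : ContDiff ℝ ∞ φ) {θ : ℝ}
    (hθ : θ ∈ Set.Ico (-Real.pi) Real.pi) :
    ∑ k ∈ Finset.range (n + 1), ‖iteratedDeriv k φ θ‖ ≤ angNorm n φ :=
  Finset.sum_le_sum fun k _ => le_ciSup (f := fun θ : Set.Ico (-Real.pi) Real.pi =>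
    ‖iteratedDeriv k φ θ‖) (bddAbove_Ico (contDiff_iteratedDeriv hφ k).continuous) ⟨θ, hθ⟩

lemma rhoEnv_lift_kT (ν : ℂ) (X : List Gen →₀ ℂ) {φ : ℝ → ℂ} (hφ : ContDiff ℝ ∞ φ) (θ : ℝ) :
    rhoEnv X (lift ν φ) (kT θ) = X.sum fun w a => a * wordOp ν w φ θ := by
  unfold rhoEnv
  simp only [rhoWord_lift ν _ hφ, lift_kT]

lemma seminormQ_le (ν : ℂ) (X : List Gen →₀ ℂ) : ∃ (n : ℕ) (C : ℝ), 0 < C ∧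
    ∀ φ : ℝ → ℂ, ContDiff ℝ ∞ φ → seminormQ X (lift ν φ) ≤ C * angNorm n φ := by
  classical
  have hD : IsDiffOp id fun φ θ => X.sum fun w a => a * wordOp ν w φ θ := by
    unfold Finsupp.sum
    induction X.support using Finset.induction_on with
    | empty => exact ⟨0, fun _ _ => 0, fun _ => contDiff_const, fun f _ => by simp⟩
    | insert w s hw ih =>
      simp only [Finset.sum_insert hw]
      exact ((isDiffOp_wordOp ν w).mul contDiff_const).add ih
  obtain ⟨n, C, hC, H⟩ := hD.bound (isCompact_Icc (a := -Real.pi) (b := Real.pi))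
  refine ⟨n, C, hC, fun φ hφ => ?_⟩
  refine Real.iSup_le (fun θ => ?_) (mul_nonneg hC.le (angNorm_nonneg _ _))
  rw [rhoEnv_lift_kT ν X hφ]
  exact (H φ hφ θ ⟨θ.2.1, θ.2.2.le⟩).trans
    (mul_le_mul_of_nonneg_left (sum_le_angNorm n hφ θ.2) hC.le)

/-- `E₊ - E₋` generates the rotations `k̃(θ)`. In coordinates, the logarithmic derivatives of the
two generators have the same real part and imaginary parts that differ by `-(sin² θ + cos² θ) = -1`.
-/
lemma deriv_eq_genOp (ν : ℂ) (φ : ℝ → ℂ) (θ : ℝ) :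
    deriv φ θ = genOp ν .Ep φ θ - genOp ν .Em φ θ := by
  have h : Real.sin θ ^ 2 + Real.cos θ ^ 2 = 1 := Real.sin_sq_add_cos_sq θ
  have h' : ((Real.sin θ ^ 2 : ℝ) : ℂ) + ((Real.cos θ ^ 2 : ℝ) : ℂ) = 1 := by exact_mod_cast h
  have h1 : (genDer .Ep θ).re = (genDer .Em θ).re := by
    rw [genDer, genDer, Complex.sub_re, Complex.add_re, Complex.re_ofReal_mul, Complex.re_ofReal_mul]
    simp
  have h2 : (genDer .Ep θ).im = -(Real.sin θ ^ 2) := by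
    rw [genDer, Complex.sub_im, Complex.im_ofReal_mul, Complex.ofReal_im]
    simp
  have h3 : (genDer .Em θ).im = Real.cos θ ^ 2 := by
    rw [genDer, Complex.add_im, Complex.im_ofReal_mul, Complex.ofReal_im]
    simp
  rw [genOp, genOp, h1, h2, h3, Complex.ofReal_neg]
  linear_combination (-deriv φ θ) * h'

/-- Writing every derivative as the difference of the actions of `E₊` and `E₋` expresses the `k`-th
derivative by words of length `k`. The innermost derivative is replaced first, so each step appends
a letter on the right. -/
lemma norm_iteratedDeriv_le_wordOp (ν : ℂ) (k : ℕ) : ∃ (S : Finset (List Gen)) (C : ℝ), 0 < C ∧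
    ∀ φ : ℝ → ℂ, ContDiff ℝ ∞ φ → ∀ θ,
      ‖iteratedDeriv k φ θ‖ ≤ C * ∑ w ∈ S, ‖wordOp ν w φ θ‖ := by
  classical
  induction k with
  | zero => exact ⟨{[]}, 1, one_pos, fun φ _ θ => by simp [wordOp]⟩
  | succ k ih =>
    obtain ⟨S, C, hC, H⟩ := ih
    have hinj : ∀ X : Gen, Set.InjOn (fun w : List Gen => w ++ [X]) S := fun X a _ b _ hab =>
      List.append_cancel_right hab
    refine ⟨S.image (fun w => w ++ [Gen.Ep]) ∪ S.image (fun w => w ++ [Gen.Em]), C + C,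
      by positivity, fun φ hφ θ => ?_⟩
    have hE : ∀ X, ContDiff ℝ ∞ (genOp ν X φ) := fun X =>
      (isDiffOp_id.genOp ν X).contDiff contDiff_id hφ
    have hd : deriv φ = genOp ν .Ep φ - genOp ν .Em φ := funext (deriv_eq_genOp ν φ)
    rw [iteratedDeriv_succ', hd, iteratedDeriv_sub ((hE _).of_le (mod_cast le_top)).contDiffAt
      ((hE _).of_le (mod_cast le_top)).contDiffAt]
    refine (norm_sub_le _ _).trans ?_
    have hw : ∀ X w, wordOp ν w (genOp ν X φ) = wordOp ν (w ++ [X]) φ := fun X w => by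
      simp [wordOp]
    have key : ∀ X, S.image (fun w => w ++ [X]) ⊆
        S.image (fun w => w ++ [Gen.Ep]) ∪ S.image (fun w => w ++ [Gen.Em]) →
        ‖iteratedDeriv k (genOp ν X φ) θ‖ ≤ C * ∑ w ∈
          S.image (fun w => w ++ [Gen.Ep]) ∪ S.image (fun w => w ++ [Gen.Em]), ‖wordOp ν w φ θ‖ := by
      intro X hX
      refine (H _ (hE X) θ).trans (mul_le_mul_of_nonneg_left ?_ hC.le)
      simp only [hw]
      rw [← Finset.sum_image (f := fun w => ‖wordOp ν w φ θ‖) (hinj X)]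
      exact Finset.sum_le_sum_of_subset_of_nonneg hX fun _ _ _ => norm_nonneg _
    rw [add_mul]
    exact add_le_add (key _ Finset.subset_union_left) (key _ Finset.subset_union_right)

lemma angNorm_le (ν : ℂ) (n : ℕ) : ∃ (S : Finset (List Gen →₀ ℂ)) (C : ℝ), 0 < C ∧
    ∀ φ : ℝ → ℂ, ContDiff ℝ ∞ φ → angNorm n φ ≤ C * ∑ X ∈ S, seminormQ X (lift ν φ) := by
  classical
  choose S C hC H using norm_iteratedDeriv_le_wordOp ν
  have hinj : ∀ T : Finset (List Gen), Set.InjOn (fun w : List Gen => Finsupp.single w (1 : ℂ)) T :=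
    fun T => (Finsupp.single_left_injective one_ne_zero).injOn
  refine ⟨((Finset.range (n + 1)).biUnion S).image fun w => Finsupp.single w 1,
    ∑ k ∈ Finset.range (n + 1), C k,
    Finset.sum_pos (fun k _ => hC k) ⟨0, by simp⟩, fun φ hφ => ?_⟩
  rw [Finset.sum_image (hinj _), Finset.sum_mul]
  refine Finset.sum_le_sum fun k hk => ?_
  have hnn : 0 ≤ ∑ w ∈ (Finset.range (n + 1)).biUnion S,
      seminormQ (Finsupp.single w 1) (lift ν φ) :=
    Finset.sum_nonneg fun _ _ => seminormQ_nonneg _ _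
  refine Real.iSup_le (fun θ => (H k φ hφ θ).trans (mul_le_mul_of_nonneg_left ?_ (hC k).le))
    (mul_nonneg (hC k).le hnn)
  refine le_trans (Finset.sum_le_sum fun w _ => ?_) (Finset.sum_le_sum_of_subset_of_nonneg
    (Finset.subset_biUnion_of_mem S hk) fun _ _ _ => seminormQ_nonneg _ _)
  have e : ∀ θ, rhoEnv (Finsupp.single w 1) (lift ν φ) (kT θ) = wordOp ν w φ θ := fun θ => by
    rw [rhoEnv_lift_kT ν _ hφ]
    simp
  unfold seminormQ
  simp only [e]
  exact le_ciSup (f := fun θ : Set.Ico (-Real.pi) Real.pi => ‖wordOp ν w φ θ‖)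
    (bddAbove_Ico (contDiff_wordOp ν w hφ).continuous) θ

/-- The restriction of a function on the covering group to `k̃(θ)`. -/
noncomputable def ang (F : Cover → ℂ) (θ : ℝ) : ℂ := F (kT θ)

/-- From here on the enveloping algebra is no longer needed for continuity: words are differential
operators in `θ`, and conversely derivatives in `θ` are combinations of words. -/
lemma isPSDistribution_iff {μ ν : ℂ} (lam : PSeries μ ν →ₗ[ℂ] ℂ) :
    IsPSDistribution lam ↔ ∃ (n : ℕ) (C : ℝ), ∀ F : PSeries μ ν, ‖lam F‖ ≤ C * angNorm n (ang F) := by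
  constructor
  · rintro ⟨c, hc, S, H⟩
    choose n C hC hS using seminormQ_le ν
    refine ⟨S.sup n, c * ∑ X ∈ S, C X, fun F => (H F).trans ?_⟩
    rw [mul_assoc, Finset.sum_mul]
    refine mul_le_mul_of_nonneg_left (Finset.sum_le_sum fun X hX => ?_) hc.le
    rw [PSeries.eq_lift F.2]
    refine (hS X _ (PSeries.isQP F.2).1).trans (mul_le_mul_of_nonneg_left ?_ (hC X).le)
    rw [← PSeries.eq_lift F.2]
    exact angNorm_mono (Finset.le_sup hX) _
  · rintro ⟨n, C, H⟩
    obtain ⟨S, D, hD, hS⟩ := angNorm_le ν n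
    refine ⟨(|C| + 1) * D, by positivity, S, fun F => (H F).trans ?_⟩
    have h1 := hS _ (PSeries.isQP F.2).1
    rw [← PSeries.eq_lift F.2] at h1
    rw [mul_assoc]
    refine mul_le_mul (by linarith [le_abs_self C]) h1 (angNorm_nonneg _ _) (by positivity)

/-! ### Charts of the quotient -/

/-- The weight `(1 + x²)^w`. -/
noncomputable def wt (w : ℂ) (x : ℝ) : ℂ := Complex.exp ((Real.log (1 + x ^ 2) : ℂ) * w)

lemma wt_add (w w' : ℂ) (x : ℝ) : wt (w + w') x = wt w x * wt w' x := by
  rw [wt, mul_add, Complex.exp_add, wt, wt]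

lemma wt_zero_exp (x : ℝ) : wt 0 x = 1 := by simp [wt]

lemma wt_at_zero (w : ℂ) : wt w 0 = 1 := by simp [wt]

lemma contDiff_wt (w : ℂ) : ContDiff ℝ ∞ (wt w) := by
  have h : ContDiff ℝ ∞ fun x : ℝ => Real.log (1 + x ^ 2) :=
    (contDiff_const.add (contDiff_id.pow 2)).log fun x => by positivity
  exact Complex.contDiff_exp.comp ((Complex.ofRealCLM.contDiff.comp h).mul contDiff_const)

lemma one_add_sq_ne (x : ℝ) : (1 + (x : ℂ) ^ 2) ≠ 0 := by
  exact_mod_cast (by positivity : (1 + x ^ 2 : ℝ) ≠ 0)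

lemma hasDerivAt_wt (w : ℂ) (x : ℝ) :
    HasDerivAt (wt w) (wt w x * (2 * x / (1 + (x : ℂ) ^ 2) * w)) x := by
  have h : HasDerivAt (fun x : ℝ => Real.log (1 + x ^ 2)) (2 * x / (1 + x ^ 2)) x := by
    have := ((hasDerivAt_pow 2 x).const_add 1).log (by positivity)
    simpa using this
  have h2 := (h.ofReal_comp.mul_const w).cexp
  refine h2.congr_deriv ?_
  push_cast
  rfl

/-- The function `x ↦ (1 + x²)^{-ν-1/2} φ(c - arctan x)`. -/
noncomputable def chart (ν : ℂ) (c : ℝ) (φ : ℝ → ℂ) (x : ℝ) : ℂ :=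
  wt (-ν - 1 / 2) x * φ (c - Real.arctan x)

lemma contDiff_sub_arctan (c : ℝ) : ContDiff ℝ ∞ fun x => c - Real.arctan x :=
  contDiff_const.sub Real.contDiff_arctan

lemma isDiffOp_chart (ν : ℂ) (c : ℝ) : IsDiffOp (fun x => c - Real.arctan x) (chart ν c) :=
  (isDiffOp_comp _).mul (contDiff_wt _)

lemma contDiff_chart (ν : ℂ) (c : ℝ) {φ : ℝ → ℂ} (hφ : ContDiff ℝ ∞ φ) :
    ContDiff ℝ ∞ (chart ν c φ) :=
  (isDiffOp_chart ν c).contDiff (contDiff_sub_arctan c) hφ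

lemma apply_eq_chart (ν : ℂ) (c : ℝ) (φ : ℝ → ℂ) (x : ℝ) :
    φ (c - Real.arctan x) = wt (ν + 1 / 2) x * chart ν c φ x := by
  rw [chart, ← mul_assoc, ← wt_add]
  ring_nf
  rw [wt_zero_exp, one_mul]

lemma hasDerivAt_chart (ν : ℂ) (c : ℝ) {φ : ℝ → ℂ} (hφ : ContDiff ℝ ∞ φ) (x : ℝ) :
    HasDerivAt (chart ν c φ) (-(chart ν c (deriv φ) x + (2 * ν + 1) * x * chart ν c φ x) /
      (1 + (x : ℂ) ^ 2)) x := by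
  have h1 := hasDerivAt_wt (-ν - 1 / 2) x
  have h2 : HasDerivAt (fun x => c - Real.arctan x) (-(1 / (1 + x ^ 2))) x :=
    (Real.hasDerivAt_arctan x).const_sub c
  have h3 := h1.mul ((hasDerivAt_of_smooth hφ (c - Real.arctan x)).scomp x h2)
  refine h3.congr_deriv ?_
  have := one_add_sq_ne x
  rw [chart, chart, Complex.real_smul, Function.comp_apply]
  push_cast
  field_simp
  ring

/-- `hasDerivAt_chart` solved for the chart of `φ'`. The coefficients are polynomials in `x`, so
derivatives along the circle are differential operators on the whole line. -/
lemma chart_deriv (ν : ℂ) (c : ℝ) {φ : ℝ → ℂ} (hφ : ContDiff ℝ ∞ φ) (x : ℝ) :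
    chart ν c (deriv φ) x =
      -(1 + (x : ℂ) ^ 2) * deriv (chart ν c φ) x - (2 * ν + 1) * x * chart ν c φ x := by
  have := one_add_sq_ne x
  rw [(hasDerivAt_chart ν c hφ x).deriv]
  field_simp
  ring

lemma sin_neg_pi_div_two_sub (y : ℝ) : Real.sin (-(Real.pi / 2) - y) = -Real.cos y := by
  rw [← Real.sin_add_pi_div_two, ← Real.sin_neg]
  ring_nf

lemma cos_neg_pi_div_two_sub (y : ℝ) : Real.cos (-(Real.pi / 2) - y) = -Real.sin y := by
  rw [← Real.cos_add_pi_div_two, ← Real.cos_neg]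
  ring_nf

/-- In the group: right translation by `ũ(t)` takes `w̃ ũ(-x)` to `w̃ ũ(-(x - t))`, so `E₊` is minus
the derivative in the standard coordinate. Here it is checked on the explicit formulas. -/
lemma chart_genOp_Ep (ν : ℂ) {φ : ℝ → ℂ} (hφ : ContDiff ℝ ∞ φ) :
    chart ν (-(Real.pi / 2)) (genOp ν .Ep φ) = fun x => -deriv (chart ν (-(Real.pi / 2)) φ) x := by
  funext x
  have h0 := one_add_sq_ne x
  have hs := sin_neg_pi_div_two_sub (Real.arctan x)
  have hc := cos_neg_pi_div_two_sub (Real.arctan x)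
  have hsq : Real.cos (Real.arctan x) ^ 2 = 1 / (1 + x ^ 2) := Real.cos_sq_arctan x
  have hsc : Real.sin (Real.arctan x) * Real.cos (Real.arctan x) = x / (1 + x ^ 2) := by
    rw [Real.sin_arctan, Real.cos_arctan, div_mul_div_comm, mul_one, ← sq, Real.sq_sqrt (by positivity)]
  have h1 : (genDer .Ep (-(Real.pi / 2) - Real.arctan x)).re = -(x / (1 + x ^ 2)) := by
    rw [genDer, Complex.sub_re, Complex.re_ofReal_mul, hs, hc, ← hsc]
    simp [-Complex.ofReal_neg, -Complex.ofReal_mul]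
    ring
  have h2 : (genDer .Ep (-(Real.pi / 2) - Real.arctan x)).im = -(1 / (1 + x ^ 2)) := by
    rw [genDer, Complex.sub_im, Complex.im_ofReal_mul, hs, ← hsq, Complex.ofReal_im]
    simp
  rw [(hasDerivAt_chart ν _ hφ x).deriv, chart, genOp, h1, h2, chart, chart]
  push_cast
  field_simp
  ring

/-! ### Quasi-periodic functions -/

lemma IsQP.deriv {μ : ℂ} {φ : ℝ → ℂ} (h : IsQP μ φ) : IsQP μ (deriv φ) := by
  refine ⟨contDiff_deriv h.1, fun θ => ?_⟩
  rw [← deriv_comp_add_const φ Real.pi θ, funext h.2]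
  exact deriv_const_mul _ (h.1.differentiable (by simp) θ)

lemma IsQP.iteratedDeriv {μ : ℂ} {φ : ℝ → ℂ} (h : IsQP μ φ) (k : ℕ) :
    IsQP μ (iteratedDeriv k φ) := by
  induction k with
  | zero => simpa using h
  | succ k ih =>
    rw [iteratedDeriv_succ]
    exact ih.deriv

lemma exists_int_mul_pi (c θ : ℝ) : ∃ (m : ℤ) (θ' : ℝ), θ = m * Real.pi + θ' ∧
    θ' ∈ Set.Icc (c - Real.pi / 2) (c + Real.pi / 2) := by
  have hp := Real.pi_pos
  refine ⟨round ((θ - c) / Real.pi), θ - round ((θ - c) / Real.pi) * Real.pi, by ring, ?_⟩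
  have h := abs_le.1 (abs_sub_round ((θ - c) / Real.pi))
  have e : θ - round ((θ - c) / Real.pi) * Real.pi =
      c + ((θ - c) / Real.pi - round ((θ - c) / Real.pi)) * Real.pi := by
    field_simp
    ring
  rw [e]
  constructor <;> nlinarith [h.1, h.2]

lemma exists_sub_arctan {c θ : ℝ} (h : θ ∈ Set.Ioo (c - Real.pi / 2) (c + Real.pi / 2)) :
    ∃ x, θ = c - Real.arctan x :=
  ⟨Real.tan (c - θ), by
    rw [Real.arctan_tan (by linarith [h.2]) (by linarith [h.1])]
    ring⟩

lemma closure_Ioo_pi (c : ℝ) : closure (Set.Ioo (c - Real.pi / 2) (c + Real.pi / 2)) =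
    Set.Icc (c - Real.pi / 2) (c + Real.pi / 2) :=
  closure_Ioo (by linarith [Real.pi_pos])

/-- A chart covers an open interval of length `π`. Continuity restores the point `x = 0` and the
endpoints, and quasi-periodicity does the rest. The point `x = 0` is left out because the coordinate
change `x ↦ -1/x` is undefined there. -/
lemma IsQP.ext_chart {μ : ℂ} (ν : ℂ) (c : ℝ) {φ ψ : ℝ → ℂ} (hφ : IsQP μ φ) (hψ : IsQP μ ψ)
    (h : ∀ x ≠ 0, chart ν c φ x = chart ν c ψ x) : φ = ψ := by
  have h1 : chart ν c φ = chart ν c ψ :=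
    Continuous.ext_on (dense_compl_singleton (0 : ℝ)) (contDiff_chart ν c hφ.1).continuous
      (contDiff_chart ν c hψ.1).continuous fun x hx => h x hx
  have h2 : Set.EqOn φ ψ (Set.Ioo (c - Real.pi / 2) (c + Real.pi / 2)) := by
    intro θ hθ
    obtain ⟨x, rfl⟩ := exists_sub_arctan hθ
    rw [apply_eq_chart ν c φ, h1, ← apply_eq_chart ν c ψ]
  have h3 := h2.closure hφ.1.continuous hψ.1.continuous
  rw [closure_Ioo_pi] at h3
  funext θ
  obtain ⟨m, θ', rfl, hθ'⟩ := exists_int_mul_pi c θ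
  rw [hφ.int, hψ.int, h3 hθ']

/-! ### The involution -/

/-- The action of `F ↦ F_∞` on the restriction to `k̃(θ)`. -/
noncomputable def angInvol (μ : ℂ) (φ : ℝ → ℂ) (θ : ℝ) : ℂ :=
  Complex.exp (Real.pi * Complex.I * μ / 2) * φ (θ - Real.pi / 2)

lemma IsQP.invol {μ : ℂ} {φ : ℝ → ℂ} (h : IsQP μ φ) : IsQP μ (angInvol μ φ) := by
  refine ⟨contDiff_const.mul (h.1.comp (contDiff_id.sub contDiff_const)), fun θ => ?_⟩
  rw [angInvol, angInvol, show θ + Real.pi - Real.pi / 2 = θ - Real.pi / 2 + Real.pi by ring, h.2]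
  ring

/-- Applying the translation twice shifts the angle by `-π`, which costs `e^{-πiμ}`; the normalizing
factor `e^{πiμ/2}` is the one whose square cancels this. -/
lemma angInvol_angInvol {μ : ℂ} {φ : ℝ → ℂ} (h : IsQP μ φ) : angInvol μ (angInvol μ φ) = φ := by
  funext θ
  have := h.2 (θ - Real.pi)
  rw [sub_add_cancel] at this
  rw [angInvol, angInvol, this, show θ - Real.pi / 2 - Real.pi / 2 = θ - Real.pi by ring, ← mul_assoc,
    ← Complex.exp_add]
  congr 2
  ring

lemma invol_lift (μ ν : ℂ) (φ : ℝ → ℂ) : invol μ (lift ν φ) = lift ν (angInvol μ φ) := by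
  funext g
  have hw : ∀ k, wT.mat 0 k = ![0, -1] k ∧ wT.mat 1 k = ![1, 0] k := by
    intro k
    change kMat (-(Real.pi / 2)) 0 k = ![0, -1] k ∧ kMat (-(Real.pi / 2)) 1 k = ![1, 0] k
    fin_cases k <;> simp [kMat]
  have hJ : autJ (g * wT).mat UpperHalfPlane.I = Complex.I * autJ g.mat UpperHalfPlane.I := by
    rw [autJ_I, Cover.mul_mat, sl_mul_apply, sl_mul_apply, (hw _).1, (hw _).1, (hw _).2, (hw _).2, autJ_I]
    simp
    linear_combination (-(g.mat 1 0 : ℂ)) * Complex.I_sq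
  have hJw : autJ wT.mat UpperHalfPlane.I = Complex.I := by
    rw [autJ_I, (hw _).2, (hw _).2]
    simp
  -- A rotation fixes `i`, so the correction term of the product in the cover vanishes and the
  -- angles simply add.
  have hJ2 : autJ g.mat (wT.mat • UpperHalfPlane.I) = autJ g.mat UpperHalfPlane.I := by
    have h1 := autJ_mul g.mat wT.mat UpperHalfPlane.I
    rw [← Cover.mul_mat, hJ, hJw, mul_comm] at h1
    exact (mul_right_cancel₀ Complex.I_ne_zero h1).symm
  have hang : (g * wT).ang = g.ang - Real.pi / 2 := by
    rw [Cover.mul_ang, hJ2, div_self (autJ_ne_zero _ _), Complex.arg_one]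
    change g.ang + -(Real.pi / 2) - 0 = _
    ring
  rw [invol, lift, lift, hJ, hang, norm_mul, Complex.norm_I, one_mul, angInvol]
  ring

lemma PSeries.invol_mem {μ ν : ℂ} {F : Cover → ℂ} (hF : F ∈ PSeries μ ν) : invol μ F ∈ PSeries μ ν := by
  rw [PSeries.eq_lift hF, invol_lift]
  exact lift_mem ν (PSeries.isQP hF).invol

lemma PSeries.ang_invol {μ ν : ℂ} {F : Cover → ℂ} (hF : F ∈ PSeries μ ν) :
    ang (invol μ F) = angInvol μ (ang F) := by
  funext θ
  rw [ang, PSeries.eq_lift hF, invol_lift, lift_kT, ← PSeries.eq_lift hF]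
  rfl

lemma PSeries.ext_ang {μ ν : ℂ} {F G : Cover → ℂ} (hF : F ∈ PSeries μ ν) (hG : G ∈ PSeries μ ν)
    (h : ang F = ang G) : F = G := by
  rw [PSeries.eq_lift hF, PSeries.eq_lift hG]
  exact congrArg (lift ν) h

/-- The coordinate `x ↦ F(w̃ ũ(-x))` of a function in the principal series, in terms of its
restriction to `k̃(θ)`. -/
noncomputable abbrev stdChart (ν : ℂ) (φ : ℝ → ℂ) : ℝ → ℂ := chart ν (-(Real.pi / 2)) φ

lemma norm_wt (w : ℂ) (x : ℝ) (t : ℝ) (ht : 0 < t) (h : t ^ 2 = 1 + x ^ 2) :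
    wt w x = (t : ℂ) ^ (2 * w) := by
  rw [wt, ← h, Real.log_pow, Complex.cpow_def_of_ne_zero (by exact_mod_cast ht.ne'),
    ← Complex.ofReal_log ht.le]
  congr 1
  push_cast
  ring

/-- At the angle `θ = -π/2 - arctan x` the argument of `J / c` is `-θ`, which lies in `(0, π)` and
is therefore principal, so the phase in `ι` is `1`. The factor `|c|^{-2ν-1}` with `c = cos (arctan
x)` cancels the weight of the chart. -/
lemma stdChart_iota (μ ν : ℂ) (f : ℝ → ℂ) : stdChart ν (ang (iotaFun μ ν f)) = f := by
  funext x
  set θ := -(Real.pi / 2) - Real.arctan x with hθ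
  have hs : Real.sin θ = _ := sin_neg_pi_div_two_sub (Real.arctan x)
  have hc : Real.cos θ = _ := cos_neg_pi_div_two_sub (Real.arctan x)
  have hpos : 0 < Real.cos (Real.arctan x) := Real.cos_arctan_pos x
  have hm0 : (kT θ).mat 1 0 = Real.cos (Real.arctan x) := by
    change kMat θ 1 0 = _
    simp [kMat, hs]
  have hm1 : (kT θ).mat 1 1 = -Real.sin (Real.arctan x) := by
    change kMat θ 1 1 = _
    simp [kMat, hc]
  have htan : Real.sin (Real.arctan x) / Real.cos (Real.arctan x) = x := by
    rw [← Real.tan_eq_sin_div_cos, Real.tan_arctan]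
  have hk : (kT θ).ang = θ := rfl
  have hJ : autJ (kT θ).mat UpperHalfPlane.I / ((kT θ).mat 1 0 : ℂ) =
      ((1 / Real.cos (Real.arctan x) : ℝ) : ℂ) * (Real.cos (-θ) + Real.sin (-θ) * Complex.I) := by
    rw [autJ_I, hm0, hm1, Real.cos_neg, Real.sin_neg, hs, hc]
    push_cast
    ring
  have hl := Real.neg_pi_div_two_lt_arctan x
  have hu := Real.arctan_lt_pi_div_two x
  have harg : Complex.arg (autJ (kT θ).mat UpperHalfPlane.I / ((kT θ).mat 1 0 : ℂ)) = -θ := by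
    rw [hJ, Complex.ofReal_cos, Complex.ofReal_sin]
    exact Complex.arg_mul_cos_add_sin_mul_I (by positivity) ⟨by linarith, by linarith⟩
  rw [stdChart, chart, ← hθ, ang, iotaFun, if_neg (by rw [hm0]; exact hpos.ne'), harg, hk, hm0, hm1,
    neg_neg, htan, abs_of_pos hpos]
  have e1 : ((Real.cos (Real.arctan x) : ℝ) : ℂ) ^ (-2 * ν - 1) = wt (ν + 1 / 2) x := by
    rw [norm_wt _ _ (Real.sqrt (1 + x ^ 2)) (by positivity) (Real.sq_sqrt (by positivity)),
      Real.cos_arctan, one_div, Complex.ofReal_inv, Complex.inv_cpow, ← Complex.cpow_neg]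
    · congr 1
      ring
    · rw [Complex.arg_ofReal_of_nonneg (by positivity)]
      exact Real.pi_ne_zero.symm
  rw [e1]
  simp only [Complex.ofReal_neg, add_neg_cancel, mul_zero, Complex.exp_zero, one_mul]
  rw [← mul_assoc, ← wt_add]
  ring_nf
  rw [wt_zero_exp, one_mul]

lemma stdChart_angInvol (μ ν : ℂ) (φ : ℝ → ℂ) (x : ℝ) : stdChart ν (angInvol μ φ) x =
    Complex.exp (Real.pi * Complex.I * μ / 2) * chart ν (-Real.pi) φ x := by
  rw [stdChart, chart, angInvol, chart,
    show -(Real.pi / 2) - Real.arctan x - Real.pi / 2 = -Real.pi - Real.arctan x by ring]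
  ring

/-- The coordinate change between the two charts: `arctan (-1/x)` is `arctan x` shifted by `π/2` for
`x < 0` and by `-π/2` for `x > 0`. In the second case the angles differ by a full `π`, and
quasi-periodicity produces the sign in the phase. -/
lemma stdChart_angInvol_eq_fInf {μ : ℂ} (ν : ℂ) {φ : ℝ → ℂ} (hφ : IsQP μ φ) {x : ℝ} (hx : x ≠ 0) :
    stdChart ν (angInvol μ φ) x = fInf μ ν (stdChart ν φ) x := by
  rw [stdChart_angInvol, fInf, if_neg hx, stdChart, chart, chart]
  have hw : ((|x| : ℝ) : ℂ) ^ (-2 * ν - 1) * wt (-ν - 1 / 2) (-1 / x) = wt (-ν - 1 / 2) x := by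
    have h1 : 1 + x ^ 2 = x ^ 2 * (1 + (-1 / x) ^ 2) := by
      field_simp
      ring
    have hx' : 0 < |x| := abs_pos.2 hx
    rw [wt, wt, h1, Real.log_mul (by positivity) (by positivity), ← sq_abs x, Real.log_pow,
      Complex.cpow_def_of_ne_zero (by exact_mod_cast hx'.ne'), ← Complex.ofReal_log hx'.le,
      ← Complex.exp_add]
    congr 1
    push_cast
    ring
  rw [← hw]
  rcases lt_or_gt_of_ne hx with h | h
  · have ha : Real.arctan (-1 / x) = Real.pi / 2 + Real.arctan x := by
      rw [neg_div, Real.arctan_neg, one_div, Real.arctan_inv_of_neg h]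
      ring
    rw [ha, Real.sign_of_neg h,
      show -(Real.pi / 2) - (Real.pi / 2 + Real.arctan x) = -Real.pi - Real.arctan x by ring]
    push_cast
    rw [show -(-1 * Real.pi * Complex.I * μ / 2) = Real.pi * Complex.I * μ / 2 by ring]
    ring
  · have ha : Real.arctan (-1 / x) = -(Real.pi / 2) + Real.arctan x := by
      rw [neg_div, Real.arctan_neg, one_div, Real.arctan_inv_of_pos h]
      ring
    have h2 := hφ.2 (-Real.pi - Real.arctan x)
    rw [ha, Real.sign_of_pos h,
      show -(Real.pi / 2) - (-(Real.pi / 2) + Real.arctan x) = -Real.pi - Real.arctan x + Real.pi by ring,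
      h2]
    push_cast
    rw [show Real.pi * Complex.I * μ / 2 = -(1 * Real.pi * Complex.I * μ / 2) + Real.pi * Complex.I * μ by ring,
      Complex.exp_add]
    ring

/-! ### The functionals `δ_∞^{(m)}` -/

lemma stdChart_wordOp_Ep (ν : ℂ) (m : ℕ) {φ : ℝ → ℂ} (hφ : ContDiff ℝ ∞ φ) :
    stdChart ν (wordOp ν (List.replicate m Gen.Ep) φ) =
      fun x => (-1) ^ m * iteratedDeriv m (stdChart ν φ) x := by
  induction m with
  | zero => simp [wordOp]
  | succ m ih =>
    rw [List.replicate_succ]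
    change stdChart ν (genOp ν .Ep (wordOp ν (List.replicate m Gen.Ep) φ)) = _
    rw [stdChart, chart_genOp_Ep ν (contDiff_wordOp ν _ hφ), ← stdChart, ih]
    funext x
    rw [deriv_const_mul_field, iteratedDeriv_succ]
    ring

/-- The point `w̃ = k̃(-π/2)` is the origin of the standard chart, where the weight is `1`. -/
lemma deltaInf_eq {μ ν : ℂ} {F : Cover → ℂ} (hF : F ∈ PSeries μ ν) (m : ℕ) :
    deltaInf μ m F = (-1) ^ m * iteratedDeriv m (stdChart ν (angInvol μ (ang F))) 0 := by
  have h := (PSeries.isQP hF).invol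
  have h2 := congrFun (stdChart_wordOp_Ep ν m h.1) 0
  rw [deltaInf, PSeries.eq_lift hF, invol_lift, rhoWord_lift ν _ h.1, wT, lift_kT]
  rw [stdChart, chart, wt_at_zero, Real.arctan_zero, sub_zero, one_mul] at h2
  rw [h2]
  rw [← PSeries.eq_lift hF]
  rfl

/-! ### Test functions -/

lemma TestFn.smooth (f : TestFn) : ContDiff ℝ ∞ (f : ℝ → ℂ) := f.contDiff

lemma hasCompactSupport_of_abs {f : ℝ → ℂ} {u : ℝ} (h : ∀ x, u < |x| → f x = 0) :
    HasCompactSupport f :=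
  HasCompactSupport.intro (isCompact_Icc (a := -u) (b := u)) fun x hx => h x (by
    by_contra hle
    exact hx (abs_le.1 (not_lt.1 hle)))

/-- The test function given by a smooth function vanishing outside `[-u, u]`. -/
def mkTest (f : ℝ → ℂ) (hf : ContDiff ℝ ∞ f) (u : ℝ) (h : ∀ x, u < |x| → f x = 0) : TestFn :=
  ⟨f, hf, hasCompactSupport_of_abs h, fun _ _ => trivial⟩

lemma mkTest_apply (f : ℝ → ℂ) (hf : ContDiff ℝ ∞ f) (u : ℝ) (h : ∀ x, u < |x| → f x = 0) (x : ℝ) :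
    mkTest f hf u h x = f x := rfl

lemma TestFn.exists_bound (f : TestFn) : ∃ u : ℝ, 0 < u ∧ ∀ x, u < |x| → f x = 0 := by
  obtain ⟨R, hR⟩ := f.hasCompactSupport.isCompact.isBounded.subset_closedBall (0 : ℝ)
  refine ⟨|R| + 1, by positivity, fun x hx => ?_⟩
  by_contra hne
  have hmem := hR (subset_tsupport _ hne)
  rw [Metric.mem_closedBall, dist_zero_right, Real.norm_eq_abs] at hmem
  linarith [le_abs_self R]

lemma tsupport_subset_iff {f : ℝ → ℂ} {u : ℝ} :
    tsupport f ⊆ {x | |x| ≤ u} ↔ ∀ x, u < |x| → f x = 0 := by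
  constructor
  · intro h x hx
    by_contra hne
    exact absurd (h (subset_tsupport _ hne)) (not_le.2 hx)
  · intro h
    refine closure_minimal (fun x hx => ?_) (isClosed_le continuous_abs continuous_const)
    by_contra hle
    exact hx (h x (not_le.1 hle))

lemma hasCompactSupport_iteratedDeriv {f : ℝ → ℂ} (h : HasCompactSupport f) (k : ℕ) :
    HasCompactSupport (iteratedDeriv k f) := by
  induction k with
  | zero => simpa using h
  | succ k ih =>
    rw [iteratedDeriv_succ]
    exact ih.deriv

/-- `∑_{i ≤ m} sup |f^{(i)}|`. -/
noncomputable def testNorm (m : ℕ) (f : ℝ → ℂ) : ℝ :=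
  ∑ i ∈ Finset.range (m + 1), ⨆ x : ℝ, ‖iteratedDeriv i f x‖

lemma testNorm_nonneg (m : ℕ) (f : ℝ → ℂ) : 0 ≤ testNorm m f :=
  Finset.sum_nonneg fun _ _ => Real.iSup_nonneg fun _ => norm_nonneg _

lemma testNorm_mono {n m : ℕ} (h : n ≤ m) (φ : ℝ → ℂ) : testNorm n φ ≤ testNorm m φ :=
  Finset.sum_le_sum_of_subset_of_nonneg (Finset.range_mono (by omega))
    fun _ _ _ => Real.iSup_nonneg fun _ => norm_nonneg _

lemma norm_iteratedDeriv_le_iSup {f : ℝ → ℂ} (hf : ContDiff ℝ ∞ f) (hc : HasCompactSupport f)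
    (k : ℕ) (x : ℝ) : ‖iteratedDeriv k f x‖ ≤ ⨆ x : ℝ, ‖iteratedDeriv k f x‖ := by
  obtain ⟨C, hC⟩ := (hasCompactSupport_iteratedDeriv hc k).exists_bound_of_continuous
    (contDiff_iteratedDeriv hf k).continuous
  exact le_ciSup (f := fun x : ℝ => ‖iteratedDeriv k f x‖) ⟨C, by rintro _ ⟨y, rfl⟩; exact hC y⟩ x

lemma sum_le_testNorm {f : ℝ → ℂ} (hf : ContDiff ℝ ∞ f) (hc : HasCompactSupport f) (m : ℕ) (x : ℝ) :
    ∑ k ∈ Finset.range (m + 1), ‖iteratedDeriv k f x‖ ≤ testNorm m f :=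
  Finset.sum_le_sum fun k _ => norm_iteratedDeriv_le_iSup hf hc k x

lemma norm_iteratedDeriv_le_testNorm {f : ℝ → ℂ} (hf : ContDiff ℝ ∞ f) (hc : HasCompactSupport f)
    {k m : ℕ} (hk : k ≤ m) (x : ℝ) : ‖iteratedDeriv k f x‖ ≤ testNorm m f :=
  (norm_iteratedDeriv_le_iSup hf hc k x).trans (Finset.single_le_sum
    (f := fun k => ⨆ x : ℝ, ‖iteratedDeriv k f x‖)
    (fun _ _ => Real.iSup_nonneg fun _ => norm_nonneg _) (Finset.mem_range.2 (by omega)))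

lemma norm_le_testNorm {f : ℝ → ℂ} (hf : ContDiff ℝ ∞ f) (hc : HasCompactSupport f)
    (m : ℕ) (x : ℝ) : ‖f x‖ ≤ testNorm m f := by
  simpa using norm_iteratedDeriv_le_testNorm hf hc (Nat.zero_le m) x

lemma testNorm_le {f : ℝ → ℂ} {m : ℕ} {B : ℝ} (hB : 0 ≤ B)
    (h : ∀ k ≤ m, ∀ x, ‖iteratedDeriv k f x‖ ≤ B) : testNorm m f ≤ (m + 1) * B := by
  refine (Finset.sum_le_card_nsmul _ _ B fun k hk => Real.iSup_le (fun x => h k ?_ x) hB).trans ?_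
  · rw [Finset.mem_range] at hk
    omega
  · simp

/-! ### Comparison of the topologies -/

lemma exists_chart_iteratedDeriv (ν : ℂ) (c : ℝ) (k : ℕ) : ∃ E : (ℝ → ℂ) → ℝ → ℂ, IsDiffOp id E ∧
    ∀ φ : ℝ → ℂ, ContDiff ℝ ∞ φ → chart ν c (iteratedDeriv k φ) = E (chart ν c φ) := by
  induction k with
  | zero => exact ⟨fun f => f, isDiffOp_id, fun φ _ => by simp⟩
  | succ k ih =>
    obtain ⟨E, hE, H⟩ := ih
    have hx : ContDiff ℝ ∞ fun x : ℝ => (x : ℂ) := Complex.ofRealCLM.contDiff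
    refine ⟨fun f x => -(1 + (x : ℂ) ^ 2) * deriv (E f) x + (-((2 * ν + 1) * x)) * E f x,
      ((hE.deriv contDiff_id).mul (contDiff_const.add (hx.pow 2)).neg).add
        (hE.mul (contDiff_const.mul hx).neg), fun φ hφ => ?_⟩
    funext x
    rw [iteratedDeriv_succ, chart_deriv ν c (contDiff_iteratedDeriv hφ k), H φ hφ]
    ring

lemma IsDiffOp.eq_zero {b : ℝ → ℝ} (hb : Continuous b) {D : (ℝ → ℂ) → ℝ → ℂ}
    (hD : IsDiffOp b D) {f : ℝ → ℂ} (hf : ContDiff ℝ ∞ f) {x : ℝ}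
    (h : f =ᶠ[𝓝 (b x)] fun _ => 0) : D f x = 0 := by
  rw [(hD.congr_of_eventuallyEq hb hf contDiff_const h).eq_of_nhds]
  obtain ⟨n, c, hc, H⟩ := hD
  rw [H _ contDiff_const]
  refine Finset.sum_eq_zero fun j _ => ?_
  rw [iteratedDeriv_fun_const_zero]
  simp

/-- Differential operators are local, so they preserve the support in `[-u, u]` and the bound on
this compact set is global. -/
lemma IsDiffOp.bound_testNorm {D : (ℝ → ℂ) → ℝ → ℂ} (hD : IsDiffOp id D) (u : ℝ) :
    ∃ (n : ℕ) (C : ℝ), 0 < C ∧ ∀ f : ℝ → ℂ, ContDiff ℝ ∞ f → (∀ x, u < |x| → f x = 0) → ∀ x,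
      ‖D f x‖ ≤ C * testNorm n f := by
  obtain ⟨n, C, hC, H⟩ := hD.bound (isCompact_Icc (a := -u) (b := u))
  refine ⟨n, C, hC, fun f hf h x => ?_⟩
  by_cases hx : |x| ≤ u
  · exact (H f hf x (abs_le.1 hx)).trans (mul_le_mul_of_nonneg_left
      (sum_le_testNorm hf (hasCompactSupport_of_abs h) n _) hC.le)
  · rw [hD.eq_zero continuous_id hf]
    · simpa using mul_nonneg hC.le (testNorm_nonneg _ _)
    · filter_upwards [continuous_abs.continuousAt.eventually (eventually_gt_nhds (not_le.1 hx))]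
        with y hy using h y hy

lemma IsQP.norm_le {μ : ℂ} {φ : ℝ → ℂ} (hφ : IsQP μ φ) (c : ℝ) {B : ℝ}
    (h : ∀ x, ‖φ (c - Real.arctan x)‖ ≤ B) {θ : ℝ} (hθ : θ ∈ Set.Ico (-Real.pi) Real.pi) :
    ‖φ θ‖ ≤ Real.exp ((2 * Real.pi + |c|) * |μ.im|) * B := by
  have hp := Real.pi_pos
  have h2 : Set.Icc (c - Real.pi / 2) (c + Real.pi / 2) ⊆ {θ | ‖φ θ‖ ≤ B} := by
    rw [← closure_Ioo_pi]
    refine closure_minimal (fun θ hθ => ?_) (isClosed_le hφ.1.continuous.norm continuous_const)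
    obtain ⟨x, rfl⟩ := exists_sub_arctan hθ
    exact h x
  obtain ⟨m, θ', rfl, hθ'⟩ := exists_int_mul_pi c θ
  have h3 : ‖φ θ'‖ ≤ B := h2 hθ'
  rw [hφ.int, norm_mul]
  refine mul_le_mul ?_ h3 (norm_nonneg _) (Real.exp_pos _).le
  rw [Complex.norm_exp, Real.exp_le_exp]
  have e : (Real.pi * m * Complex.I * μ).re = -(m * Real.pi) * μ.im := by
    simp only [Complex.mul_re, Complex.mul_im, Complex.ofReal_re, Complex.ofReal_im, Complex.intCast_re,
      Complex.intCast_im, Complex.I_re, Complex.I_im]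
    ring
  rw [e]
  -- Here `mπ = θ - θ'` with `|θ| ≤ π` and `|θ' - c| ≤ π/2`.
  have hm : |m * Real.pi| ≤ 2 * Real.pi + |c| := by
    rw [abs_le]
    constructor <;> linarith [hθ.1, hθ.2, hθ'.1, hθ'.2, le_abs_self c, neg_abs_le c]
  calc -(m * Real.pi) * μ.im ≤ |-(m * Real.pi) * μ.im| := le_abs_self _
    _ = |m * Real.pi| * |μ.im| := by rw [abs_mul, abs_neg]
    _ ≤ _ := mul_le_mul_of_nonneg_right hm (abs_nonneg _)

/-- With `c = -π/2` this makes `ι`, and with `c = 0` its composition with the involution, continuous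
on test functions with support in a fixed interval. It is what turns functionals on the principal
series into distributions on `ℝ`. -/
lemma angNorm_le_testNorm (μ ν : ℂ) (c u : ℝ) (n : ℕ) : ∃ (m : ℕ) (C : ℝ), 0 < C ∧
    ∀ φ : ℝ → ℂ, IsQP μ φ → (∀ x, u < |x| → chart ν c φ x = 0) →
      angNorm n φ ≤ C * testNorm m (chart ν c φ) := by
  choose E hE HE using exists_chart_iteratedDeriv ν c
  choose m C hC HC using fun k => (hE k).bound_testNorm u
  obtain ⟨M, hM⟩ := (isCompact_Icc (a := -u) (b := u)).exists_bound_of_continuousOn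
    (contDiff_wt (ν + 1 / 2)).continuous.continuousOn
  set A := Real.exp ((2 * Real.pi + |c|) * |μ.im|) with hA
  have hA0 : 0 < A := Real.exp_pos _
  refine ⟨(Finset.range (n + 1)).sup m, ∑ k ∈ Finset.range (n + 1), A * ((|M| + 1) * C k),
    Finset.sum_pos (fun k _ => by have := hC k; positivity) ⟨0, by simp⟩, fun φ hφ h => ?_⟩
  rw [Finset.sum_mul]
  refine Finset.sum_le_sum fun k hk => ?_
  have ht : testNorm (m k) (chart ν c φ) ≤ testNorm ((Finset.range (n + 1)).sup m) (chart ν c φ) :=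
    testNorm_mono (Finset.le_sup hk) _
  have h0 := testNorm_nonneg ((Finset.range (n + 1)).sup m) (chart ν c φ)
  have hCk := hC k
  refine Real.iSup_le (fun θ => ?_) (by positivity)
  rw [mul_assoc]
  refine (hφ.iteratedDeriv k).norm_le c (fun x => ?_) θ.2
  rw [apply_eq_chart ν c (iteratedDeriv k φ), norm_mul, HE k φ hφ.1]
  have hb := (HC k _ (contDiff_chart ν c hφ.1) h x).trans (mul_le_mul_of_nonneg_left ht hCk.le)
  by_cases hx : |x| ≤ u
  · rw [mul_assoc]
    exact mul_le_mul ((hM x (abs_le.1 hx)).trans (by linarith [le_abs_self M])) hb (norm_nonneg _)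
      (by positivity)
  · rw [(hE k).eq_zero continuous_id (contDiff_chart ν c hφ.1), norm_zero, mul_zero]
    · positivity
    · filter_upwards [continuous_abs.continuousAt.eventually (eventually_gt_nhds (not_le.1 hx))]
        with y hy using h y hy

lemma iotaFun_mem (μ ν : ℂ) (f : TestFn) : iotaFun μ ν f ∈ PSeries μ ν := (iota μ ν f).2

/-- The involution `F ↦ F_∞` of `I^∞_{μ,ν}`. -/
noncomputable def involL (μ ν : ℂ) : PSeries μ ν →ₗ[ℂ] PSeries μ ν where
  toFun F := ⟨invol μ F, PSeries.invol_mem F.2⟩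
  map_add' F G := by
    ext g
    exact mul_add _ _ _
  map_smul' a F := by
    ext g
    exact mul_left_comm _ _ _

/-- The chart centred at `-π` leaves the window `[-π, π)` over which the seminorms are taken. Moving
it by `π` to the chart centred at `0` only costs a constant. -/
lemma stdChart_angInvol_eq_chart_zero {μ : ℂ} (ν : ℂ) {φ : ℝ → ℂ} (hφ : IsQP μ φ) (x : ℝ) :
    stdChart ν (angInvol μ φ) x = Complex.exp (-(Real.pi * Complex.I * μ / 2)) * chart ν 0 φ x := by
  have h := hφ.int (-1) (0 - Real.arctan x)
  rw [stdChart_angInvol, chart, chart, show -Real.pi - Real.arctan x =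
    ((-1 : ℤ) : ℝ) * Real.pi + (0 - Real.arctan x) by push_cast; ring, h]
  rw [show -(Real.pi * Complex.I * μ / 2) = Real.pi * Complex.I * μ / 2 +
    Real.pi * ((-1 : ℤ) : ℂ) * Complex.I * μ by push_cast; ring, Complex.exp_add]
  ring

lemma isDistribution_restr {μ ν : ℂ} {lam : PSeries μ ν →ₗ[ℂ] ℂ} (h : IsPSDistribution lam) :
    IsDistribution (restr lam) := by
  obtain ⟨n, C, H⟩ := (isPSDistribution_iff lam).1 h
  intro u hu
  obtain ⟨m, D, hD, HD⟩ := angNorm_le_testNorm μ ν (-(Real.pi / 2)) u n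
  refine ⟨m, (|C| + 1) * D, by positivity, fun f hf => ?_⟩
  rw [tsupport_subset_iff] at hf
  have e := stdChart_iota μ ν f
  have h1 := HD (ang (iotaFun μ ν f)) (PSeries.isQP (iotaFun_mem μ ν f)) (fun x hx => by
    change stdChart ν (ang (iotaFun μ ν f)) x = 0
    rw [e]
    exact hf x hx)
  have h2 := H (iota μ ν f)
  change angNorm n (ang (iotaFun μ ν f)) ≤ D * testNorm m (stdChart ν (ang (iotaFun μ ν f))) at h1
  rw [e] at h1
  rw [mul_assoc]
  refine h2.trans (mul_le_mul (by linarith [le_abs_self C]) h1 (angNorm_nonneg _ _) (by positivity))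

lemma stdChart_angInvol_invol_iota (μ ν : ℂ) (f : TestFn) :
    stdChart ν (angInvol μ (ang (invol μ (iotaFun μ ν f)))) = f := by
  have hQ : IsQP μ (ang (iotaFun μ ν f)) := PSeries.isQP (iotaFun_mem μ ν f)
  rw [PSeries.ang_invol (iotaFun_mem μ ν f), angInvol_angInvol hQ]
  exact stdChart_iota μ ν f

lemma isDistribution_restr_invol {μ ν : ℂ} {lam : PSeries μ ν →ₗ[ℂ] ℂ} (h : IsPSDistribution lam) :
    IsDistribution (restr (lam ∘ₗ involL μ ν)) := by
  obtain ⟨n, C, H⟩ := (isPSDistribution_iff lam).1 h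
  intro u hu
  obtain ⟨m, D, hD, HD⟩ := angNorm_le_testNorm μ ν 0 u n
  set a := Complex.exp (Real.pi * Complex.I * μ / 2) with ha
  refine ⟨m, (|C| + 1) * (D * ((m + 1) * (‖a‖ + 1))), by positivity, fun f hf => ?_⟩
  rw [tsupport_subset_iff] at hf
  set F := involL μ ν (iota μ ν f) with hF
  have hQ : IsQP μ (ang F) := PSeries.isQP F.2
  have e : chart ν 0 (ang F) = fun x => a * f x := by
    funext x
    have h1 := stdChart_angInvol_eq_chart_zero ν hQ x
    have h2 := congrFun (stdChart_angInvol_invol_iota μ ν f) x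
    change stdChart ν (angInvol μ (ang F)) x = f x at h2
    rw [← h2, h1, ← mul_assoc, ha, ← Complex.exp_add, add_neg_cancel, Complex.exp_zero, one_mul]
  have h1 := HD (ang F) hQ (fun x hx => by rw [e]; simp [hf x hx])
  rw [e] at h1
  have h0 := testNorm_nonneg m f
  have h3 : testNorm m (fun x => a * f x) ≤ (m + 1) * ((‖a‖ + 1) * testNorm m f) := by
    refine testNorm_le (by positivity) fun k hk x => ?_
    rw [iteratedDeriv_const_mul_field, norm_mul]
    exact mul_le_mul (by linarith) (norm_iteratedDeriv_le_testNorm f.smooth f.hasCompactSupport hk x)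
      (norm_nonneg _) (by positivity)
  refine (H F).trans (le_trans (mul_le_mul (le_trans (le_abs_self C) (by linarith : |C| ≤ |C| + 1))
    (h1.trans (mul_le_mul_of_nonneg_left h3 hD.le)) (angNorm_nonneg _ _) (by positivity)) (le_of_eq ?_))
  change _ = (|C| + 1) * (D * ((m + 1) * (‖a‖ + 1))) * testNorm m f
  ring

lemma eq_zero_of_punctured {h : ℝ → ℂ} (hh : Continuous h) {ε : ℝ} (hε : 0 < ε)
    (h0 : ∀ x, x ≠ 0 → |x| < ε → h x = 0) {x : ℝ} (hx : |x| < ε) : h x = 0 := by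
  rcases eq_or_ne x 0 with rfl | hne
  · have h1 : Filter.Tendsto h (𝓝[≠] 0) (𝓝 (h 0)) := hh.continuousAt.tendsto.mono_left nhdsWithin_le_nhds
    have h2 : Filter.Tendsto h (𝓝[≠] 0) (𝓝 0) := by
      refine tendsto_const_nhds.congr' ?_
      have hb : ∀ᶠ y : ℝ in 𝓝[≠] 0, |y| < ε := by
        refine nhdsWithin_le_nhds ?_
        exact continuous_abs.continuousAt.eventually (eventually_lt_nhds (by simpa using hε))
      filter_upwards [hb, self_mem_nhdsWithin] with y hy hy0 using (h0 y hy0 hy).symm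
    exact tendsto_nhds_unique h1 h2
  · exact h0 x hne hx

/-- If `x` is small then `-1/x` lies outside the support of `f`: the function `ι(f)` vanishes in a
neighbourhood of the point at infinity. -/
lemma stdChart_angInvol_iota_eq_zero (μ ν : ℂ) {f : TestFn} {u : ℝ} (hu : 0 < u)
    (hf : ∀ x, u < |x| → f x = 0) {x : ℝ} (hx : |x| < 1 / u) :
    stdChart ν (angInvol μ (ang (iotaFun μ ν f))) x = 0 := by
  have hQ : IsQP μ (ang (iotaFun μ ν f)) := PSeries.isQP (iotaFun_mem μ ν f)
  refine eq_zero_of_punctured (contDiff_chart ν _ hQ.invol.1).continuous (by positivity : 0 < 1 / u)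
    (fun y hy hyu => ?_) hx
  rw [← stdChart, stdChart_angInvol_eq_fInf ν hQ hy, stdChart_iota, fInf, if_neg hy, hf, mul_zero]
  rw [abs_div, abs_neg, abs_one]
  exact (lt_one_div hu (abs_pos.2 hy)).2 hyu

lemma deltaInf_iota (μ ν : ℂ) (m : ℕ) (f : TestFn) : deltaInf μ m (iotaFun μ ν f) = 0 := by
  rw [deltaInf_eq (iotaFun_mem μ ν f)]
  obtain ⟨u, hu, hf⟩ := f.exists_bound
  have : stdChart ν (angInvol μ (ang (iotaFun μ ν f))) =ᶠ[𝓝 0] fun _ => 0 := by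
    filter_upwards [continuous_abs.continuousAt.eventually (eventually_lt_nhds
      (by simpa using hu : |(0 : ℝ)| < 1 / u))] with x hx
    exact stdChart_angInvol_iota_eq_zero μ ν hu hf hx
  rw [(iteratedDeriv_congr_of_eventuallyEq this m).eq_of_nhds, iteratedDeriv_fun_const_zero]
  simp

lemma deltaInf_invol_iota (μ ν : ℂ) (m : ℕ) (f : TestFn) :
    deltaInf μ m (invol μ (iotaFun μ ν f)) = deltaDeriv m f := by
  rw [deltaInf_eq (PSeries.invol_mem (iotaFun_mem μ ν f)), stdChart_angInvol_invol_iota]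
  rfl

/-! ### Partitions -/

/-- A cutoff function: `1` on `[-1, 1]` and `0` outside `[-2, 2]`. -/
noncomputable def cutoff (x : ℝ) : ℂ := ((⟨1, 2, one_pos, one_lt_two⟩ : ContDiffBump (0 : ℝ)) x : ℝ)

lemma contDiff_cutoff : ContDiff ℝ ∞ cutoff :=
  Complex.ofRealCLM.contDiff.comp (ContDiffBump.contDiff _)

lemma cutoff_one {x : ℝ} (hx : |x| ≤ 1) : cutoff x = 1 := by
  rw [cutoff, ContDiffBump.one_of_mem_closedBall]
  · simp
  · simpa using hx

lemma cutoff_zero {x : ℝ} (hx : 2 ≤ |x|) : cutoff x = 0 := by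
  rw [cutoff, ContDiffBump.zero_of_le_dist]
  · simp
  · simpa using hx

/-- The complementary cutoff function `x ↦ 1 - cutoff (-1 / x)` at infinity. -/
noncomputable def cutoffInf (x : ℝ) : ℂ := if x = 0 then 1 else 1 - cutoff (-1 / x)

lemma cutoffInf_one {x : ℝ} (hx : |x| ≤ 1 / 2) : cutoffInf x = 1 := by
  rw [cutoffInf]
  split_ifs with h
  · rfl
  · rw [cutoff_zero, sub_zero]
    rw [abs_div, abs_neg, abs_one, le_div_iff₀ (abs_pos.2 h)]
    linarith

lemma cutoffInf_zero {x : ℝ} (hx : 1 < |x|) : cutoffInf x = 0 := by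
  have h : x ≠ 0 := by
    rintro rfl
    norm_num at hx
  rw [cutoffInf, if_neg h, cutoff_one, sub_self]
  rw [abs_div, abs_neg, abs_one, div_le_one (by linarith)]
  exact hx.le

lemma contDiff_cutoffInf : ContDiff ℝ ∞ cutoffInf := by
  rw [contDiff_iff_contDiffAt]
  intro x
  rcases eq_or_ne x 0 with rfl | hx
  · refine (contDiffAt_const (c := (1 : ℂ))).congr_of_eventuallyEq ?_
    filter_upwards [continuous_abs.continuousAt.eventually (eventually_lt_nhds
      (by norm_num : |(0 : ℝ)| < 1 / 2))] with y hy using cutoffInf_one hy.le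
  · have h : ContDiffAt ℝ ∞ (fun x => 1 - cutoff (-1 / x)) x :=
      contDiffAt_const.sub (contDiff_cutoff.contDiffAt.comp x (contDiffAt_const.div contDiffAt_id hx))
    refine h.congr_of_eventuallyEq ?_
    filter_upwards [isOpen_ne.mem_nhds hx] with y hy
    rw [cutoffInf, if_neg hy]

/-- The first component of the standard partition of a function in the principal series. -/
noncomputable def partFst (ν : ℂ) (φ : ℝ → ℂ) (hφ : ContDiff ℝ ∞ φ) : TestFn :=
  mkTest (fun x => cutoff x * stdChart ν φ x) (contDiff_cutoff.mul (contDiff_chart ν _ hφ)) 2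
    fun x hx => by rw [cutoff_zero hx.le, zero_mul]

/-- The second component of the standard partition of a function in the principal series. -/
noncomputable def partSnd (μ ν : ℂ) (φ : ℝ → ℂ) (hφ : ContDiff ℝ ∞ φ) : TestFn :=
  mkTest (fun x => cutoffInf x * (Complex.exp (-(Real.pi * Complex.I * μ / 2)) * chart ν 0 φ x))
    (contDiff_cutoffInf.mul (contDiff_const.mul (contDiff_chart ν _ hφ))) 2
    fun x hx => by rw [cutoffInf_zero (by linarith), zero_mul]

/-- The two cutoffs form a partition of unity on the circle, because `cutoffInf (-1/x) = 1 - cutoff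
x`. It suffices to compare both sides in the standard chart away from `x = 0`. -/
lemma isPartition_part {μ ν : ℂ} {F : Cover → ℂ} (hF : F ∈ PSeries μ ν) :
    IsPartition μ ν F (partFst ν (ang F) (PSeries.isQP hF).1, partSnd μ ν (ang F) (PSeries.isQP hF).1) := by
  have hQ : IsQP μ (ang F) := PSeries.isQP hF
  set f₁ := partFst ν (ang F) (PSeries.isQP hF).1 with hf₁
  set f₂ := partSnd μ ν (ang F) (PSeries.isQP hF).1 with hf₂
  have hQ₁ : IsQP μ (ang (iotaFun μ ν f₁)) := PSeries.isQP (iotaFun_mem μ ν f₁)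
  have hQ₂ : IsQP μ (ang (iotaFun μ ν f₂)) := PSeries.isQP (iotaFun_mem μ ν f₂)
  have hmem : iotaFun μ ν f₁ + invol μ (iotaFun μ ν f₂) ∈ PSeries μ ν :=
    (PSeries μ ν).add_mem (iotaFun_mem μ ν f₁) (PSeries.invol_mem (iotaFun_mem μ ν f₂))
  refine PSeries.ext_ang hmem hF ?_
  refine IsQP.ext_chart ν (-(Real.pi / 2)) (PSeries.isQP hmem) hQ fun x hx => ?_
  have e1 : ang (iotaFun μ ν f₁ + invol μ (iotaFun μ ν f₂)) =
      fun θ => ang (iotaFun μ ν f₁) θ + angInvol μ (ang (iotaFun μ ν f₂)) θ := by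
    rw [← PSeries.ang_invol (iotaFun_mem μ ν f₂)]
    rfl
  have e2 : stdChart ν (ang (iotaFun μ ν f₁ + invol μ (iotaFun μ ν f₂))) x =
      stdChart ν (ang (iotaFun μ ν f₁)) x + stdChart ν (angInvol μ (ang (iotaFun μ ν f₂))) x := by
    rw [e1]
    exact mul_add _ _ _
  change stdChart ν (ang (iotaFun μ ν f₁ + invol μ (iotaFun μ ν f₂))) x = stdChart ν (ang F) x
  have e3 : ∀ y, f₂ y = cutoffInf y * stdChart ν (angInvol μ (ang F)) y := fun y => by
    rw [stdChart_angInvol_eq_chart_zero ν hQ]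
    rfl
  -- The coordinate change applied to the involuted function expresses `F` at `x` through the chart
  -- at infinity at `-1/x`.
  have e4 := stdChart_angInvol_eq_fInf ν hQ.invol hx
  rw [angInvol_angInvol hQ, fInf, if_neg hx] at e4
  rw [e2, stdChart_angInvol_eq_fInf ν hQ₂ hx, stdChart_iota, stdChart_iota, fInf, if_neg hx, e3]
  have e5 : cutoffInf (-1 / x) = 1 - cutoff x := by
    rw [cutoffInf, if_neg (div_ne_zero (by norm_num) hx)]
    congr 2
    field_simp
  have e6 : f₁ x = cutoff x * stdChart ν (ang F) x := rfl
  rw [e5, e6]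
  linear_combination (-(1 - cutoff x)) * e4

/-- Both components of the standard partition have this form: supports in the fixed interval `[-2,
2]` and angles in the window of the seminorms. Hence the constants do not depend on `φ`. -/
lemma IsDiffOp.testNorm_le_angNorm {c : ℝ} {D : (ℝ → ℂ) → ℝ → ℂ}
    (hD : IsDiffOp (fun x => c - Real.arctan x) D)
    (hc : ∀ x, c - Real.arctan x ∈ Set.Ico (-Real.pi) Real.pi)
    (h2 : ∀ φ, ContDiff ℝ ∞ φ → ∀ x, 2 < |x| → D φ x = 0) (m : ℕ) : ∃ (n : ℕ) (C : ℝ), 0 < C ∧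
      ∀ φ : ℝ → ℂ, ContDiff ℝ ∞ φ → testNorm m (D φ) ≤ C * angNorm n φ := by
  choose n C hC H using fun k => (hD.iteratedDeriv (contDiff_sub_arctan c) k).bound
    (isCompact_Icc (a := -2) (b := (2 : ℝ)))
  refine ⟨(Finset.range (m + 1)).sup n, (m + 1) * ∑ k ∈ Finset.range (m + 1), C k, ?_,
    fun φ hφ => ?_⟩
  · have : 0 < ∑ k ∈ Finset.range (m + 1), C k := Finset.sum_pos (fun k _ => hC k) ⟨0, by simp⟩
    positivity
  · have h0 := angNorm_nonneg ((Finset.range (m + 1)).sup n) φ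
    have hS : 0 ≤ ∑ k ∈ Finset.range (m + 1), C k := Finset.sum_nonneg fun k _ => (hC k).le
    rw [mul_assoc]
    refine testNorm_le (by positivity) fun k hk x => ?_
    have hk' : k ∈ Finset.range (m + 1) := Finset.mem_range.2 (by omega)
    by_cases hx : |x| ≤ 2
    · refine (H k φ hφ x (abs_le.1 hx)).trans ?_
      exact mul_le_mul (Finset.single_le_sum (f := C) (fun i _ => (hC i).le) hk')
        ((sum_le_angNorm _ hφ (hc x)).trans (angNorm_mono (Finset.le_sup hk') _))
        (Finset.sum_nonneg fun _ _ => norm_nonneg _) hS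
    · have : D φ =ᶠ[𝓝 x] fun _ => 0 := by
        filter_upwards [continuous_abs.continuousAt.eventually (eventually_gt_nhds (not_le.1 hx))]
          with y hy using h2 φ hφ y hy
      rw [(iteratedDeriv_congr_of_eventuallyEq this k).eq_of_nhds, iteratedDeriv_fun_const_zero]
      simpa using mul_nonneg hS h0

lemma testNorm_partFst_le (ν : ℂ) (m : ℕ) : ∃ (n : ℕ) (C : ℝ), 0 < C ∧
    ∀ (φ : ℝ → ℂ) (hφ : ContDiff ℝ ∞ φ), testNorm m (partFst ν φ hφ) ≤ C * angNorm n φ := by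
  refine IsDiffOp.testNorm_le_angNorm ((isDiffOp_chart ν (-(Real.pi / 2))).mul contDiff_cutoff)
    (fun x => ?_) (fun φ _ x hx => by rw [cutoff_zero hx.le, zero_mul]) m
  have h1 := Real.neg_pi_div_two_lt_arctan x
  have h2 := Real.arctan_lt_pi_div_two x
  constructor <;> linarith

lemma testNorm_partSnd_le (μ ν : ℂ) (m : ℕ) : ∃ (n : ℕ) (C : ℝ), 0 < C ∧
    ∀ (φ : ℝ → ℂ) (hφ : ContDiff ℝ ∞ φ), testNorm m (partSnd μ ν φ hφ) ≤ C * angNorm n φ := by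
  refine IsDiffOp.testNorm_le_angNorm (((isDiffOp_chart ν 0).mul (contDiff_const
    (c := Complex.exp (-(Real.pi * Complex.I * μ / 2))))).mul contDiff_cutoffInf)
    (fun x => ?_) (fun φ _ x hx => by rw [cutoffInf_zero (by linarith), zero_mul]) m
  have h1 := Real.neg_pi_div_two_lt_arctan x
  have h2 := Real.arctan_lt_pi_div_two x
  constructor <;> linarith [Real.pi_pos]

/-! ### The twisted Fourier transform at `y ≠ 0` -/

lemma fInf_of_ne (μ s : ℂ) (f : ℝ → ℂ) {x : ℝ} (hx : x ≠ 0) : fInf μ s f x =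
    Complex.exp (-(Real.sign x * Real.pi * Complex.I * μ / 2)) *
      (Complex.exp ((Real.log x : ℂ) * (-2 * s - 1)) * f (-1 / x)) := by
  have hx' : ((|x| : ℝ) : ℂ) ≠ 0 := by exact_mod_cast (abs_pos.2 hx).ne'
  rw [fInf, if_neg hx, Complex.cpow_def_of_ne_zero hx', ← Complex.ofReal_log (abs_nonneg _),
    Real.log_abs, mul_assoc]

lemma fInf_eq_zero (μ s : ℂ) {f : ℝ → ℂ} {u : ℝ} (hu : 0 < u) (hf : ∀ x, u < |x| → f x = 0) {x : ℝ}
    (hx : |x| < 1 / u) : fInf μ s f x = 0 := by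
  rcases eq_or_ne x 0 with rfl | h
  · simp [fInf]
  · rw [fInf_of_ne μ s f h, hf, mul_zero, mul_zero]
    rw [abs_div, abs_neg, abs_one]
    exact (lt_one_div hu (abs_pos.2 h)).2 hx

/-- The operator `D_s` with `(f_{μ,s,∞})' = (D_s f)_{μ,s,∞}`. -/
noncomputable def dOp (s : ℂ) (f : ℝ → ℂ) (t : ℝ) : ℂ := (2 * s + 1) * t * f t + (t : ℂ) ^ 2 * deriv f t

lemma eventually_sign {x : ℝ} (hx : x ≠ 0) : ∀ᶠ y in 𝓝 x, Real.sign y = Real.sign x := by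
  rcases lt_or_gt_of_ne hx with h | h
  · filter_upwards [eventually_lt_nhds h] with y hy
    rw [Real.sign_of_neg hy, Real.sign_of_neg h]
  · filter_upwards [eventually_gt_nhds h] with y hy
    rw [Real.sign_of_pos hy, Real.sign_of_pos h]

lemma hasDerivAt_fInf (μ s : ℂ) {f : ℝ → ℂ} (hf : ContDiff ℝ ∞ f) {u : ℝ} (hu : 0 < u)
    (h0 : ∀ x, u < |x| → f x = 0) (x : ℝ) : HasDerivAt (fInf μ s f) (fInf μ s (dOp s f) x) x := by
  rcases eq_or_ne x 0 with rfl | hx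
  -- Near `0` the argument `-1/x` has left the support of `f`, so the function is identically `0`
  -- there and the singular factor `|x|^{-2s-1}` is harmless.
  · have h1 : fInf μ s (dOp s f) 0 = 0 := by simp [fInf]
    rw [h1]
    refine (hasDerivAt_const (0 : ℝ) (0 : ℂ)).congr_of_eventuallyEq ?_
    filter_upwards [continuous_abs.continuousAt.eventually (eventually_lt_nhds
      (by simpa using hu : |(0 : ℝ)| < 1 / u))] with y hy using fInf_eq_zero μ s hu h0 hy
  · have hxC : (x : ℂ) ≠ 0 := by exact_mod_cast hx
    have h1 := ((Real.hasDerivAt_log hx).ofReal_comp.mul_const (-2 * s - 1)).cexp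
    have h2 : HasDerivAt (fun x : ℝ => -1 / x) (1 / x ^ 2) x := by
      have := (hasDerivAt_inv hx).neg
      refine (this.congr_of_eventuallyEq (Filter.Eventually.of_forall fun y => ?_)).congr_deriv ?_
      · simp [neg_div]
      · simp
    have h3 := (h1.mul ((hasDerivAt_of_smooth hf (-1 / x)).scomp x h2)).const_mul
      (Complex.exp (-(Real.sign x * Real.pi * Complex.I * μ / 2)))
    refine (h3.congr_of_eventuallyEq ?_).congr_deriv ?_
    · filter_upwards [eventually_sign hx, isOpen_ne.mem_nhds hx] with y hy hy0
      rw [fInf_of_ne μ s f hy0, hy]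
      rfl
    · rw [fInf_of_ne μ s _ hx, dOp, Complex.real_smul, Function.comp_apply]
      push_cast
      field_simp
      ring

lemma contDiff_dOp (s : ℂ) {f : ℝ → ℂ} (hf : ContDiff ℝ ∞ f) : ContDiff ℝ ∞ (dOp s f) := by
  have hx : ContDiff ℝ ∞ fun x : ℝ => (x : ℂ) := Complex.ofRealCLM.contDiff
  exact ((contDiff_const.mul hx).mul hf).add ((hx.pow 2).mul (contDiff_deriv hf))

lemma dOp_eq_zero (s : ℂ) {f : ℝ → ℂ} {t : ℝ} (h : f =ᶠ[𝓝 t] fun _ => 0) : dOp s f =ᶠ[𝓝 t] fun _ => 0 := by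
  filter_upwards [h, h.deriv] with x hx hx'
  rw [dOp, hx, hx']
  simp

/-- The iterates of `D_s`. -/
noncomputable def dIter (s : ℂ) : ℕ → (ℝ → ℂ) → ℝ → ℂ
  | 0, f => f
  | N + 1, f => dOp s (dIter s N f)

lemma contDiff_dIter (s : ℂ) (N : ℕ) {f : ℝ → ℂ} (hf : ContDiff ℝ ∞ f) :
    ContDiff ℝ ∞ (dIter s N f) := by
  induction N with
  | zero => exact hf
  | succ N ih => exact contDiff_dOp s ih

lemma dIter_eventually_zero (s : ℂ) (N : ℕ) {f : ℝ → ℂ} {t : ℝ} (h : f =ᶠ[𝓝 t] fun _ => 0) :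
    dIter s N f =ᶠ[𝓝 t] fun _ => 0 := by
  induction N with
  | zero => exact h
  | succ N ih => exact dOp_eq_zero s ih

lemma eventually_zero_of_lt_abs {f : ℝ → ℂ} {u : ℝ} (h0 : ∀ x, u < |x| → f x = 0) {x : ℝ}
    (hx : u < |x|) : f =ᶠ[𝓝 x] fun _ => 0 := by
  filter_upwards [continuous_abs.continuousAt.eventually (eventually_gt_nhds hx)] with y hy using h0 y hy

lemma eventually_zero_of_abs_lt {f : ℝ → ℂ} {u : ℝ} (h0 : ∀ x, |x| < u → f x = 0) {x : ℝ}
    (hx : |x| < u) : f =ᶠ[𝓝 x] fun _ => 0 := by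
  filter_upwards [continuous_abs.continuousAt.eventually (eventually_lt_nhds hx)] with y hy using h0 y hy

lemma dIter_zero_of_lt (s : ℂ) (N : ℕ) {f : ℝ → ℂ} {u : ℝ} (h0 : ∀ x, u < |x| → f x = 0) :
    ∀ x, u < |x| → dIter s N f x = 0 := fun _ hx =>
  (dIter_eventually_zero s N (eventually_zero_of_lt_abs h0 hx)).eq_of_nhds

/-- The essential feature is the factor `t^N` common to all terms: it makes `(D_s^N f)_{μ,s,∞}`
smaller by `|x|^{-N}` at infinity. The dependence on `s` sits in holomorphic coefficients. -/
lemma dIter_formula (N : ℕ) : ∃ p : ℕ → ℂ → ℂ, (∀ j, Differentiable ℂ (p j)) ∧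
    ∀ (s : ℂ) (f : ℝ → ℂ), ContDiff ℝ ∞ f → ∀ t : ℝ, dIter s N f t =
      ∑ j ∈ Finset.range (N + 1), p j s * ((t : ℂ) ^ (N + j) * iteratedDeriv j f t) := by
  induction N with
  | zero => exact ⟨fun _ _ => 1, fun _ => differentiable_const _, fun s f _ t => by simp [dIter]⟩
  | succ N ih =>
    obtain ⟨p, hp, H⟩ := ih
    -- Recursion from applying `D_s` to `t^{N+j} f^{(j)}`: the terms that keep `j` contribute the
    -- factor `2s + 1 + N + j`, and differentiating `f^{(j)}` moves the coefficient to `j + 1`.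
    refine ⟨fun j s => (if j = N + 1 then 0 else (2 * s + 1 + (N + j : ℕ)) * p j s) +
      (if j = 0 then 0 else p (j - 1) s), fun j => ?_, fun s f hf t => ?_⟩
    · refine Differentiable.fun_add ?_ ?_
      · split_ifs
        · exact differentiable_const _
        · exact ((differentiable_id.const_mul _).add_const _ |>.add_const _).mul (hp j)
      · split_ifs
        · exact differentiable_const _
        · exact hp _
    · have hd : HasDerivAt (dIter s N f) (∑ j ∈ Finset.range (N + 1), p j s *
          (((N + j : ℕ) : ℂ) * (t : ℂ) ^ (N + j - 1) * iteratedDeriv j f t +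
            (t : ℂ) ^ (N + j) * iteratedDeriv (j + 1) f t)) t := by
        rw [funext (H s f hf)]
        refine HasDerivAt.fun_sum fun j _ => HasDerivAt.const_mul _ ?_
        have e1 : HasDerivAt (fun t : ℝ => (t : ℂ) ^ (N + j)) (((N + j : ℕ) : ℂ) * (t : ℂ) ^ (N + j - 1)) t := by
          simpa using (hasDerivAt_pow (N + j) (t : ℂ)).comp_ofReal
        rw [iteratedDeriv_succ]
        exact e1.mul (hasDerivAt_of_smooth (contDiff_iteratedDeriv hf j) t)
      rw [dIter, dOp, hd.deriv, H s f hf]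
      simp only [add_mul]
      rw [Finset.sum_add_distrib]
      have e1 : ∑ j ∈ Finset.range (N + 1 + 1), (if j = N + 1 then 0 else (2 * s + 1 + (N + j : ℕ)) * p j s) *
          ((t : ℂ) ^ (N + 1 + j) * iteratedDeriv j f t) = ∑ j ∈ Finset.range (N + 1),
            ((2 * s + 1 + (N + j : ℕ)) * p j s) * ((t : ℂ) ^ (N + 1 + j) * iteratedDeriv j f t) := by
        rw [Finset.sum_range_succ, if_pos rfl, zero_mul, add_zero]
        refine Finset.sum_congr rfl fun j hj => ?_
        rw [if_neg (by rw [Finset.mem_range] at hj; omega)]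
      have e2 : ∑ j ∈ Finset.range (N + 1 + 1), (if j = 0 then 0 else p (j - 1) s) *
          ((t : ℂ) ^ (N + 1 + j) * iteratedDeriv j f t) = ∑ j ∈ Finset.range (N + 1),
            p j s * ((t : ℂ) ^ (N + 1 + (j + 1)) * iteratedDeriv (j + 1) f t) := by
        rw [Finset.sum_range_succ']
        simp
      have e3 : ∀ a b c : ℕ → ℂ, ∑ j ∈ Finset.range (N + 1), a j + ∑ j ∈ Finset.range (N + 1), b j =
          ∑ j ∈ Finset.range (N + 1), (a j + b j) := fun a b _ => Finset.sum_add_distrib.symm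
      simp only [add_mul] at e1
      rw [e1, e2, ← add_mul, Finset.mul_sum, Finset.mul_sum, ← Finset.sum_add_distrib,
        ← Finset.sum_add_distrib]
      refine Finset.sum_congr rfl fun j _ => ?_
      -- The exponent `N + j - 1` is truncated subtraction, so `N + j = 0` is treated apart; there
      -- its coefficient vanishes.
      rcases Nat.eq_zero_or_pos (N + j) with h | h
      · rw [h]
        have hN : N = 0 := by omega
        have hj : j = 0 := by omega
        subst hN hj
        simp
        ring
      · obtain ⟨k, hk⟩ : ∃ k, N + j = k + 1 := ⟨N + j - 1, by omega⟩
        rw [show N + 1 + (j + 1) = k + 3 by omega, show N + 1 + j = k + 2 by omega, hk,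
          show k + 1 - 1 = k by omega]
        push_cast
        ring

/-! ### Integrability of `f_{μ,s,∞}` and partial integration. -/

lemma norm_fInf_le (μ s : ℂ) : ∃ A : ℝ, 0 < A ∧ ∀ (f : ℝ → ℂ) (x : ℝ), x ≠ 0 →
    ‖fInf μ s f x‖ ≤ A * (|x| ^ (-2 * s.re - 1) * ‖f (-1 / x)‖) := by
  refine ⟨Real.exp (Real.pi * |μ.im| / 2), Real.exp_pos _, fun f x hx => ?_⟩
  rw [fInf, if_neg hx, norm_mul, norm_mul, mul_assoc,
    Complex.norm_cpow_eq_rpow_re_of_pos (abs_pos.2 hx)]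
  have e : (-2 * s - 1).re = -2 * s.re - 1 := by simp
  rw [e]
  refine mul_le_mul_of_nonneg_right ?_ (by positivity)
  rw [Complex.norm_exp, Real.exp_le_exp]
  have h1 : (-((Real.sign x : ℂ) * Real.pi * Complex.I * μ / 2)).re = Real.sign x * (Real.pi * μ.im / 2) := by
    rw [show -((Real.sign x : ℂ) * Real.pi * Complex.I * μ / 2) =
      ((-(Real.sign x * Real.pi / 2) : ℝ) : ℂ) * (Complex.I * μ) by push_cast; ring, Complex.re_ofReal_mul]
    simp
    ring
  rw [h1]
  have hp := Real.pi_pos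
  have h2 := le_abs_self μ.im
  have h3 := neg_abs_le μ.im
  rcases lt_or_gt_of_ne hx with h | h
  · rw [Real.sign_of_neg h]
    nlinarith
  · rw [Real.sign_of_pos h]
    nlinarith

lemma continuous_fInf (μ s : ℂ) {f : ℝ → ℂ} (hf : ContDiff ℝ ∞ f) {u : ℝ} (hu : 0 < u)
    (h0 : ∀ x, u < |x| → f x = 0) : Continuous (fInf μ s f) :=
  continuous_iff_continuousAt.2 fun x => (hasDerivAt_fInf μ s hf hu h0 x).continuousAt

/-- Vanishing of order `N` at the origin becomes the decay `|x|^{-2 re s - 1 - N}` at infinity,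
integrable exactly under the hypothesis on `N`; near `0` the function vanishes. The constant depends
on the support only through `u`. -/
lemma integrable_fInf (μ s : ℂ) {u : ℝ} (hu : 0 < u) {N : ℕ} (hN : 0 < 2 * s.re + N) :
    ∃ M : ℝ, 0 < M ∧ ∀ (f : ℝ → ℂ) (C : ℝ), ContDiff ℝ ∞ f → (∀ x, u < |x| → f x = 0) →
      (∀ t, ‖f t‖ ≤ C * |t| ^ N) →
      MeasureTheory.Integrable (fInf μ s f) ∧ ∫ x, ‖fInf μ s f x‖ ≤ M * C := by
  obtain ⟨A, hA, HA⟩ := norm_fInf_le μ s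
  set r : ℝ := 2 * s.re + 1 + N with hr
  have hint : MeasureTheory.Integrable fun x : ℝ => (1 + ‖x‖) ^ (-r) :=
    integrable_one_add_norm (by simp; linarith)
  have hI0 : 0 ≤ ∫ x : ℝ, (1 + ‖x‖) ^ (-r) :=
    MeasureTheory.integral_nonneg fun x => by positivity
  refine ⟨A * (1 + u) ^ r * (∫ x : ℝ, (1 + ‖x‖) ^ (-r)) + 1, by positivity, fun f C hf h0 hb => ?_⟩
  have hC : 0 ≤ C := by
    have := (norm_nonneg _).trans (hb 1)
    simpa using this
  have key : ∀ x, ‖fInf μ s f x‖ ≤ A * (1 + u) ^ r * C * (1 + ‖x‖) ^ (-r) := by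
    intro x
    by_cases hx : |x| < 1 / u
    · rw [fInf_eq_zero μ s hu h0 hx, norm_zero]
      positivity
    · have hx' : 1 / u ≤ |x| := not_lt.1 hx
      have hxp : 0 < |x| := lt_of_lt_of_le (by positivity) hx'
      have hx0 : x ≠ 0 := abs_pos.1 hxp
      refine (HA f x hx0).trans ?_
      have h1 : ‖f (-1 / x)‖ ≤ C * |x| ^ (-(N : ℝ)) := by
        refine (hb _).trans (le_of_eq ?_)
        rw [abs_div, abs_neg, abs_one, Real.rpow_neg hxp.le, Real.rpow_natCast, one_div, inv_pow]
      have h2 : |x| ^ (-2 * s.re - 1) * |x| ^ (-(N : ℝ)) = |x| ^ (-r) := by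
        rw [← Real.rpow_add hxp]
        congr 1
        rw [hr]
        ring
      -- On `|x| ≥ 1/u` one has `1 + |x| ≤ (1 + u) |x|`, so the power of `|x|` may be replaced by a
      -- globally integrable one.
      have h3 : |x| ^ (-r) ≤ (1 + u) ^ r * (1 + ‖x‖) ^ (-r) := by
        rw [Real.norm_eq_abs, Real.rpow_neg hxp.le, Real.rpow_neg (by positivity), ← div_eq_mul_inv,
          ← Real.div_rpow (by positivity) (by positivity), ← Real.inv_rpow hxp.le]
        refine Real.rpow_le_rpow (by positivity) ?_ (by linarith)
        rw [div_le_iff₀ hu] at hx'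
        rw [le_div_iff₀ (by positivity), inv_mul_le_iff₀ hxp]
        linarith
      calc A * (|x| ^ (-2 * s.re - 1) * ‖f (-1 / x)‖)
          ≤ A * (|x| ^ (-2 * s.re - 1) * (C * |x| ^ (-(N : ℝ)))) := by gcongr
        _ = A * C * (|x| ^ (-2 * s.re - 1) * |x| ^ (-(N : ℝ))) := by ring
        _ ≤ A * C * ((1 + u) ^ r * (1 + ‖x‖) ^ (-r)) := by
          rw [h2]
          exact mul_le_mul_of_nonneg_left h3 (by positivity)
        _ = _ := by ring
  have hfi : MeasureTheory.Integrable (fInf μ s f) :=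
    (hint.const_mul (A * (1 + u) ^ r * C)).mono' (continuous_fInf μ s hf hu h0).aestronglyMeasurable
      (Filter.Eventually.of_forall key)
  refine ⟨hfi, ?_⟩
  calc ∫ x, ‖fInf μ s f x‖ ≤ ∫ x : ℝ, A * (1 + u) ^ r * C * (1 + ‖x‖) ^ (-r) :=
        MeasureTheory.integral_mono hfi.norm (hint.const_mul _) key
    _ = A * (1 + u) ^ r * (∫ x : ℝ, (1 + ‖x‖) ^ (-r)) * C := by
      rw [MeasureTheory.integral_const_mul]
      ring
    _ ≤ _ := mul_le_mul_of_nonneg_right (by linarith) hC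

lemma norm_character (x y : ℝ) : ‖Complex.exp (2 * Real.pi * Complex.I * x * y)‖ = 1 := by
  rw [show 2 * Real.pi * Complex.I * x * y = ((2 * Real.pi * x * y : ℝ) : ℂ) * Complex.I by push_cast; ring]
  exact Complex.norm_exp_ofReal_mul_I _

lemma continuous_character (y : ℝ) :
    Continuous fun x : ℝ => Complex.exp (2 * Real.pi * Complex.I * x * y) := by fun_prop

lemma integrable_mul_character {f : ℝ → ℂ} (hf : MeasureTheory.Integrable f) (y : ℝ) :
    MeasureTheory.Integrable fun x : ℝ => f x * Complex.exp (2 * Real.pi * Complex.I * x * y) :=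
  hf.mul_bdd (c := 1) (continuous_character y).aestronglyMeasurable
    (Filter.Eventually.of_forall fun x => (norm_character x y).le)

lemma norm_fourierT_le (f : ℝ → ℂ) (y : ℝ) : ‖fourierT f y‖ ≤ ∫ x, ‖f x‖ := by
  refine (MeasureTheory.norm_integral_le_integral_norm _).trans (le_of_eq ?_)
  simp only [norm_mul, norm_character, mul_one]

lemma fourierT_fInf_dOp (μ s : ℂ) {f : ℝ → ℂ} (hf : ContDiff ℝ ∞ f) {u : ℝ} (hu : 0 < u)
    (h0 : ∀ x, u < |x| → f x = 0) (h1 : MeasureTheory.Integrable (fInf μ s f))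
    (h2 : MeasureTheory.Integrable (fInf μ s (dOp s f))) (y : ℝ) :
    fourierT (fInf μ s (dOp s f)) y = -(2 * Real.pi * Complex.I * y) * fourierT (fInf μ s f) y := by
  have hv : ∀ x : ℝ, HasDerivAt (fun x : ℝ => Complex.exp (2 * Real.pi * Complex.I * x * y))
      (Complex.exp (2 * Real.pi * Complex.I * x * y) * (2 * Real.pi * Complex.I * y)) x := by
    intro x
    have h := ((((hasDerivAt_id (x : ℂ)).const_mul (2 * Real.pi * Complex.I)).mul_const (y : ℂ)).cexp).comp_ofReal
    simpa using h
  have := MeasureTheory.integral_mul_deriv_eq_deriv_mul_of_integrable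
    (u := fInf μ s f) (u' := fInf μ s (dOp s f))
    (v := fun x : ℝ => Complex.exp (2 * Real.pi * Complex.I * x * y))
    (v' := fun x : ℝ => Complex.exp (2 * Real.pi * Complex.I * x * y) * (2 * Real.pi * Complex.I * y))
    (fun x _ => hasDerivAt_fInf μ s hf hu h0 x) (fun x _ => hv x)
    (by
      have := (integrable_mul_character h1 y).mul_const (2 * Real.pi * Complex.I * y)
      refine this.congr (Filter.Eventually.of_forall fun x => ?_)
      simp only [Pi.mul_apply]
      ring) (integrable_mul_character h2 y) (integrable_mul_character h1 y)
  rw [fourierT, fourierT, ← neg_eq_iff_eq_neg.2 this, ← MeasureTheory.integral_const_mul,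
    ← MeasureTheory.integral_neg]
  congr 1
  funext x
  ring

lemma dIter_bound (N : ℕ) (s : ℂ) (u : ℝ) : ∃ B : ℝ, 0 < B ∧ ∀ f : ℝ → ℂ, ContDiff ℝ ∞ f →
    (∀ x, u < |x| → f x = 0) → ∀ t, ‖dIter s N f t‖ ≤ B * testNorm N f * |t| ^ N := by
  obtain ⟨p, hp, H⟩ := dIter_formula N
  refine ⟨1 + ∑ j ∈ Finset.range (N + 1), ‖p j s‖ * |u| ^ j, by positivity, fun f hf h0 t => ?_⟩
  have hc := hasCompactSupport_of_abs h0
  have hT := testNorm_nonneg N f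
  by_cases ht : |t| ≤ u
  · rw [H s f hf, add_mul, add_mul]
    refine (norm_sum_le _ _).trans ?_
    refine le_trans ?_ (le_add_of_nonneg_left (by positivity))
    rw [Finset.sum_mul, Finset.sum_mul]
    refine Finset.sum_le_sum fun j hj => ?_
    rw [norm_mul, norm_mul, norm_pow, Complex.norm_real, Real.norm_eq_abs, pow_add]
    have h1 := norm_iteratedDeriv_le_testNorm hf hc (Nat.lt_succ_iff.1 (Finset.mem_range.1 hj)) t
    have h2 : |t| ^ j ≤ |u| ^ j := pow_le_pow_left₀ (abs_nonneg _) (ht.trans (le_abs_self u)) j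
    calc ‖p j s‖ * (|t| ^ N * |t| ^ j * ‖iteratedDeriv j f t‖)
        ≤ ‖p j s‖ * (|t| ^ N * |u| ^ j * testNorm N f) := by gcongr
      _ = _ := by ring
  · rw [dIter_zero_of_lt s N h0 t (not_le.1 ht), norm_zero]
    positivity

lemma integrable_fInf_dIter (μ s : ℂ) {f : ℝ → ℂ} (hf : ContDiff ℝ ∞ f) {u : ℝ} (hu : 0 < u)
    (h0 : ∀ x, u < |x| → f x = 0) {N : ℕ} (hN : 0 < 2 * s.re + N) :
    MeasureTheory.Integrable (fInf μ s (dIter s N f)) := by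
  obtain ⟨M, hM, H⟩ := integrable_fInf μ s hu hN
  obtain ⟨B, hB, HB⟩ := dIter_bound N s u
  exact (H _ _ (contDiff_dIter s N hf) (dIter_zero_of_lt s N h0) (HB f hf h0)).1

/-- A bounded function that vanishes near the origin is `O(|t|^N)` for every `N`, so no condition on
`s` remains. -/
lemma integrable_fInf_of_zero (μ s : ℂ) {f : ℝ → ℂ} (hf : ContDiff ℝ ∞ f) {u ε : ℝ} (hu : 0 < u)
    (h0 : ∀ x, u < |x| → f x = 0) (hε : 0 < ε) (h1 : ∀ x, |x| < ε → f x = 0) :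
    MeasureTheory.Integrable (fInf μ s f) := by
  obtain ⟨N, hN⟩ := exists_nat_gt (-(2 * s.re))
  obtain ⟨M, hM, H⟩ := integrable_fInf μ s (N := N) hu (by linarith)
  have hc := hasCompactSupport_of_abs h0
  refine (H f (testNorm 0 f * (1 / ε) ^ N) hf h0 fun t => ?_).1
  by_cases ht : |t| < ε
  · rw [h1 t ht, norm_zero]
    have := testNorm_nonneg 0 f
    positivity
  · rw [mul_assoc, ← mul_pow]
    refine (norm_le_testNorm hf hc 0 t).trans (le_mul_of_one_le_right (testNorm_nonneg 0 f) ?_)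
    refine one_le_pow₀ ?_
    rw [one_div, inv_mul_eq_div, one_le_div hε]
    exact not_lt.1 ht

/-- The `N`-fold partial integration of `s ↦ 𝓕(f_{μ,s,∞})(y)`. -/
noncomputable def partInt (μ : ℂ) (f : ℝ → ℂ) (y : ℝ) (N : ℕ) (s : ℂ) : ℂ :=
  (-(2 * Real.pi * Complex.I * y))⁻¹ ^ N * fourierT (fInf μ s (dIter s N f)) y

lemma two_pi_I_ne {y : ℝ} (hy : y ≠ 0) : -(2 * Real.pi * Complex.I * y : ℂ) ≠ 0 := by
  have : (Real.pi : ℂ) ≠ 0 := by exact_mod_cast Real.pi_ne_zero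
  have : (y : ℂ) ≠ 0 := by exact_mod_cast hy
  simp [*]

lemma partInt_succ (μ s : ℂ) {f : ℝ → ℂ} (hf : ContDiff ℝ ∞ f) {u : ℝ} (hu : 0 < u)
    (h0 : ∀ x, u < |x| → f x = 0) {y : ℝ} (hy : y ≠ 0) {N : ℕ}
    (h1 : MeasureTheory.Integrable (fInf μ s (dIter s N f)))
    (h2 : MeasureTheory.Integrable (fInf μ s (dIter s (N + 1) f))) :
    partInt μ f y (N + 1) s = partInt μ f y N s := by
  have := two_pi_I_ne hy
  rw [partInt, partInt, dIter, fourierT_fInf_dOp μ s (contDiff_dIter s N hf) hu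
    (dIter_zero_of_lt s N h0) h1 h2, pow_succ, ← mul_assoc, mul_assoc _ _ (-(2 * Real.pi * Complex.I * y : ℂ)),
    inv_mul_cancel₀ this, mul_one]

lemma partInt_eq_of_le (μ s : ℂ) {f : ℝ → ℂ} (hf : ContDiff ℝ ∞ f) {u : ℝ} (hu : 0 < u)
    (h0 : ∀ x, u < |x| → f x = 0) {y : ℝ} (hy : y ≠ 0) {N M : ℕ} (hN : 0 < 2 * s.re + N)
    (hNM : N ≤ M) : partInt μ f y M s = partInt μ f y N s := by
  induction M, hNM using Nat.le_induction with
  | base => rfl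
  | succ M hM ih =>
    have hM' : (N : ℝ) ≤ M := by exact_mod_cast hM
    rw [← ih]
    exact partInt_succ μ s hf hu h0 hy (integrable_fInf_dIter μ s hf hu h0 (by linarith))
      (integrable_fInf_dIter μ s hf hu h0 (by push_cast; linarith))

/-- The local formulas, one for each `N` on `re s > -N/2`, agree on overlaps and thus glue to an
entire function of `s`. -/
lemma partInt_eq (μ s : ℂ) {f : ℝ → ℂ} (hf : ContDiff ℝ ∞ f) {u : ℝ} (hu : 0 < u)
    (h0 : ∀ x, u < |x| → f x = 0) {y : ℝ} (hy : y ≠ 0) {N M : ℕ} (hN : 0 < 2 * s.re + N)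
    (hM : 0 < 2 * s.re + M) : partInt μ f y M s = partInt μ f y N s := by
  rcases le_total N M with h | h
  · exact partInt_eq_of_le μ s hf hu h0 hy hN h
  · exact (partInt_eq_of_le μ s hf hu h0 hy hM h).symm

/-! ### Holomorphy in `s` by Mellin transforms, and the identity theorem. -/

lemma integral_eq_Ioi_add {F : ℝ → ℂ} (hF : MeasureTheory.Integrable F) :
    ∫ x, F x = ∫ x in Set.Ioi (0 : ℝ), (F x + F (-x)) := by
  rw [MeasureTheory.integral_add hF.integrableOn hF.comp_neg.integrableOn,
    integral_comp_neg_Ioi, neg_zero, add_comm, intervalIntegral.integral_Iic_add_Ioi hF.integrableOn hF.integrableOn]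

/-- The even part of the integrand of `𝓕(f_{μ,s,∞})(y)`, without its dependence on `s`. -/
noncomputable def mellinKernel (μ : ℂ) (g : ℝ → ℂ) (y x : ℝ) : ℂ :=
  Complex.exp (-(Real.pi * Complex.I * μ / 2)) * g (-1 / x) *
    Complex.exp (2 * Real.pi * Complex.I * x * y) +
  Complex.exp (Real.pi * Complex.I * μ / 2) * g (1 / x) *
    Complex.exp (2 * Real.pi * Complex.I * (-x : ℝ) * y)

/-- Folding the line onto the half-line leaves `|x|^{-2s-1}` as the only factor depending on `s`, so
holomorphy in `s` is a property of Mellin transforms. -/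
lemma fourierT_eq_mellin (μ s : ℂ) {g : ℝ → ℂ} (hg : MeasureTheory.Integrable (fInf μ s g)) (y : ℝ) :
    fourierT (fInf μ s g) y = mellin (mellinKernel μ g y) (-2 * s) := by
  rw [fourierT, integral_eq_Ioi_add (integrable_mul_character hg y), mellin]
  refine MeasureTheory.setIntegral_congr_fun measurableSet_Ioi fun x hx => ?_
  have hx : 0 < x := hx
  simp only [smul_eq_mul]
  rw [fInf, fInf, if_neg hx.ne', if_neg (neg_ne_zero.2 hx.ne'), Real.sign_of_pos hx,
    Real.sign_of_neg (neg_neg_of_pos hx), abs_neg, abs_of_pos hx, mellinKernel, neg_div_neg_eq]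
  push_cast
  rw [one_mul, show -(-1 * Real.pi * Complex.I * μ / 2) = Real.pi * Complex.I * μ / 2 by ring]
  ring

lemma differentiableAt_mellinKernel (μ : ℂ) {g : ℝ → ℂ} (hg : Continuous g) {u : ℝ} (hu : 0 < u)
    (h0 : ∀ x, u < |x| → g x = 0) {N : ℕ} {C : ℝ} (hC : ∀ t, ‖g t‖ ≤ C * |t| ^ N) (y : ℝ) {s : ℂ}
    (hs : s.re < N) : DifferentiableAt ℂ (mellin (mellinKernel μ g y)) s := by
  -- The kernel decays like `x^{-N}` at infinity. It vanishes near `0`, so any exponent below `re s`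
  -- will do there.
  refine mellin_differentiableAt_of_isBigO_rpow (a := N) (b := s.re - 1) ?_ ?_ hs ?_ (by linarith)
  · refine ContinuousOn.locallyIntegrableOn ?_ measurableSet_Ioi
    have h1 : ContinuousOn (fun x : ℝ => 1 / x) (Set.Ioi 0) :=
      continuousOn_const.div continuousOn_id fun x hx => ne_of_gt hx
    have h2 : ContinuousOn (fun x : ℝ => -1 / x) (Set.Ioi 0) :=
      continuousOn_const.div continuousOn_id fun x hx => ne_of_gt hx
    unfold mellinKernel
    exact ((continuousOn_const.mul (hg.comp_continuousOn h2)).mul (continuous_character y).continuousOn).add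
      ((continuousOn_const.mul (hg.comp_continuousOn h1)).mul
        ((continuous_character y).comp continuous_neg).continuousOn)
  · refine Asymptotics.IsBigO.of_bound (‖Complex.exp (-(Real.pi * Complex.I * μ / 2))‖ * C +
      ‖Complex.exp (Real.pi * Complex.I * μ / 2)‖ * C) ?_
    filter_upwards [Filter.eventually_gt_atTop 0] with x hx
    rw [mellinKernel, Real.norm_of_nonneg (by positivity)]
    refine (norm_add_le _ _).trans ?_
    rw [norm_mul, norm_mul, norm_mul, norm_mul, norm_character, norm_character, mul_one, mul_one, add_mul]
    have e1 : ∀ t : ℝ, |t| = 1 / x → ‖g t‖ ≤ C * x ^ (-(N : ℝ)) := fun t ht => by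
      refine (hC t).trans (le_of_eq ?_)
      rw [ht, Real.rpow_neg hx.le, Real.rpow_natCast, one_div, inv_pow]
    rw [mul_assoc _ C, mul_assoc _ C]
    refine add_le_add (mul_le_mul_of_nonneg_left (e1 _ ?_) (norm_nonneg _))
      (mul_le_mul_of_nonneg_left (e1 _ ?_) (norm_nonneg _))
    · rw [abs_div, abs_neg, abs_one, abs_of_pos hx]
    · rw [abs_div, abs_one, abs_of_pos hx]
  · refine Asymptotics.IsBigO.of_bound 0 ?_
    have h1 : ∀ᶠ x : ℝ in 𝓝[>] 0, x < 1 / u := nhdsWithin_le_nhds (eventually_lt_nhds (by positivity))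
    filter_upwards [h1, self_mem_nhdsWithin] with x hx hx0
    have hx0 : 0 < x := hx0
    have hlt : u < 1 / x := (lt_one_div hx0 hu).1 hx
    rw [mellinKernel, h0 (-1 / x), h0 (1 / x)]
    · simp
    · rwa [abs_of_pos (by positivity)]
    · rwa [neg_div, abs_neg, abs_of_pos (by positivity)]

lemma fourierT_sum {ι : Type*} (S : Finset ι) (F : ι → ℝ → ℂ)
    (h : ∀ i ∈ S, MeasureTheory.Integrable (F i)) (y : ℝ) :
    fourierT (fun x => ∑ i ∈ S, F i x) y = ∑ i ∈ S, fourierT (F i) y := by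
  unfold fourierT
  rw [← MeasureTheory.integral_finsetSum S fun i hi => integrable_mul_character (h i hi) y]
  simp only [Finset.sum_mul]

lemma fourierT_const_mul (a : ℂ) (F : ℝ → ℂ) (y : ℝ) :
    fourierT (fun x => a * F x) y = a * fourierT F y := by
  unfold fourierT
  rw [← MeasureTheory.integral_const_mul]
  simp only [mul_assoc]

lemma fourierT_add {F G : ℝ → ℂ} (hF : MeasureTheory.Integrable F) (hG : MeasureTheory.Integrable G)
    (y : ℝ) : fourierT (fun x => F x + G x) y = fourierT F y + fourierT G y := by
  unfold fourierT
  rw [← MeasureTheory.integral_add (integrable_mul_character hF y) (integrable_mul_character hG y)]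
  simp only [add_mul]

lemma fInf_add (μ s : ℂ) (f g : ℝ → ℂ) (x : ℝ) :
    fInf μ s (fun t => f t + g t) x = fInf μ s f x + fInf μ s g x := by
  unfold fInf
  split_ifs <;> ring

lemma fInf_const_mul (μ s a : ℂ) (f : ℝ → ℂ) (x : ℝ) :
    fInf μ s (fun t => a * f t) x = a * fInf μ s f x := by
  unfold fInf
  split_ifs <;> ring

lemma fInf_sum (μ s : ℂ) {ι : Type*} (S : Finset ι) (F : ι → ℝ → ℂ) (x : ℝ) :
    fInf μ s (fun t => ∑ i ∈ S, F i t) x = ∑ i ∈ S, fInf μ s (F i) x := by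
  unfold fInf
  split_ifs
  · simp
  · rw [Finset.mul_sum]

/-- The function to be transformed itself depends on `s` through `D_s^N`. `dIter_formula` separates
this dependence: the result is a finite sum of holomorphic coefficients times Mellin transforms of
fixed functions. -/
lemma differentiableAt_partInt (μ : ℂ) {f : ℝ → ℂ} (hf : ContDiff ℝ ∞ f) {u : ℝ} (hu : 0 < u)
    (h0 : ∀ x, u < |x| → f x = 0) (y : ℝ) (N : ℕ) {s : ℂ} (hs : 0 < 2 * s.re + N) :
    DifferentiableAt ℂ (partInt μ f y N) s := by
  obtain ⟨p, hp, H⟩ := dIter_formula N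
  have hx : ContDiff ℝ ∞ fun x : ℝ => (x : ℂ) := Complex.ofRealCLM.contDiff
  set g : ℕ → ℝ → ℂ := fun j t => (t : ℂ) ^ (N + j) * iteratedDeriv j f t with hg
  have hgs : ∀ j, ContDiff ℝ ∞ (g j) := fun j => (hx.pow _).mul (contDiff_iteratedDeriv hf j)
  have hg0 : ∀ j x, u < |x| → g j x = 0 := fun j x hx => by
    simp only [hg]
    rw [(iteratedDeriv_congr_of_eventuallyEq (eventually_zero_of_lt_abs h0 hx) j).eq_of_nhds,
      iteratedDeriv_fun_const_zero]
    simp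
  have hgC : ∀ j t, ‖g j t‖ ≤ (u ^ j * testNorm j f) * |t| ^ N := fun j t => by
    by_cases ht : |t| ≤ u
    · simp only [hg]
      rw [norm_mul, norm_pow, Complex.norm_real, Real.norm_eq_abs, pow_add]
      have h1 := norm_iteratedDeriv_le_testNorm hf (hasCompactSupport_of_abs h0) le_rfl t (k := j)
      have h2 : |t| ^ j ≤ u ^ j := pow_le_pow_left₀ (abs_nonneg _) ht j
      calc |t| ^ N * |t| ^ j * ‖iteratedDeriv j f t‖ ≤ |t| ^ N * u ^ j * testNorm j f := by gcongr
        _ = _ := by ring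
    · rw [hg0 j t (not_le.1 ht), norm_zero]
      have := testNorm_nonneg j f
      positivity
  have hint : ∀ s : ℂ, 0 < 2 * s.re + N → ∀ j, MeasureTheory.Integrable (fInf μ s (g j)) := by
    intro s hs j
    obtain ⟨M, hM, HM⟩ := integrable_fInf μ s hu hs
    exact (HM _ _ (hgs j) (hg0 j) (hgC j)).1
  have heq : ∀ s : ℂ, 0 < 2 * s.re + N → partInt μ f y N s =
      (-(2 * Real.pi * Complex.I * y : ℂ))⁻¹ ^ N * ∑ j ∈ Finset.range (N + 1),
        p j s * mellin (mellinKernel μ (g j) y) (-2 * s) := by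
    intro s hs
    rw [partInt]
    congr 1
    have e1 : dIter s N f = fun t => ∑ j ∈ Finset.range (N + 1), p j s * g j t := funext (H s f hf)
    have e2 : fInf μ s (dIter s N f) = fun x => ∑ j ∈ Finset.range (N + 1), p j s * fInf μ s (g j) x := by
      funext x
      rw [e1, fInf_sum]
      exact Finset.sum_congr rfl fun j _ => fInf_const_mul _ _ _ _ _
    rw [e2, fourierT_sum _ _ fun j _ => (hint s hs j).const_mul _]
    refine Finset.sum_congr rfl fun j _ => ?_
    rw [fourierT_const_mul, fourierT_eq_mellin μ s (hint s hs j)]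
  have hev : ∀ᶠ z : ℂ in 𝓝 s, (0 : ℝ) < 2 * z.re + N :=
    (Continuous.continuousAt (by fun_prop : Continuous fun z : ℂ => 2 * z.re + N)).eventually
      (eventually_gt_nhds hs)
  refine DifferentiableAt.congr_of_eventuallyEq ?_ (hev.mono fun z hz => heq z hz)
  refine DifferentiableAt.const_mul (DifferentiableAt.fun_sum fun j _ => (hp j s).mul ?_) _
  refine DifferentiableAt.comp (g := mellin (mellinKernel μ (g j) y)) (f := fun s => -2 * s) s
    (differentiableAt_mellinKernel μ (hgs j).continuous hu (hg0 j) (hgC j) y ?_)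
    (differentiableAt_id.const_mul _)
  have : (-2 * s).re = -2 * s.re := by simp
  rw [this]
  linarith

/-- Two continuations agree near `s = 1`, hence on the connected set `U` by the identity theorem.
Any explicit continuation therefore computes the chosen one. -/
lemma holoExt_eq {U : Set ℂ} (hU : IsOpen U) (hc : IsPreconnected U) (hsub : ∀ s : ℂ, 0 < s.re → s ∈ U)
    {φ Φ : ℂ → ℂ} (hΦ : DifferentiableOn ℂ Φ U) (h : ∀ s : ℂ, 0 < s.re → Φ s = φ s) {s : ℂ} (hs : s ∈ U) :
    holoExt U φ s = Φ s := by
  have hex : ∃ Φ : ℂ → ℂ, DifferentiableOn ℂ Φ U ∧ ∀ s : ℂ, 0 < s.re → Φ s = φ s := ⟨Φ, hΦ, h⟩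
  rw [holoExt, dif_pos hex]
  obtain ⟨h1, h2⟩ := hex.choose_spec
  refine (h1.analyticOnNhd hU).eqOn_of_preconnected_of_eventuallyEq (hΦ.analyticOnNhd hU) hc
    (hsub 1 (by simp)) ?_ hs
  filter_upwards [Complex.continuous_re.continuousAt.eventually
    (eventually_gt_nhds (by simp : (0 : ℝ) < (1 : ℂ).re))] with z hz
  rw [h2 z hz, h z hz]

lemma twistedFourier_of_ne (μ ν : ℂ) (f : TestFn) {u : ℝ} (hu : 0 < u)
    (h0 : ∀ x, u < |x| → f x = 0) {y : ℝ} (hy : y ≠ 0) {N : ℕ} (hN : 0 < 2 * ν.re + N) :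
    twistedFourier μ ν f y = partInt μ f y N ν := by
  have hf := f.smooth
  -- A number of partial integrations that suffices at `s`. It may jump with `s`, but near each
  -- point `partInt_eq` allows it to be frozen.
  set n : ℂ → ℕ := fun s => ⌈|2 * s.re|⌉₊ + 1 with hn
  have hns : ∀ s, 0 < 2 * s.re + n s := fun s => by
    have h1 := Nat.le_ceil |2 * s.re|
    have h2 := neg_abs_le (2 * s.re)
    simp only [hn]
    push_cast
    linarith
  rw [twistedFourier, if_pos hy]
  rw [holoExt_eq (Φ := fun s => partInt μ f y (n s) s) isOpen_univ isPreconnected_univ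
    (fun _ _ => Set.mem_univ _) ?_ ?_ (Set.mem_univ _)]
  · exact partInt_eq μ ν hf hu h0 hy hN (hns ν)
  · intro s _
    refine DifferentiableAt.differentiableWithinAt ?_
    refine (differentiableAt_partInt μ hf hu h0 y (n s) (hns s)).congr_of_eventuallyEq ?_
    have hev : ∀ᶠ z : ℂ in 𝓝 s, (0 : ℝ) < 2 * z.re + n s :=
      (Continuous.continuousAt (by fun_prop : Continuous fun z : ℂ => 2 * z.re + n s)).eventually
        (eventually_gt_nhds (hns s))
    filter_upwards [hev] with z hz
    exact partInt_eq μ z hf hu h0 hy hz (hns z)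
  · intro s hs
    rw [partInt_eq μ s hf hu h0 hy (N := 0) (by simp [hs]) (hns s)]
    simp [partInt, dIter]

/-- All the integrals converge, so every partial integration can be undone at `ν` itself and the
continued value is the original integral. -/
lemma twistedFourier_of_ne_of_zero (μ ν : ℂ) (f : TestFn) {ε : ℝ} (hε : 0 < ε)
    (h1 : ∀ x, |x| < ε → f x = 0) {y : ℝ} (hy : y ≠ 0) :
    twistedFourier μ ν f y = fourierT (fInf μ ν f) y := by
  obtain ⟨u, hu, h0⟩ := f.exists_bound
  obtain ⟨N, hN⟩ := exists_nat_gt (-(2 * ν.re))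
  have hi : ∀ M, MeasureTheory.Integrable (fInf μ ν (dIter ν M f)) := fun M =>
    integrable_fInf_of_zero μ ν (contDiff_dIter ν M f.smooth) hu (dIter_zero_of_lt ν M h0) hε
      fun x hx => (dIter_eventually_zero ν M (eventually_zero_of_abs_lt h1 hx)).eq_of_nhds
  have h2 : ∀ M, partInt μ f y M ν = fourierT (fInf μ ν f) y := by
    intro M
    induction M with
    | zero => simp [partInt, dIter]
    | succ M ih => rw [partInt_succ μ ν f.smooth hu h0 hy (hi _) (hi _), ih]
  rw [twistedFourier_of_ne μ ν f hu h0 hy (N := N) (by linarith), h2]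

/-- Each partial integration divides by `2πy`, so the number of steps can be chosen both to reach
`ν` and to obtain the desired decay in `y`. -/
lemma partInt_bound (μ ν : ℂ) {u : ℝ} (hu : 0 < u) {N : ℕ} (hN : 0 < 2 * ν.re + N) :
    ∃ C : ℝ, 0 < C ∧ ∀ f : ℝ → ℂ, ContDiff ℝ ∞ f → (∀ x, u < |x| → f x = 0) → ∀ y : ℝ, y ≠ 0 →
      ‖partInt μ f y N ν‖ ≤ C * testNorm N f * (|y| ^ N)⁻¹ := by
  obtain ⟨M, hM, H⟩ := integrable_fInf μ ν hu hN
  obtain ⟨B, hB, HB⟩ := dIter_bound N ν u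
  refine ⟨M * B, by positivity, fun f hf h0 y hy => ?_⟩
  have h1 := (H _ _ (contDiff_dIter ν N hf) (dIter_zero_of_lt ν N h0) (HB f hf h0)).2
  have hT := testNorm_nonneg N f
  have hp := Real.pi_gt_three
  rw [partInt, norm_mul, norm_pow, norm_inv, norm_neg, mul_comm, inv_pow]
  refine mul_le_mul ((norm_fourierT_le _ _).trans (h1.trans (le_of_eq (by ring)))) ?_ (by positivity)
    (by positivity)
  have hyp : 0 < |y| := abs_pos.2 hy
  refine inv_anti₀ (by positivity) (pow_le_pow_left₀ (abs_nonneg _) ?_ N)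
  have : ‖(2 * Real.pi * Complex.I * y : ℂ)‖ = 2 * Real.pi * |y| := by
    rw [norm_mul, norm_mul, norm_mul, Complex.norm_I, Complex.norm_real, Complex.norm_real,
      Real.norm_of_nonneg Real.pi_pos.le, Real.norm_eq_abs]
    simp
  rw [this]
  nlinarith

lemma dIter_add_smul (s a : ℂ) (N : ℕ) {f g : ℝ → ℂ} (hf : ContDiff ℝ ∞ f) (hg : ContDiff ℝ ∞ g) :
    dIter s N (fun t => a * f t + g t) = fun t => a * dIter s N f t + dIter s N g t := by
  induction N with
  | zero => rfl
  | succ N ih =>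
    funext t
    have h1 := (hasDerivAt_of_smooth (contDiff_dIter s N hf) t).const_mul a
    have h2 := hasDerivAt_of_smooth (contDiff_dIter s N hg) t
    rw [dIter, dIter, dIter, ih, dOp, dOp, dOp, (h1.fun_add h2).deriv]
    ring

lemma partInt_add_smul (μ ν a : ℂ) {f g : ℝ → ℂ} (hf : ContDiff ℝ ∞ f) (hg : ContDiff ℝ ∞ g) {u : ℝ}
    (hu : 0 < u) (hf0 : ∀ x, u < |x| → f x = 0) (hg0 : ∀ x, u < |x| → g x = 0) (y : ℝ) {N : ℕ}
    (hN : 0 < 2 * ν.re + N) : partInt μ (fun t => a * f t + g t) y N ν =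
      a * partInt μ f y N ν + partInt μ g y N ν := by
  have h1 : fInf μ ν (fun t => a * dIter ν N f t + dIter ν N g t) =
      fun x => a * fInf μ ν (dIter ν N f) x + fInf μ ν (dIter ν N g) x := by
    funext x
    rw [fInf_add, fInf_const_mul]
  rw [partInt, partInt, partInt, dIter_add_smul ν a N hf hg, h1,
    fourierT_add ((integrable_fInf_dIter μ ν hf hu hf0 hN).const_mul a)
      (integrable_fInf_dIter μ ν hg hu hg0 hN), fourierT_const_mul]
  ring

/-! ### Taylor polynomials -/

/-- The Taylor polynomial `∑_{k < N} G^{(k)}(0) x^k / k!`. -/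
noncomputable def taylorPoly (N : ℕ) (G : ℝ → ℂ) (x : ℝ) : ℂ :=
  ∑ k ∈ Finset.range N, iteratedDeriv k G 0 / k.factorial * (x : ℂ) ^ k

lemma hasDerivAt_taylorPoly (N : ℕ) (G : ℝ → ℂ) (x : ℝ) :
    HasDerivAt (taylorPoly (N + 1) G) (taylorPoly N (deriv G) x) x := by
  have e : taylorPoly (N + 1) G = fun x : ℝ => ∑ k ∈ Finset.range N,
      iteratedDeriv (k + 1) G 0 / (k + 1).factorial * (x : ℂ) ^ (k + 1) + G 0 := by
    funext x
    rw [taylorPoly, Finset.sum_range_succ']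
    simp
  rw [e]
  refine HasDerivAt.add_const _ ?_
  unfold taylorPoly
  refine HasDerivAt.fun_sum fun k _ => ?_
  have h : HasDerivAt (fun x : ℝ => (x : ℂ) ^ (k + 1)) (((k + 1 : ℕ) : ℂ) * (x : ℂ) ^ k) x := by
    simpa using (hasDerivAt_pow (k + 1) (x : ℂ)).comp_ofReal
  refine (h.const_mul _).congr_deriv ?_
  have h1 : ((k.factorial : ℕ) : ℂ) ≠ 0 := by exact_mod_cast k.factorial_ne_zero
  have h2 : ((k : ℂ) + 1) ≠ 0 := by exact_mod_cast k.succ_ne_zero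
  rw [iteratedDeriv_succ', Nat.factorial_succ]
  push_cast
  field_simp

/-- Induction on the order: the derivative of the remainder is the remainder of the derivative, and
the mean value inequality integrates the bound. The factor `1/N!` is given up. -/
lemma norm_sub_taylorPoly_le (N : ℕ) : ∀ {G : ℝ → ℂ}, ContDiff ℝ ∞ G → ∀ {B : ℝ}, ∀ {r : ℝ},
    (∀ x, |x| ≤ r → ‖iteratedDeriv N G x‖ ≤ B) → ∀ x, |x| ≤ r →
      ‖G x - taylorPoly N G x‖ ≤ B * |x| ^ N := by
  induction N with
  | zero =>
    intro G hG B r h x hx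
    simpa [taylorPoly] using h x hx
  | succ N ih =>
    intro G hG B r h x hx
    have hd : ∀ y, HasDerivAt (fun x => G x - taylorPoly (N + 1) G x)
        (deriv G y - taylorPoly N (deriv G) y) y := fun y =>
      (hasDerivAt_of_smooth hG y).fun_sub (hasDerivAt_taylorPoly N G y)
    have hb : ∀ y, |y| ≤ r → ‖deriv G y - taylorPoly N (deriv G) y‖ ≤ B * |y| ^ N :=
      ih (contDiff_deriv hG) fun y hy => by
        rw [← iteratedDeriv_succ']
        exact h y hy
    have hB : 0 ≤ B := (norm_nonneg _).trans (h x hx)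
    have h0 : G 0 - taylorPoly (N + 1) G 0 = 0 := by
      rw [taylorPoly, Finset.sum_range_succ']
      simp
    have := (convex_closedBall (0 : ℝ) |x|).norm_image_sub_le_of_norm_hasDerivWithin_le
      (f := fun x => G x - taylorPoly (N + 1) G x) (C := B * |x| ^ N)
      (fun y _ => (hd y).hasDerivWithinAt) (fun y hy => ?_) (x := 0) (y := x) (by simp) (by simp)
    · simp only [h0, sub_zero] at this
      rw [pow_succ, ← mul_assoc]
      simpa using this
    · have hy' : |y| ≤ |x| := by simpa using hy
      exact (hb y (hy'.trans hx)).trans (by gcongr)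

lemma continuous_taylorPoly (N : ℕ) (G : ℝ → ℂ) : Continuous (taylorPoly N G) := by
  unfold taylorPoly
  fun_prop

/-! ### Continuation of Mellin transforms -/

/-- The function `G` minus its Taylor polynomial of order `N` on `(0, 1]`. -/
noncomputable def bracket (N : ℕ) (G : ℝ → ℂ) (t : ℝ) : ℂ :=
  G t - (Set.Ioc (0 : ℝ) 1).indicator (taylorPoly N G) t

lemma norm_bracket_le {G : ℝ → ℂ} (hG : ContDiff ℝ ∞ G) (hc : HasCompactSupport G) (N : ℕ) {t : ℝ}
    (ht : 0 < t) : ‖bracket N G t‖ ≤ testNorm N G * t ^ N := by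
  have hT := testNorm_nonneg N G
  by_cases h : t ≤ 1
  · rw [bracket, Set.indicator_of_mem (show t ∈ Set.Ioc (0 : ℝ) 1 from ⟨ht, h⟩)]
    have := norm_sub_taylorPoly_le N hG (r := 1) (B := testNorm N G)
      (fun x _ => norm_iteratedDeriv_le_testNorm hG hc le_rfl x) t (by rwa [abs_of_pos ht])
    rwa [abs_of_pos ht] at this
  · rw [bracket, Set.indicator_of_notMem fun hm => h hm.2, sub_zero]
    exact (norm_le_testNorm hG hc N t).trans
      (le_mul_of_one_le_right hT (one_le_pow₀ (not_le.1 h).le))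

lemma bracket_zero_of_lt {G : ℝ → ℂ} {u : ℝ} (h0 : ∀ x, u < |x| → G x = 0) (N : ℕ) {t : ℝ}
    (ht : max u 1 < t) : bracket N G t = 0 := by
  have h1 : u < t := (le_max_left _ _).trans_lt ht
  have h2 : 1 < t := (le_max_right _ _).trans_lt ht
  rw [bracket, Set.indicator_of_notMem fun hm => absurd hm.2 (not_le.2 h2), sub_zero, h0]
  rwa [abs_of_pos (by linarith)]

lemma locallyIntegrableOn_bracket {G : ℝ → ℂ} (hG : ContDiff ℝ ∞ G) (N : ℕ) :
    MeasureTheory.LocallyIntegrableOn (bracket N G) (Set.Ioi 0) := by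
  have h1 : MeasureTheory.Integrable ((Set.Ioc (0 : ℝ) 1).indicator (taylorPoly N G)) :=
    (((continuous_taylorPoly N G).continuousOn.integrableOn_compact isCompact_Icc).mono_set
      Set.Ioc_subset_Icc_self).integrable_indicator measurableSet_Ioc
  exact (hG.continuous.locallyIntegrable.sub h1.locallyIntegrable).locallyIntegrableOn _

lemma bracket_isBigO {G : ℝ → ℂ} (hG : ContDiff ℝ ∞ G) {u : ℝ} (h0 : ∀ x, u < |x| → G x = 0) (N : ℕ)
    (a : ℝ) : bracket N G =O[Filter.atTop] (fun t : ℝ => t ^ (-a)) ∧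
      bracket N G =O[𝓝[>] 0] (fun t : ℝ => t ^ (-(-N : ℝ))) := by
  constructor
  · refine Asymptotics.IsBigO.of_bound 0 ?_
    filter_upwards [Filter.eventually_gt_atTop (max u 1)] with t ht
    rw [bracket_zero_of_lt h0 N ht]
    simp
  · refine Asymptotics.IsBigO.of_bound (testNorm N G) ?_
    filter_upwards [self_mem_nhdsWithin] with t ht
    have ht : 0 < t := ht
    rw [neg_neg, Real.rpow_natCast, Real.norm_of_nonneg (by positivity)]
    exact norm_bracket_le hG (hasCompactSupport_of_abs h0) N ht

lemma mellinConvergent_bracket {G : ℝ → ℂ} (hG : ContDiff ℝ ∞ G) {u : ℝ} (h0 : ∀ x, u < |x| → G x = 0)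
    {N : ℕ} {σ : ℂ} (hσ : 0 < σ.re + N) : MellinConvergent (bracket N G) σ :=
  mellinConvergent_of_isBigO_rpow (locallyIntegrableOn_bracket hG N)
    (bracket_isBigO hG h0 N (σ.re + 1)).1 (by linarith) (bracket_isBigO hG h0 N (σ.re + 1)).2 (by linarith)

lemma differentiableAt_mellin_bracket {G : ℝ → ℂ} (hG : ContDiff ℝ ∞ G) {u : ℝ}
    (h0 : ∀ x, u < |x| → G x = 0) {N : ℕ} {σ : ℂ} (hσ : 0 < σ.re + N) :
    DifferentiableAt ℂ (mellin (bracket N G)) σ :=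
  mellin_differentiableAt_of_isBigO_rpow (locallyIntegrableOn_bracket hG N)
    (bracket_isBigO hG h0 N (σ.re + 1)).1 (by linarith) (bracket_isBigO hG h0 N (σ.re + 1)).2 (by linarith)

/-- Subtracting one more Taylor term on `(0, 1]` removes the Mellin transform of `t^N` there, which
is `1/(σ + N)`. So the continuations for different orders agree. -/
lemma mellin_bracket_succ {G : ℝ → ℂ} (hG : ContDiff ℝ ∞ G) {u : ℝ} (h0 : ∀ x, u < |x| → G x = 0)
    {N : ℕ} {σ : ℂ} (hσ : 0 < σ.re + N) : mellin (bracket (N + 1) G) σ =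
      mellin (bracket N G) σ - iteratedDeriv N G 0 / N.factorial / (σ + N) := by
  have h1 := hasMellin_cpow_Ioc (N : ℂ) (s := σ) (by simpa using hσ)
  have h2 := hasMellin_const_smul h1.1 (iteratedDeriv N G 0 / N.factorial : ℂ)
  have h3 := hasMellin_sub (mellinConvergent_bracket hG h0 hσ) h2.1
  have e : bracket (N + 1) G = fun t => bracket N G t - (iteratedDeriv N G 0 / N.factorial : ℂ) •
      (Set.Ioc (0 : ℝ) 1).indicator (fun t => (t : ℂ) ^ (N : ℂ)) t := by
    funext t
    by_cases ht : t ∈ Set.Ioc (0 : ℝ) 1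
    · rw [bracket, bracket, Set.indicator_of_mem ht, Set.indicator_of_mem ht, Set.indicator_of_mem ht,
        taylorPoly, Finset.sum_range_succ, ← taylorPoly, Complex.cpow_natCast, smul_eq_mul]
      ring
    · simp [bracket, Set.indicator_of_notMem ht]
  rw [e, h3.2, h2.2, h1.2, smul_eq_mul]
  ring

/-- The continuation of the Mellin transform of `G` to `re σ > -N`. -/
noncomputable def mellinCont (N : ℕ) (G : ℝ → ℂ) (σ : ℂ) : ℂ :=
  mellin (bracket N G) σ + ∑ k ∈ Finset.range N, iteratedDeriv k G 0 / k.factorial / (σ + k)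

lemma mellinCont_eq_of_le {G : ℝ → ℂ} (hG : ContDiff ℝ ∞ G) {u : ℝ} (h0 : ∀ x, u < |x| → G x = 0)
    {N M : ℕ} {σ : ℂ} (hσ : 0 < σ.re + N) (hNM : N ≤ M) : mellinCont M G σ = mellinCont N G σ := by
  induction M, hNM using Nat.le_induction with
  | base => rfl
  | succ M hM ih =>
    have : (N : ℝ) ≤ M := by exact_mod_cast hM
    rw [← ih, mellinCont, mellinCont, Finset.sum_range_succ, mellin_bracket_succ hG h0 (by linarith)]
    ring

lemma mellinCont_eq {G : ℝ → ℂ} (hG : ContDiff ℝ ∞ G) {u : ℝ} (h0 : ∀ x, u < |x| → G x = 0)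
    {N M : ℕ} {σ : ℂ} (hN : 0 < σ.re + N) (hM : 0 < σ.re + M) : mellinCont M G σ = mellinCont N G σ := by
  rcases le_total N M with h | h
  · exact mellinCont_eq_of_le hG h0 hN h
  · exact (mellinCont_eq_of_le hG h0 hM h).symm

lemma mellinCont_zero (G : ℝ → ℂ) (σ : ℂ) : mellinCont 0 G σ = mellin G σ := by
  have : bracket 0 G = G := by
    funext t
    simp [bracket, taylorPoly, Set.indicator]
  rw [mellinCont, this]
  simp

lemma mellinCont_of_zero {G : ℝ → ℂ} (hG : ∀ k, iteratedDeriv k G 0 = 0) (N : ℕ) (σ : ℂ) :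
    mellinCont N G σ = mellin G σ := by
  have : bracket N G = G := by
    funext t
    simp [bracket, taylorPoly, Set.indicator, hG]
  rw [mellinCont, this]
  simp [hG]

lemma mellinCont_add_smul (a : ℂ) {f g : ℝ → ℂ} (hf : ContDiff ℝ ∞ f) (hg : ContDiff ℝ ∞ g) {u : ℝ}
    (hf0 : ∀ x, u < |x| → f x = 0) (hg0 : ∀ x, u < |x| → g x = 0) {N : ℕ} {σ : ℂ}
    (hσ : 0 < σ.re + N) : mellinCont N (fun t => a * f t + g t) σ =
      a * mellinCont N f σ + mellinCont N g σ := by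
  have hd : ∀ k x, iteratedDeriv k (fun t => a * f t + g t) x =
      a * iteratedDeriv k f x + iteratedDeriv k g x := fun k x => by
    rw [iteratedDeriv_fun_add ((contDiff_const.mul hf).of_le (mod_cast le_top)).contDiffAt
      (hg.of_le (mod_cast le_top)).contDiffAt, iteratedDeriv_const_mul_field]
  have ht : ∀ x, taylorPoly N (fun t => a * f t + g t) x = a * taylorPoly N f x + taylorPoly N g x := by
    intro x
    simp only [taylorPoly, hd, Finset.mul_sum]
    rw [← Finset.sum_add_distrib]
    exact Finset.sum_congr rfl fun k _ => by ring
  have hb : bracket N (fun t => a * f t + g t) = fun t => a • bracket N f t + bracket N g t := by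
    funext t
    by_cases h : t ∈ Set.Ioc (0 : ℝ) 1
    · simp only [bracket, Set.indicator_of_mem h, ht, smul_eq_mul]
      ring
    · simp [bracket, Set.indicator_of_notMem h]
  have h1 := hasMellin_const_smul (mellinConvergent_bracket hf hf0 hσ) a
  have h2 := hasMellin_add h1.1 (mellinConvergent_bracket hg hg0 hσ)
  rw [mellinCont, mellinCont, mellinCont, hb, h2.2, h1.2, smul_eq_mul, mul_add, Finset.mul_sum]
  have : ∀ x y z w : ℂ, x + y + (z + w) = x + z + (y + w) := fun x y z w => by ring
  rw [this, ← Finset.sum_add_distrib]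
  congr 1
  refine Finset.sum_congr rfl fun k _ => ?_
  rw [hd]
  ring

/-- Valid also at a pole: with `1/0 = 0` the polar term drops out, and the remaining terms are
bounded by Taylor coefficients and an integral over `(0, max u 1]`. -/
lemma mellinCont_bound (u : ℝ) {N : ℕ} {σ : ℂ} (hσ : 0 < σ.re + N) : ∃ C : ℝ, 0 < C ∧
    ∀ G : ℝ → ℂ, ContDiff ℝ ∞ G → (∀ x, u < |x| → G x = 0) →
      ‖mellinCont N G σ‖ ≤ C * testNorm N G := by
  set R := max u 1 with hR
  have hI0 : 0 ≤ ∫ t in Set.Ioc (0 : ℝ) R, t ^ (σ.re - 1 + N) :=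
    MeasureTheory.setIntegral_nonneg measurableSet_Ioc fun t ht => Real.rpow_nonneg ht.1.le _
  have hint : MeasureTheory.IntegrableOn (fun t : ℝ => t ^ (σ.re - 1 + N)) (Set.Ioc 0 R) := by
    rw [← intervalIntegrable_iff_integrableOn_Ioc_of_le (by positivity)]
    exact intervalIntegral.intervalIntegrable_rpow' (by linarith)
  refine ⟨(∫ t in Set.Ioc (0 : ℝ) R, t ^ (σ.re - 1 + N)) + 1 +
    ∑ k ∈ Finset.range N, ‖(1 / k.factorial / (σ + k) : ℂ)‖, by positivity, fun G hG h0 => ?_⟩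
  have hc := hasCompactSupport_of_abs h0
  have hT := testNorm_nonneg N G
  rw [mellinCont, add_mul]
  refine (norm_add_le _ _).trans (add_le_add ?_ ?_)
  · have h1 : mellin (bracket N G) σ = ∫ t in Set.Ioc (0 : ℝ) R, (t : ℂ) ^ (σ - 1) • bracket N G t := by
      rw [mellin]
      refine (MeasureTheory.setIntegral_eq_of_subset_of_forall_sdiff_eq_zero measurableSet_Ioi
        Set.Ioc_subset_Ioi_self fun t ht => ?_)
      have h2 : R < t := by
        by_contra hle
        exact ht.2 ⟨ht.1, not_lt.1 hle⟩
      rw [bracket_zero_of_lt h0 N h2, smul_zero]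
    rw [h1]
    have h2 := MeasureTheory.norm_integral_le_of_norm_le (hint.const_mul (testNorm N G))
      (f := fun t : ℝ => (t : ℂ) ^ (σ - 1) • bracket N G t) (by
        refine (MeasureTheory.ae_restrict_mem measurableSet_Ioc).mono fun t ht => ?_
        rw [norm_smul, Complex.norm_cpow_eq_rpow_re_of_pos ht.1, Real.rpow_add ht.1, Real.rpow_natCast]
        have h3 : (σ - 1).re = σ.re - 1 := by simp
        rw [h3]
        refine (mul_le_mul_of_nonneg_left (norm_bracket_le hG hc N ht.1)
          (Real.rpow_nonneg ht.1.le _)).trans (le_of_eq (by ring)))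
    refine h2.trans ?_
    rw [MeasureTheory.integral_const_mul]
    nlinarith
  · rw [Finset.sum_mul]
    refine (norm_sum_le _ _).trans (Finset.sum_le_sum fun k hk => ?_)
    have e : (iteratedDeriv k G 0 / k.factorial / (σ + k) : ℂ) =
        (1 / k.factorial / (σ + k)) * iteratedDeriv k G 0 := by ring
    rw [e, norm_mul]
    exact mul_le_mul_of_nonneg_left (norm_iteratedDeriv_le_testNorm hG hc
      (Finset.mem_range.1 hk).le 0) (norm_nonneg _)

/-! ### The twisted Fourier transform at `0` -/

/-- The even part of `f` with respect to `μ`. -/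
noncomputable def evenPart (μ : ℂ) (f : ℝ → ℂ) (t : ℝ) : ℂ :=
  Complex.exp (-(Real.pi * Complex.I * μ / 2)) * f (-t) + Complex.exp (Real.pi * Complex.I * μ / 2) * f t

lemma contDiff_evenPart (μ : ℂ) {f : ℝ → ℂ} (hf : ContDiff ℝ ∞ f) : ContDiff ℝ ∞ (evenPart μ f) :=
  (contDiff_const.mul (hf.comp contDiff_neg)).add (contDiff_const.mul hf)

lemma evenPart_zero (μ : ℂ) {f : ℝ → ℂ} {u : ℝ} (h0 : ∀ x, u < |x| → f x = 0) :
    ∀ x, u < |x| → evenPart μ f x = 0 := fun x hx => by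
  rw [evenPart, h0 x hx, h0 (-x) (by rwa [abs_neg])]
  simp

lemma iteratedDeriv_evenPart (μ : ℂ) {f : ℝ → ℂ} (hf : ContDiff ℝ ∞ f) (k : ℕ) (t : ℝ) :
    iteratedDeriv k (evenPart μ f) t = Complex.exp (-(Real.pi * Complex.I * μ / 2)) *
      ((-1) ^ k * iteratedDeriv k f (-t)) + Complex.exp (Real.pi * Complex.I * μ / 2) * iteratedDeriv k f t := by
  unfold evenPart
  have h1 : ContDiff ℝ ∞ fun t => f (-t) := hf.comp contDiff_neg
  rw [iteratedDeriv_fun_add ((contDiff_const.mul h1).of_le (mod_cast le_top)).contDiffAt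
    ((contDiff_const.mul hf).of_le (mod_cast le_top)).contDiffAt, iteratedDeriv_const_mul_field,
    iteratedDeriv_const_mul_field, iteratedDeriv_comp_neg]
  simp

/-- At frequency `0` the substitution `t = 1/x` removes the inversion and leaves the Mellin
transform of a smooth compactly supported function, whose poles come from its Taylor coefficients at
`0`. -/
lemma fourierT_fInf_zero (μ s : ℂ) {f : ℝ → ℂ} (hf : MeasureTheory.Integrable (fInf μ s f)) :
    fourierT (fInf μ s f) 0 = mellin (evenPart μ f) (2 * s) := by
  have e : mellinKernel μ f 0 = fun t => evenPart μ f t⁻¹ := by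
    funext t
    simp [mellinKernel, evenPart, neg_div]
  rw [fourierT_eq_mellin μ s hf, e, mellin_comp_inv]
  congr 1
  ring

lemma isClosed_range_natCast : IsClosed (Set.range fun n : ℕ => (n : ℂ)) := by
  have := (Complex.isometry_ofReal.isClosedEmbedding.comp Nat.isClosedEmbedding_coe_real).isClosed_range
  convert! this using 1

lemma isOpen_regularSet : IsOpen regularSet := by
  have : regularSet = (fun s : ℂ => -2 * s) ⁻¹' (Set.range fun n : ℕ => (n : ℂ))ᶜ := by
    ext s
    simp [regularSet, eq_comm]
  rw [this]
  exact isClosed_range_natCast.isOpen_compl.preimage (by fun_prop)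

lemma isPreconnected_regularSet : IsPreconnected regularSet := by
  have h1 : (Set.range fun n : ℕ => -(n : ℂ) / 2).Countable := Set.countable_range _
  have : regularSet = (Set.range fun n : ℕ => -(n : ℂ) / 2)ᶜ := by
    ext s
    simp only [regularSet, Set.mem_ofPred_eq, Set.mem_compl_iff, Set.mem_range, not_exists]
    refine forall_congr' fun n => not_congr ⟨fun h => ?_, fun h => ?_⟩
    · linear_combination (1 / 2) * h
    · linear_combination 2 * h
  rw [this]
  exact (h1.isConnected_compl_of_one_lt_rank (by simp [Complex.rank_real_complex])).isPreconnected

lemma differentiableAt_mellinCont {G : ℝ → ℂ} (hG : ContDiff ℝ ∞ G) {u : ℝ}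
    (h0 : ∀ x, u < |x| → G x = 0) {N : ℕ} {σ : ℂ} (hσ : 0 < σ.re + N) (h : ∀ n : ℕ, σ + n ≠ 0) :
    DifferentiableAt ℂ (mellinCont N G) σ := by
  refine (differentiableAt_mellin_bracket hG h0 hσ).fun_add (DifferentiableAt.fun_sum fun k _ => ?_)
  exact (differentiableAt_const _).div (differentiableAt_id.add_const _) (h k)

lemma holoExt_regularSet (μ : ℂ) (f : TestFn) {u : ℝ} (hu : 0 < u) (h0 : ∀ x, u < |x| → f x = 0) {s : ℂ}
    (hs : s ∈ regularSet) {N : ℕ} (hN : 0 < 2 * s.re + N) :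
    holoExt regularSet (fun s => fourierT (fInf μ s f) 0) s = mellinCont N (evenPart μ f) (2 * s) := by
  have hf := f.smooth
  have hG := contDiff_evenPart μ hf
  have hG0 := evenPart_zero μ h0
  set n : ℂ → ℕ := fun s => ⌈|2 * s.re|⌉₊ + 1 with hn
  have hre : ∀ s : ℂ, (2 * s).re = 2 * s.re := fun s => by simp
  have hns : ∀ s : ℂ, 0 < (2 * s).re + n s := fun s => by
    have h1 := Nat.le_ceil |2 * s.re|
    have h2 := neg_abs_le (2 * s.re)
    simp only [hn, hre]
    push_cast
    linarith
  rw [holoExt_eq (Φ := fun s => mellinCont (n s) (evenPart μ f) (2 * s)) isOpen_regularSet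
    isPreconnected_regularSet ?_ ?_ ?_ hs]
  · exact mellinCont_eq hG hG0 (by rw [hre]; exact hN) (hns s)
  · intro s hs n h
    have := congrArg Complex.re h
    simp at this
    have : (0 : ℝ) ≤ n := n.cast_nonneg
    linarith
  · intro s hs
    refine DifferentiableAt.differentiableWithinAt ?_
    have h1 : DifferentiableAt ℂ (fun z => mellinCont (n s) (evenPart μ f) (2 * z)) s := by
      refine DifferentiableAt.comp (g := mellinCont (n s) (evenPart μ f)) (f := fun z => 2 * z) s
        (differentiableAt_mellinCont hG hG0 (hns s) fun k hk => hs k ?_) (differentiableAt_id.const_mul _)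
      linear_combination -hk
    refine h1.congr_of_eventuallyEq ?_
    have hev : ∀ᶠ z : ℂ in 𝓝 s, (0 : ℝ) < (2 * z).re + n s :=
      (Continuous.continuousAt (by fun_prop : Continuous fun z : ℂ => (2 * z).re + n s)).eventually
        (eventually_gt_nhds (hns s))
    filter_upwards [hev] with z hz
    exact mellinCont_eq hG hG0 hz (hns z)
  · intro s hs
    have hi := integrable_fInf_dIter μ s hf hu h0 (N := 0) (by simpa using hs)
    simp only [dIter] at hi
    rw [mellinCont_eq hG hG0 (N := 0) (by simpa using hs) (hns s), mellinCont_zero,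
      fourierT_fInf_zero μ s hi]

/-- Matches the polar term in the definition of the twisted transform with the one of `mellinCont`:
`e^{±πi(n+μ)/2} = (±i)^n e^{±πiμ/2}`. -/
lemma polar_coeff (μ : ℂ) (f : TestFn) (n : ℕ) :
    Complex.I ^ n * (2 * Complex.cos (Real.pi * (n + μ) / 2)) * deltaDeriv n f =
      iteratedDeriv n (evenPart μ f) 0 := by
  rw [iteratedDeriv_evenPart μ f.smooth, deltaDeriv, neg_zero, Complex.two_cos]
  have h1 : Complex.exp (Real.pi * (n + μ) / 2 * Complex.I) =
      Complex.I ^ n * Complex.exp (Real.pi * Complex.I * μ / 2) := by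
    rw [show (Real.pi * (n + μ) / 2 * Complex.I : ℂ) =
      n * (Real.pi / 2 * Complex.I) + Real.pi * Complex.I * μ / 2 by ring, Complex.exp_add,
      Complex.exp_nat_mul, Complex.exp_pi_div_two_mul_I]
  have h2 : Complex.exp (-(Real.pi * (n + μ) / 2) * Complex.I) =
      (-Complex.I) ^ n * Complex.exp (-(Real.pi * Complex.I * μ / 2)) := by
    rw [show (-(Real.pi * (n + μ) / 2) * Complex.I : ℂ) =
      n * (-(Real.pi / 2 * Complex.I)) + -(Real.pi * Complex.I * μ / 2) by ring, Complex.exp_add,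
      Complex.exp_nat_mul, Complex.exp_neg, Complex.exp_pi_div_two_mul_I, Complex.inv_I]
  have h3 : Complex.I ^ n * Complex.I ^ n = (-1) ^ n := by rw [← mul_pow, Complex.I_mul_I]
  have h4 : Complex.I ^ n * (-Complex.I) ^ n = 1 := by rw [← mul_pow]; simp
  have h5 : (-1 : ℂ) ^ n * (-1) ^ n = 1 := by rw [← mul_pow]; simp
  rw [h1, h2]
  linear_combination (Complex.exp (Real.pi * Complex.I * μ / 2) * ((-1) ^ n * iteratedDeriv n f 0)) * h3 +
    (Complex.exp (-(Real.pi * Complex.I * μ / 2)) * ((-1) ^ n * iteratedDeriv n f 0)) * h4 +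
    (Complex.exp (Real.pi * Complex.I * μ / 2) * iteratedDeriv n f 0) * h5

/-- At a pole, the value of `mellinCont` (with `1 / 0 = 0`) is the constant term of the Laurent
expansion. -/
lemma tendsto_mellinCont {G : ℝ → ℂ} (hG : ContDiff ℝ ∞ G) {u : ℝ} (h0 : ∀ x, u < |x| → G x = 0)
    {N n : ℕ} {ν : ℂ} (hν : -2 * ν = n) (hN : n < N) :
    Filter.Tendsto (fun s => mellinCont N G (2 * s) - iteratedDeriv n G 0 / n.factorial / (2 * s + n))
      (𝓝[≠] ν) (𝓝 (mellinCont N G (2 * ν))) := by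
  have hν' : 2 * ν = -n := by linear_combination -hν
  have hmem : n ∈ Finset.range N := Finset.mem_range.2 hN
  have e : ∀ s : ℂ, mellinCont N G (2 * s) - iteratedDeriv n G 0 / n.factorial / (2 * s + n) =
      mellin (bracket N G) (2 * s) + ∑ k ∈ (Finset.range N).erase n,
        iteratedDeriv k G 0 / k.factorial / (2 * s + k) := fun s => by
    rw [mellinCont, ← Finset.add_sum_erase _ _ hmem]
    ring
  have e2 := e ν
  rw [hν', neg_add_cancel, div_zero, sub_zero, ← hν'] at e2
  simp only [e]
  rw [e2]
  refine Filter.Tendsto.mono_left (ContinuousAt.tendsto ?_) nhdsWithin_le_nhds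
  have hre : 0 < (2 * ν).re + N := by
    rw [hν']
    have : (n : ℝ) < N := by exact_mod_cast hN
    simpa using this
  refine ContinuousAt.add ?_ ?_
  · exact ContinuousAt.comp (f := fun s : ℂ => 2 * s) (g := mellin (bracket N G))
      (differentiableAt_mellin_bracket hG h0 hre).continuousAt (by fun_prop)
  · refine tendsto_finsetSum _ fun k hk => ?_
    refine ContinuousAt.tendsto (ContinuousAt.div continuousAt_const (by fun_prop) ?_)
    rw [hν', neg_add_eq_sub, sub_ne_zero]
    exact_mod_cast (Finset.mem_erase.1 hk).1

/-- One formula for regular and singular `ν`: at a pole, the convention `1/0 = 0` in `mellinCont`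
performs the same subtraction as the limit in the definition. -/
lemma twistedFourier_zero (μ ν : ℂ) (f : TestFn) {N : ℕ} (hN : 0 < 2 * ν.re + N) :
    twistedFourier μ ν f 0 = mellinCont N (evenPart μ f) (2 * ν) := by
  obtain ⟨u, hu, h0⟩ := f.exists_bound
  have hG := contDiff_evenPart μ f.smooth
  have hG0 := evenPart_zero μ h0
  rw [twistedFourier, if_neg (by simp)]
  split_ifs with h
  · have hn : -2 * ν = h.choose := h.choose_spec
    set n := h.choose with hn'
    have hnN : n < N := by
      have h1 := congrArg Complex.re hn
      simp at h1
      have : (n : ℝ) < N := by linarith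
      exact_mod_cast this
    refine Filter.Tendsto.limUnder_eq ?_
    refine (tendsto_mellinCont hG hG0 hn hnN).congr' ?_
    have hev : ∀ᶠ z : ℂ in 𝓝[≠] ν, (0 : ℝ) < 2 * z.re + N := nhdsWithin_le_nhds
      ((Continuous.continuousAt (by fun_prop : Continuous fun z : ℂ => 2 * z.re + N)).eventually
        (eventually_gt_nhds hN))
    have hreg : ∀ᶠ z : ℂ in 𝓝[≠] ν, z ∈ regularSet := by
      -- The possible poles are spaced by `1/2`, so none other than `ν` lies in this ball: the
      -- integers `m` and `n` would differ by less than `1`.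
      have h1 : ∀ᶠ z : ℂ in 𝓝 ν, ‖z - ν‖ < 1 / 2 := by
        filter_upwards [Metric.ball_mem_nhds ν (by norm_num : (0 : ℝ) < 1 / 2)] with z hz
        rwa [← dist_eq_norm]
      filter_upwards [nhdsWithin_le_nhds h1, self_mem_nhdsWithin] with z hz hne m hm
      have h2 : (((m : ℤ) - n : ℤ) : ℂ) = -2 * (z - ν) := by
        push_cast
        linear_combination hn - hm
      have h3 : ‖(((m : ℤ) - n : ℤ) : ℂ)‖ < 1 := by
        rw [h2, norm_mul]
        simp
        linarith
      rw [Complex.norm_intCast] at h3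
      have h4 : |((m : ℤ) - n : ℤ)| < 1 := by exact_mod_cast h3
      rw [Int.abs_lt_one_iff] at h4
      rw [h4] at h2
      apply hne
      simp only [Set.mem_singleton_iff]
      push_cast at h2
      linear_combination (1 / 2) * h2
    filter_upwards [hev, hreg] with z hz hzr
    rw [holoExt_regularSet μ f hu h0 hzr hz, ← polar_coeff]
    simp only [div_eq_mul_inv, mul_inv]
    ring
  · exact holoExt_regularSet μ f hu h0 (fun n hn => h ⟨n, hn⟩) hN

/-! ### Linearity and bounds of Fourier transforms -/

lemma TestFn.integrable (f : TestFn) : MeasureTheory.Integrable (f : ℝ → ℂ) :=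
  f.smooth.continuous.integrable_of_hasCompactSupport f.hasCompactSupport

lemma TestFn.exists_bound₂ (f g : TestFn) : ∃ u : ℝ, 0 < u ∧ (∀ x, u < |x| → f x = 0) ∧
    ∀ x, u < |x| → g x = 0 := by
  obtain ⟨u, hu, h⟩ := f.exists_bound
  obtain ⟨v, hv, h'⟩ := g.exists_bound
  exact ⟨max u v, lt_max_of_lt_left hu, fun x hx => h x ((le_max_left _ _).trans_lt hx),
    fun x hx => h' x ((le_max_right _ _).trans_lt hx)⟩

lemma fourierT_add_smul (a : ℂ) (f g : TestFn) (y : ℝ) :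
    fourierT (a • f + g : TestFn) y = a * fourierT f y + fourierT g y := by
  rw [← fourierT_const_mul, ← fourierT_add (f.integrable.const_mul a) g.integrable]
  rfl

lemma evenPart_add_smul (μ a : ℂ) (f g : ℝ → ℂ) :
    evenPart μ (fun t => a * f t + g t) = fun t => a * evenPart μ f t + evenPart μ g t := by
  funext t
  simp only [evenPart]
  ring

lemma exists_nat_re (ν : ℂ) (N : ℕ) : ∃ M : ℕ, N ≤ M ∧ 0 < 2 * ν.re + M := by
  obtain ⟨M, hM⟩ := exists_nat_gt (-(2 * ν.re))
  refine ⟨max N M, le_max_left _ _, ?_⟩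
  have : (M : ℝ) ≤ (max N M : ℕ) := by exact_mod_cast le_max_right N M
  linarith

lemma twistedFourier_add_smul (μ ν a : ℂ) (f g : TestFn) (y : ℝ) :
    twistedFourier μ ν (a • f + g) y = a * twistedFourier μ ν f y + twistedFourier μ ν g y := by
  obtain ⟨u, hu, hf, hg⟩ := f.exists_bound₂ g
  obtain ⟨N, -, hN⟩ := exists_nat_re ν 0
  have hfg : ∀ x, u < |x| → (a • f + g : TestFn) x = 0 := fun x hx => by
    change a * f x + g x = 0
    rw [hf x hx, hg x hx]
    simp
  by_cases hy : y = 0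
  · rw [hy, twistedFourier_zero μ ν _ hN, twistedFourier_zero μ ν _ hN, twistedFourier_zero μ ν _ hN,
      ← mellinCont_add_smul a (contDiff_evenPart μ f.smooth) (contDiff_evenPart μ g.smooth)
        (evenPart_zero μ hf) (evenPart_zero μ hg) (by simpa using hN), ← evenPart_add_smul]
    rfl
  · rw [twistedFourier_of_ne μ ν _ hu hfg hy hN, twistedFourier_of_ne μ ν _ hu hf hy hN,
      twistedFourier_of_ne μ ν _ hu hg hy hN,
      ← partInt_add_smul μ ν a f.smooth g.smooth hu hf hg y hN]
    rfl

lemma twistedFourier_of_zero (μ ν : ℂ) (f : TestFn) {ε : ℝ} (hε : 0 < ε)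
    (h1 : ∀ x, |x| < ε → f x = 0) (y : ℝ) :
    twistedFourier μ ν f y = fourierT (fInf μ ν f) y := by
  by_cases hy : y = 0
  · obtain ⟨u, hu, h0⟩ := f.exists_bound
    obtain ⟨N, -, hN⟩ := exists_nat_re ν 0
    have hd : ∀ k, iteratedDeriv k f 0 = 0 := fun k => by
      rw [(iteratedDeriv_congr_of_eventuallyEq (eventually_zero_of_abs_lt h1 (x := 0) (by simpa using hε))
        k).eq_of_nhds, iteratedDeriv_fun_const_zero]
    rw [hy, twistedFourier_zero μ ν f hN, fourierT_fInf_zero μ ν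
      (integrable_fInf_of_zero μ ν f.smooth hu h0 hε h1), mellinCont_of_zero fun k => ?_]
    rw [iteratedDeriv_evenPart μ f.smooth, neg_zero, hd]
    simp
  · exact twistedFourier_of_ne_of_zero μ ν f hε h1 hy

lemma integral_norm_le {f : ℝ → ℂ} {u B : ℝ} (hu : 0 < u) (h0 : ∀ x, u < |x| → f x = 0)
    (hB : ∀ x, ‖f x‖ ≤ B) : ∫ x, ‖f x‖ ≤ 2 * u * B := by
  rw [← MeasureTheory.setIntegral_eq_integral_of_forall_compl_eq_zero (s := Set.Icc (-u) u)]
  · have := MeasureTheory.norm_setIntegral_le_of_norm_le_const (μ := MeasureTheory.volume)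
      (s := Set.Icc (-u) u) (f := fun x => ‖f x‖) (C := B) (by simp) (fun x _ => by simpa using hB x)
    refine (le_abs_self _).trans (this.trans (le_of_eq ?_))
    rw [Real.volume_real_Icc_of_le (by linarith)]
    ring
  · intro x hx
    rw [h0 x (by
      by_contra h
      exact hx (abs_le.1 (not_lt.1 h))), norm_zero]

lemma fourierT_deriv {f : ℝ → ℂ} (hf : ContDiff ℝ ∞ f) {u : ℝ} (h0 : ∀ x, u < |x| → f x = 0) (y : ℝ) :
    fourierT (deriv f) y = -(2 * Real.pi * Complex.I * y) * fourierT f y := by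
  have hc := hasCompactSupport_of_abs h0
  have hi : MeasureTheory.Integrable f := hf.continuous.integrable_of_hasCompactSupport hc
  have hi' : MeasureTheory.Integrable (deriv f) :=
    (contDiff_deriv hf).continuous.integrable_of_hasCompactSupport hc.deriv
  have hd : ∀ x : ℝ, HasDerivAt (fun x : ℝ => Complex.exp (2 * Real.pi * Complex.I * x * y))
      (2 * Real.pi * Complex.I * y * Complex.exp (2 * Real.pi * Complex.I * x * y)) x := fun x => by
    have h1 : HasDerivAt (fun x : ℝ => (2 * Real.pi * Complex.I * x * y : ℂ))
        (2 * Real.pi * Complex.I * y) x := by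
      have := ((hasDerivAt_id (x : ℂ)).comp_ofReal.const_mul (2 * Real.pi * Complex.I : ℂ)).mul_const (y : ℂ)
      simpa using this
    exact h1.cexp.congr_deriv (by ring)
  have h2 := MeasureTheory.integral_mul_deriv_eq_deriv_mul_of_integrable (fun x _ => hd x)
    (fun x _ => hasDerivAt_of_smooth hf x) ?_ ?_ ?_
  · rw [fourierT, fourierT, ← MeasureTheory.integral_const_mul]
    rw [← MeasureTheory.integral_neg] at h2
    refine Eq.trans ?_ (h2.trans ?_)
    · exact MeasureTheory.integral_congr_ae (Filter.Eventually.of_forall fun x => mul_comm _ _)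
    · exact MeasureTheory.integral_congr_ae (Filter.Eventually.of_forall fun x => by simp only; ring)
  · refine (integrable_mul_character hi' y).congr (Filter.Eventually.of_forall fun x => mul_comm _ _)
  · refine ((integrable_mul_character hi y).const_mul (2 * Real.pi * Complex.I * y)).congr
      (Filter.Eventually.of_forall fun x => ?_)
    simp only [Pi.mul_apply]
    ring
  · refine (integrable_mul_character hi y).congr (Filter.Eventually.of_forall fun x => mul_comm _ _)

lemma norm_two_pi_I_mul (y : ℝ) : ‖(2 * Real.pi * Complex.I * y : ℂ)‖ = 2 * Real.pi * |y| := by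
  rw [norm_mul, norm_mul, norm_mul, Complex.norm_I, Complex.norm_real, Complex.norm_real,
    Real.norm_of_nonneg Real.pi_pos.le, Real.norm_eq_abs]
  simp

lemma norm_fourierT_mul_pow_le (N : ℕ) {u : ℝ} (hu : 0 < u) (y : ℝ) : ∀ {f : ℝ → ℂ}, ContDiff ℝ ∞ f →
    (∀ x, u < |x| → f x = 0) → ∀ {B : ℝ}, (∀ x, ‖iteratedDeriv N f x‖ ≤ B) →
      ‖fourierT f y‖ * |y| ^ N ≤ 2 * u * B := by
  induction N with
  | zero =>
    intro f hf h0 B hB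
    rw [pow_zero, mul_one]
    exact (norm_fourierT_le f y).trans (integral_norm_le hu h0 fun x => by simpa using hB x)
  | succ N ih =>
    intro f hf h0 B hB
    have h1 : ∀ x, u < |x| → deriv f x = 0 := fun x hx => by
      rw [(eventually_zero_of_lt_abs h0 hx).deriv_eq]
      simp
    have h2 := ih (contDiff_deriv hf) h1 (B := B) fun x => by
      rw [← iteratedDeriv_succ']
      exact hB x
    rw [fourierT_deriv hf h0, norm_mul, norm_neg, norm_two_pi_I_mul] at h2
    refine le_trans ?_ h2
    have h3 : 0 ≤ ‖fourierT f y‖ * |y| ^ (N + 1) := by positivity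
    have h4 := Real.pi_gt_three
    calc ‖fourierT f y‖ * |y| ^ (N + 1) ≤ 2 * Real.pi * (‖fourierT f y‖ * |y| ^ (N + 1)) := by nlinarith
      _ = _ := by ring

lemma one_add_pow_le (N : ℕ) {t : ℝ} (ht : 0 ≤ t) : (1 + t) ^ N ≤ 2 ^ N * (1 + t ^ N) := by
  rcases le_total t 1 with h | h
  · have : (1 + t) ^ N ≤ 2 ^ N := pow_le_pow_left₀ (by linarith) (by linarith) N
    have : (0 : ℝ) ≤ 2 ^ N * t ^ N := by positivity
    linarith
  · have : (1 + t) ^ N ≤ (2 * t) ^ N := pow_le_pow_left₀ (by linarith) (by linarith) N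
    rw [mul_pow] at this
    have : (0 : ℝ) ≤ 2 ^ N := by positivity
    linarith

lemma norm_fourierT_mul_one_add_pow_le (N : ℕ) {u : ℝ} (hu : 0 < u) : ∃ C : ℝ, 0 < C ∧
    ∀ f : ℝ → ℂ, ContDiff ℝ ∞ f → (∀ x, u < |x| → f x = 0) → ∀ y : ℝ,
      ‖fourierT f y‖ * (1 + |y|) ^ N ≤ C * testNorm N f := by
  refine ⟨2 ^ N * (2 * (2 * u)), by positivity, fun f hf h0 y => ?_⟩
  have hc := hasCompactSupport_of_abs h0
  have h1 := norm_fourierT_mul_pow_le 0 hu y hf h0 fun x =>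
    norm_iteratedDeriv_le_testNorm hf hc (Nat.zero_le N) x
  have h2 := norm_fourierT_mul_pow_le N hu y hf h0 fun x =>
    norm_iteratedDeriv_le_testNorm hf hc le_rfl x
  have h3 := mul_le_mul_of_nonneg_left (one_add_pow_le N (abs_nonneg y)) (norm_nonneg (fourierT f y))
  have h4 : (0 : ℝ) < 2 ^ N := by positivity
  calc ‖fourierT f y‖ * (1 + |y|) ^ N ≤
      2 ^ N * (‖fourierT f y‖ * |y| ^ 0 + ‖fourierT f y‖ * |y| ^ N) := by
        refine h3.trans (le_of_eq (by ring))
    _ ≤ 2 ^ N * (2 * u * testNorm N f + 2 * u * testNorm N f) := by gcongr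
    _ = _ := by ring

lemma testNorm_evenPart_le (μ : ℂ) (N : ℕ) : ∃ C : ℝ, 0 < C ∧ ∀ f : TestFn,
    testNorm N (evenPart μ f) ≤ C * testNorm N f := by
  set A := ‖Complex.exp (-(Real.pi * Complex.I * μ / 2))‖ with hA
  set B := ‖Complex.exp (Real.pi * Complex.I * μ / 2)‖ with hB
  have hA0 : 0 < A := norm_pos_iff.2 (Complex.exp_ne_zero _)
  have hB0 : 0 < B := norm_pos_iff.2 (Complex.exp_ne_zero _)
  refine ⟨(N + 1) * (A + B), by positivity, fun f => ?_⟩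
  have hT := testNorm_nonneg N f
  rw [mul_assoc]
  refine testNorm_le (by positivity) fun k hk x => ?_
  have h1 := norm_iteratedDeriv_le_testNorm f.smooth f.hasCompactSupport hk x
  have h2 := norm_iteratedDeriv_le_testNorm f.smooth f.hasCompactSupport hk (-x)
  rw [iteratedDeriv_evenPart μ f.smooth]
  refine (norm_add_le _ _).trans ?_
  rw [norm_mul, norm_mul, norm_mul, norm_pow, norm_neg, norm_one, one_pow, one_mul, add_mul]
  gcongr

/-- The bound from partial integration degenerates as `y → 0`, hence the gap `ε`; the single value
`y = 0` is covered by the Mellin continuation. -/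
lemma norm_twistedFourier_le (μ ν : ℂ) {u ε : ℝ} (hu : 0 < u) (hε : 0 < ε) (N : ℕ) :
    ∃ (m : ℕ) (C : ℝ), 0 < C ∧ ∀ f : TestFn, (∀ x, u < |x| → f x = 0) → ∀ y : ℝ, (y ≠ 0 → ε ≤ |y|) →
      ‖twistedFourier μ ν f y‖ * (1 + |y|) ^ N ≤ C * testNorm m f := by
  obtain ⟨M, hNM, hM⟩ := exists_nat_re ν N
  obtain ⟨C, hC, H⟩ := partInt_bound μ ν hu hM
  obtain ⟨C', hC', H'⟩ := mellinCont_bound u (N := M) (σ := 2 * ν) (by simpa using hM)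
  obtain ⟨E, hE, HE⟩ := testNorm_evenPart_le μ M
  refine ⟨M, C * (1 / ε + 1) ^ M + C' * E, by positivity, fun f h0 y hy => ?_⟩
  have hT := testNorm_nonneg M f
  by_cases h : y = 0
  · rw [h, twistedFourier_zero μ ν f hM, abs_zero, add_zero, one_pow, mul_one]
    refine (H' _ (contDiff_evenPart μ f.smooth) (evenPart_zero μ h0)).trans ?_
    refine (mul_le_mul_of_nonneg_left (HE f) hC'.le).trans ?_
    rw [← mul_assoc]
    refine mul_le_mul_of_nonneg_right ?_ hT
    have : 0 ≤ C * (1 / ε + 1) ^ M := by positivity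
    linarith
  · have hy0 : 0 < |y| := abs_pos.2 h
    have h1 : 1 + |y| ≤ (1 / ε + 1) * |y| := by
      rw [add_mul, one_mul, one_div, inv_mul_eq_div]
      have := (one_le_div hε).2 (hy h)
      linarith
    rw [twistedFourier_of_ne μ ν f hu h0 h hM]
    calc ‖partInt μ f y M ν‖ * (1 + |y|) ^ N
        ≤ (C * testNorm M f * (|y| ^ M)⁻¹) * ((1 / ε + 1) * |y|) ^ M := by
          refine mul_le_mul (H f f.smooth h0 y h) ?_ (by positivity) (by positivity)
          exact (pow_le_pow_right₀ (by linarith) hNM).trans (pow_le_pow_left₀ (by positivity) h1 M)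
      _ = C * (1 / ε + 1) ^ M * testNorm M f := by
          rw [mul_pow]
          field_simp
      _ ≤ _ := by
          refine mul_le_mul_of_nonneg_right ?_ hT
          have : 0 ≤ C' * E := by positivity
          linarith

/-! ### The Jacquet integral -/

lemma iotaFun_add_smul (μ ν a : ℂ) (f g : TestFn) :
    iotaFun μ ν (a • f + g : TestFn) = a • iotaFun μ ν f + iotaFun μ ν g := by
  have := congrArg Subtype.val (((iota μ ν).map_add (a • f) g).trans
    (congrArg (· + iota μ ν g) ((iota μ ν).map_smul a f)))
  exact this

lemma invol_add_smul (μ a : ℂ) (F G : Cover → ℂ) :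
    invol μ (a • F + G) = a • invol μ F + invol μ G := by
  funext x
  simp only [invol, Pi.add_apply, Pi.smul_apply, smul_eq_mul]
  ring

lemma IsPartition.add_smul {μ ν : ℂ} {F G : Cover → ℂ} {f g : TestFn × TestFn} (a : ℂ)
    (hf : IsPartition μ ν F f) (hg : IsPartition μ ν G g) :
    IsPartition μ ν (a • F + G) (a • f.1 + g.1, a • f.2 + g.2) := by
  unfold IsPartition at *
  rw [iotaFun_add_smul, iotaFun_add_smul, invol_add_smul, ← hf, ← hg, smul_add]
  abel

lemma IsPartition.eq {μ ν : ℂ} {F : Cover → ℂ} {f : TestFn × TestFn} (h : IsPartition μ ν F f) {x : ℝ}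
    (hx : x ≠ 0) : stdChart ν (ang F) x = f.1 x + fInf μ ν f.2 x := by
  have hQ₂ : IsQP μ (ang (iotaFun μ ν f.2)) := PSeries.isQP (iotaFun_mem μ ν f.2)
  have e1 : ang F = fun θ => ang (iotaFun μ ν f.1) θ + angInvol μ (ang (iotaFun μ ν f.2)) θ := by
    rw [← PSeries.ang_invol (iotaFun_mem μ ν f.2), ← show _ = F from h]
    rfl
  have e2 : stdChart ν (ang F) x =
      stdChart ν (ang (iotaFun μ ν f.1)) x + stdChart ν (angInvol μ (ang (iotaFun μ ν f.2))) x := by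
    rw [e1]
    exact mul_add _ _ _
  rw [e2, stdChart_angInvol_eq_fInf ν hQ₂ hx, stdChart_iota, stdChart_iota]

lemma stdChart_zero (ν : ℂ) (x : ℝ) : stdChart ν (ang 0) x = 0 := mul_zero _

lemma zero_of_fInf_zero (μ ν : ℂ) {f : TestFn} {u : ℝ} (hu : 0 < u) (h : ∀ x, u < |x| → fInf μ ν f x = 0) :
    ∀ t, |t| < 1 / u → f t = 0 := by
  refine fun t ht => eq_zero_of_punctured f.smooth.continuous (ε := 1 / u) (by positivity)
    (fun t ht ht' => ?_) ht
  have h1 : -1 / t ≠ 0 := div_ne_zero (by norm_num) ht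
  have h2 := h (-1 / t) (by
    rw [abs_div, abs_neg, abs_one]
    exact (lt_one_div hu (abs_pos.2 ht)).2 ht')
  rw [fInf_of_ne μ ν f h1, show -1 / (-1 / t) = t by field_simp] at h2
  simpa [Complex.exp_ne_zero] using h2

/-- On `x ≠ 0` a partition of zero means `f₁ = -(f₂)_{μ,ν,∞}`. As `f₁` has compact support, `f₂`
vanishes near `0`, so its twisted transform is an honest integral and cancels that of `f₁`. -/
lemma IsPartition.jacquet_zero {μ ν : ℂ} {f : TestFn × TestFn} (h : IsPartition μ ν 0 f) (y : ℝ) :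
    fourierT f.1 y + twistedFourier μ ν f.2 y = 0 := by
  obtain ⟨u, hu, h0⟩ := f.1.exists_bound
  have h1 : ∀ x, x ≠ 0 → f.1 x = -fInf μ ν f.2 x := fun x hx => by
    have := h.eq hx
    rw [stdChart_zero] at this
    linear_combination -this
  have h2 := zero_of_fInf_zero μ ν hu (f := f.2) fun x hx => by
    have := h1 x (by rintro rfl; simp at hx; linarith)
    rw [h0 x hx] at this
    exact neg_eq_zero.1 this.symm
  rw [twistedFourier_of_zero μ ν f.2 (by positivity) h2, fourierT, fourierT, ← eq_neg_iff_add_eq_zero,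
    ← MeasureTheory.integral_neg]
  refine MeasureTheory.integral_congr_ae ?_
  -- The relation between `f₁` and `f₂` is only known off the null set `{0}`.
  filter_upwards [(MeasureTheory.measure_eq_zero_iff_ae_notMem).1 (Real.volume_singleton (a := 0))] with x hx
  rw [h1 x hx]
  ring

/-- Independence of the partition: the difference of two partitions of `F` is a partition of zero,
and both transforms are linear. -/
lemma IsPartition.jacquet_eq {μ ν : ℂ} {F : Cover → ℂ} {f : TestFn × TestFn} (h : IsPartition μ ν F f)
    (y : ℝ) : jacquet μ ν y F = fourierT f.1 y + twistedFourier μ ν f.2 y := by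
  have hex : ∃ f : TestFn × TestFn, IsPartition μ ν F f := ⟨f, h⟩
  rw [jacquet, dif_pos hex]
  have h1 := (h.add_smul (-1) hex.choose_spec)
  rw [neg_smul, one_smul, neg_add_cancel] at h1
  have h2 := h1.jacquet_zero y
  simp only [fourierT_add_smul, twistedFourier_add_smul] at h2
  linear_combination h2

lemma jacquet_add_smul {μ ν : ℂ} (y : ℝ) (a : ℂ) (F G : PSeries μ ν) :
    jacquet μ ν y (a • F + G : PSeries μ ν) = a * jacquet μ ν y F + jacquet μ ν y G := by
  have h1 := isPartition_part F.2
  have h2 := isPartition_part G.2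
  have h3 := h1.add_smul a h2
  rw [h1.jacquet_eq, h2.jacquet_eq]
  refine (h3.jacquet_eq y).trans ?_
  simp only [fourierT_add_smul, twistedFourier_add_smul]
  ring

lemma twistedFourier_zero_fun (μ ν : ℂ) (y : ℝ) : twistedFourier μ ν 0 y = 0 := by
  have := twistedFourier_add_smul μ ν 1 0 0 y
  rw [smul_zero, zero_add] at this
  linear_combination -this

lemma jacquet_iota (μ ν : ℂ) (y : ℝ) (f : TestFn) : jacquet μ ν y (iotaFun μ ν f) = fourierT f y := by
  have : IsPartition μ ν (iotaFun μ ν f) (f, 0) := by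
    have h0 : iotaFun μ ν (0 : TestFn) = 0 := congrArg Subtype.val (iota μ ν).map_zero
    have h1 : invol μ 0 = 0 := by
      funext g
      simp [invol]
    rw [IsPartition, h0, h1, add_zero]
  rw [this.jacquet_eq, twistedFourier_zero_fun, add_zero]

lemma partFst_zero (ν : ℂ) (φ : ℝ → ℂ) (hφ : ContDiff ℝ ∞ φ) (x : ℝ) (hx : 2 < |x|) :
    partFst ν φ hφ x = 0 := by
  rw [partFst, mkTest_apply, cutoff_zero hx.le, zero_mul]

lemma partSnd_zero (μ ν : ℂ) (φ : ℝ → ℂ) (hφ : ContDiff ℝ ∞ φ) (x : ℝ) (hx : 2 < |x|) :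
    partSnd μ ν φ hφ x = 0 := by
  rw [partSnd, mkTest_apply, cutoffInf_zero (by linarith), zero_mul]

/-- Using the standard partition, whose supports lie in `[-2, 2]` for all `F`, makes the bounds for
test functions uniform in `F`. -/
lemma norm_jacquet_le (μ ν : ℂ) {ε : ℝ} (hε : 0 < ε) (N : ℕ) :
    ∃ (n : ℕ) (C : ℝ), 0 < C ∧ ∀ F : PSeries μ ν, ∀ y : ℝ, (y ≠ 0 → ε ≤ |y|) →
      ‖jacquet μ ν y F‖ * (1 + |y|) ^ N ≤ C * angNorm n (ang F) := by
  obtain ⟨C, hC, H⟩ := norm_fourierT_mul_one_add_pow_le N (u := 2) (by norm_num)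
  obtain ⟨m, C', hC', H'⟩ := norm_twistedFourier_le μ ν (u := 2) (by norm_num) hε N
  obtain ⟨n₁, D, hD, K⟩ := testNorm_partFst_le ν N
  obtain ⟨n₂, D', hD', K'⟩ := testNorm_partSnd_le μ ν m
  refine ⟨max n₁ n₂, C * D + C' * D', by positivity, fun F y hy => ?_⟩
  have hF : ContDiff ℝ ∞ (ang (F : Cover → ℂ)) := (PSeries.isQP F.2).1
  rw [(isPartition_part F.2).jacquet_eq]
  have h1 := H _ (partFst ν _ hF).smooth (partFst_zero ν _ hF) y
  have h2 := H' (partSnd μ ν _ hF) (partSnd_zero μ ν _ hF) y hy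
  have h3 := mul_le_mul_of_nonneg_left (angNorm_mono (le_max_left n₁ n₂) (ang (F : Cover → ℂ))) hD.le
  have h4 := mul_le_mul_of_nonneg_left (angNorm_mono (le_max_right n₁ n₂) (ang (F : Cover → ℂ))) hD'.le
  have h5 := mul_le_mul_of_nonneg_left ((K _ hF).trans h3) hC.le
  have h6 := mul_le_mul_of_nonneg_left ((K' _ hF).trans h4) hC'.le
  refine (mul_le_mul_of_nonneg_right (norm_add_le _ _) (by positivity)).trans ?_
  rw [add_mul]
  refine (add_le_add (h1.trans h5) (h2.trans h6)).trans (le_of_eq (by ring))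

/-! ### Shifted lattices -/

/-- This normal form makes `p` the period: the multiples of `p` lie in the dual lattice
(`mul_mem_dualLattice`), and the sign matches the frequencies that Poisson summation produces. -/
lemma IsShiftedLattice.exists_pos {L : Set ℝ} (hL : IsShiftedLattice L) :
    ∃ a p : ℝ, 0 < p ∧ L = Set.range fun n : ℤ => a - n / p := by
  obtain ⟨a, b, hb, rfl⟩ := hL
  rcases lt_or_gt_of_ne hb with h | h
  · refine ⟨a, -1 / b, div_pos_of_neg_of_neg (by norm_num) h, ?_⟩
    congr 1
    funext n
    field_simp
    ring
  · refine ⟨a, 1 / b, by positivity, ?_⟩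
    rw [← (Equiv.neg ℤ).surjective.range_comp]
    congr 1
    funext n
    simp
    ring

/-- The enumeration of a shifted lattice by `ℤ`. -/
noncomputable def latticeEquiv (a : ℝ) {p : ℝ} (hp : 0 < p) :
    ℤ ≃ Set.range fun n : ℤ => a - n / p :=
  Equiv.ofInjective _ fun m n h => by
    have : (m : ℝ) / p = n / p := by linarith [show a - m / p = a - n / p from h]
    exact_mod_cast (div_left_inj' hp.ne').1 this

lemma latticeEquiv_apply (a : ℝ) {p : ℝ} (hp : 0 < p) (n : ℤ) :
    (latticeEquiv a hp n : ℝ) = a - n / p := rfl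

/-- If `r` is an integer the gap is `1`; otherwise it is the distance from `r` to the nearest
integer. -/
lemma exists_gap (r : ℝ) : ∃ ε : ℝ, 0 < ε ∧ ∀ n : ℤ, r - n ≠ 0 → ε ≤ |r - n| := by
  by_cases h : r - round r = 0
  · refine ⟨1, one_pos, fun n hn => ?_⟩
    have h1 : r - n = ((round r - n : ℤ) : ℝ) := by
      push_cast
      linarith
    rw [h1] at hn ⊢
    exact_mod_cast Int.one_le_abs (by exact_mod_cast hn)
  · exact ⟨|r - round r|, abs_pos.2 h, fun n _ => round_le r n⟩

lemma IsShiftedLattice.exists_gap {L : Set ℝ} (hL : IsShiftedLattice L) :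
    ∃ ε : ℝ, 0 < ε ∧ ∀ l ∈ L, l ≠ 0 → ε ≤ |l| := by
  obtain ⟨a, p, hp, rfl⟩ := hL.exists_pos
  obtain ⟨ε, hε, H⟩ := QuasiAuto.exists_gap (a * p)
  refine ⟨ε / p, by positivity, ?_⟩
  rintro _ ⟨n, rfl⟩ hn
  have h1 : a - n / p = (a * p - n) / p := by field_simp
  simp only [h1] at hn ⊢
  rw [abs_div, abs_of_pos hp]
  exact div_le_div_of_nonneg_right (H n fun h => hn (by rw [h, zero_div])) hp.le

lemma one_add_abs_int_le (a : ℝ) {p : ℝ} (hp : 0 < p) (n : ℤ) :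
    1 + |(n : ℝ)| ≤ (1 + p + |a| * p) * (1 + |a - n / p|) := by
  have h1 : (n : ℝ) = a * p - (a - n / p) * p := by
    field_simp
    ring
  have h2 : |(n : ℝ)| ≤ |a| * p + |a - n / p| * p := by
    nth_rewrite 1 [h1]
    refine (abs_sub _ _).trans (le_of_eq ?_)
    rw [abs_mul, abs_mul, abs_of_pos hp]
  have h3 : 0 ≤ |a - n / p| := abs_nonneg _
  have h4 : 0 ≤ |a| * p := by positivity
  nlinarith [mul_nonneg h4 h3]

lemma summable_int_one_add : Summable fun n : ℤ => ((1 + |(n : ℝ)|) ^ 2)⁻¹ := by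
  refine Summable.of_norm_bounded_eventually (Real.summable_one_div_int_pow.2 one_lt_two) ?_
  filter_upwards [(Set.finite_singleton (0 : ℤ)).compl_mem_cofinite] with n hn
  have hn' : (n : ℝ) ≠ 0 := by exact_mod_cast hn
  rw [Real.norm_of_nonneg (by positivity), one_div, ← sq_abs (n : ℝ)]
  have := abs_pos.2 hn'
  gcongr
  linarith

lemma IsShiftedLattice.summable {L : Set ℝ} (hL : IsShiftedLattice L) :
    Summable fun l : L => ((1 + |(l : ℝ)|) ^ 2)⁻¹ := by
  obtain ⟨a, p, hp, rfl⟩ := hL.exists_pos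
  rw [← (latticeEquiv a hp).summable_iff]
  have hK : 0 < 1 + p + |a| * p := by positivity
  refine Summable.of_nonneg_of_le (fun n => inv_nonneg.2 (sq_nonneg _)) (fun n => ?_)
    (summable_int_one_add.mul_left ((1 + p + |a| * p) ^ 2))
  have h1 := pow_le_pow_left₀ (by positivity) (one_add_abs_int_le a hp n) 2
  simp only [Function.comp_apply, latticeEquiv_apply]
  rw [mul_pow] at h1
  rw [← div_eq_mul_inv, inv_eq_one_div, div_le_div_iff₀ (by positivity) (by positivity), one_mul]
  exact h1

lemma IsShiftedLattice.finite {L : Set ℝ} (hL : IsShiftedLattice L) (R : ℝ) :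
    {l : L | |(l : ℝ)| ≤ R}.Finite := by
  obtain ⟨a, p, hp, rfl⟩ := hL.exists_pos
  refine Set.Finite.of_preimage (f := latticeEquiv a hp) ?_ (latticeEquiv a hp).surjective
  refine (Set.finite_Icc (-⌈(1 + p + |a| * p) * (1 + R)⌉) ⌈(1 + p + |a| * p) * (1 + R)⌉).subset
    fun n hn => ?_
  have hn : |a - n / p| ≤ R := hn
  have h1 := one_add_abs_int_le a hp n
  have hK : 0 < 1 + p + |a| * p := by positivity
  have h2 : |(n : ℝ)| ≤ (1 + p + |a| * p) * (1 + R) := by nlinarith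
  have h3 : |(n : ℝ)| ≤ ⌈(1 + p + |a| * p) * (1 + R)⌉ := h2.trans (Int.le_ceil _)
  have h4 : |n| ≤ ⌈(1 + p + |a| * p) * (1 + R)⌉ := by exact_mod_cast h3
  exact abs_le.1 h4

/-- A bounded set contains only finitely many lattice points, so the asymptotic bound can be made
global, and the real exponent may be rounded up to a natural number. -/
lemma mem_polyGrowth_iff {L : Set ℝ} (hL : IsShiftedLattice L) (α : L → ℂ) :
    α ∈ polyGrowth L ↔ ∃ (k : ℕ) (C : ℝ), 0 < C ∧ ∀ l : L, ‖α l‖ ≤ C * (1 + |(l : ℝ)|) ^ k := by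
  constructor
  · rintro ⟨r, hr⟩
    obtain ⟨c, hc⟩ := hr.bound
    rw [Filter.eventually_comap, Filter.eventually_atTop] at hc
    obtain ⟨R, hR⟩ := hc
    obtain ⟨k, hk⟩ := exists_nat_ge r
    obtain ⟨B, hB⟩ := ((hL.finite (max R 1)).image fun l => ‖α l‖).bddAbove
    refine ⟨k, |c| + |B| + 1, by positivity, fun l => ?_⟩
    have h1 : 1 ≤ (1 + |(l : ℝ)|) ^ k := one_le_pow₀ (by linarith [abs_nonneg (l : ℝ)])
    rcases le_total |(l : ℝ)| (max R 1) with h | h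
    · have h2 : ‖α l‖ ≤ B := hB ⟨l, h, rfl⟩
      have h3 := le_abs_self B
      have h4 := abs_nonneg c
      have h5 : (|c| + |B| + 1) * 1 ≤ (|c| + |B| + 1) * (1 + |(l : ℝ)|) ^ k :=
        mul_le_mul_of_nonneg_left h1 (by positivity)
      linarith
    · have h2 := hR _ ((le_max_left _ _).trans h) l rfl
      have h3 : 1 ≤ |(l : ℝ)| := (le_max_right _ _).trans h
      rw [Real.norm_of_nonneg (by positivity)] at h2
      have h4 : |(l : ℝ)| ^ r ≤ (1 + |(l : ℝ)|) ^ k := by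
        refine (Real.rpow_le_rpow_of_exponent_le h3 hk).trans ?_
        rw [Real.rpow_natCast]
        exact pow_le_pow_left₀ (abs_nonneg _) (by linarith) k
      calc ‖α l‖ ≤ c * |(l : ℝ)| ^ r := h2
        _ ≤ (|c| + |B| + 1) * |(l : ℝ)| ^ r := by
          refine mul_le_mul_of_nonneg_right ?_ (by positivity)
          linarith [le_abs_self c, abs_nonneg B]
        _ ≤ _ := by gcongr
  · rintro ⟨k, C, hC, H⟩
    refine ⟨k, Asymptotics.IsBigO.of_bound (C * 2 ^ k) ?_⟩
    filter_upwards [Filter.tendsto_comap.eventually (Filter.eventually_ge_atTop (1 : ℝ))] with l hl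
    rw [Real.norm_of_nonneg (by positivity), Real.rpow_natCast, mul_assoc, ← mul_pow]
    refine (H l).trans ?_
    gcongr
    linarith

/-- Two powers of `1 + |l|` beyond the growth of `α` pay for the summability over the lattice. -/
lemma summable_mul_of_bound {L : Set ℝ} (hL : IsShiftedLattice L) {α b : L → ℂ} {k : ℕ} {C B : ℝ}
    (hα : ∀ l : L, ‖α l‖ ≤ C * (1 + |(l : ℝ)|) ^ k)
    (hb : ∀ l : L, ‖b l‖ * (1 + |(l : ℝ)|) ^ (k + 2) ≤ B) :
    (Summable fun l => α l * b l) ∧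
      ‖∑' l, α l * b l‖ ≤ C * (∑' l : L, ((1 + |(l : ℝ)|) ^ 2)⁻¹) * B := by
  have h : ∀ l : L, ‖α l * b l‖ ≤ C * B * ((1 + |(l : ℝ)|) ^ 2)⁻¹ := fun l => by
    have hp : 0 < 1 + |(l : ℝ)| := by positivity
    rw [norm_mul, ← div_eq_mul_inv, le_div_iff₀ (by positivity)]
    have hC : 0 ≤ C := by
      have := (norm_nonneg _).trans (hα l)
      exact nonneg_of_mul_nonneg_left this (by positivity)
    calc ‖α l‖ * ‖b l‖ * (1 + |(l : ℝ)|) ^ 2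
        ≤ (C * (1 + |(l : ℝ)|) ^ k) * ‖b l‖ * (1 + |(l : ℝ)|) ^ 2 := by
          gcongr
          exact hα l
      _ = C * (‖b l‖ * (1 + |(l : ℝ)|) ^ (k + 2)) := by ring
      _ ≤ C * B := mul_le_mul_of_nonneg_left (hb l) hC
  have hs := hL.summable.mul_left (C * B)
  refine ⟨Summable.of_norm_bounded hs h, ?_⟩
  refine (tsum_of_norm_bounded hs.hasSum h).trans (le_of_eq ?_)
  rw [tsum_mul_left]
  ring

/-- The Fourier series of a sequence of polynomial growth is absolutely convergent. -/
lemma summable_fourierT {L : Set ℝ} (hL : IsShiftedLattice L) {α : L → ℂ} (hα : α ∈ polyGrowth L)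
    (f : TestFn) : Summable fun l : L => α l * fourierT f l := by
  obtain ⟨k, C, hC, H⟩ := (mem_polyGrowth_iff hL α).1 hα
  obtain ⟨u, hu, h0⟩ := f.exists_bound
  obtain ⟨D, hD, K⟩ := norm_fourierT_mul_one_add_pow_le (k + 2) hu
  exact (summable_mul_of_bound hL H fun l => K f f.smooth h0 l).1

lemma jacquet_series {L : Set ℝ} (hL : IsShiftedLattice L) (μ ν : ℂ) {α : L → ℂ}
    (hα : α ∈ polyGrowth L) : (∀ F : PSeries μ ν, Summable fun l : L => α l * jacquet μ ν l F) ∧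
      ∃ (n : ℕ) (C : ℝ), ∀ F : PSeries μ ν, ‖∑' l : L, α l * jacquet μ ν l F‖ ≤ C * angNorm n (ang F) := by
  obtain ⟨k, C, hC, H⟩ := (mem_polyGrowth_iff hL α).1 hα
  obtain ⟨ε, hε, hgap⟩ := hL.exists_gap
  obtain ⟨n, D, hD, K⟩ := norm_jacquet_le μ ν hε (k + 2)
  have h : ∀ F : PSeries μ ν, _ := fun F => summable_mul_of_bound hL H
    (b := fun l => jacquet μ ν l F) (B := D * angNorm n (ang F)) fun l => K F l (hgap l l.2)
  refine ⟨fun F => (h F).1, n, _, fun F => (h F).2.trans (le_of_eq (mul_assoc _ _ _).symm)⟩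

/-! ### Fourier series are quasi-periodic distributions -/

lemma fourierT_shift (t : ℝ) (f : TestFn) (y : ℝ) :
    fourierT (shift t f) y = Complex.exp (-(2 * Real.pi * Complex.I * y * t)) * fourierT f y := by
  rw [fourierT, fourierT, ← MeasureTheory.integral_const_mul,
    ← MeasureTheory.integral_sub_right_eq_self _ t]
  refine MeasureTheory.integral_congr_ae (Filter.Eventually.of_forall fun x => ?_)
  change f (x - t + t) * _ = _
  rw [sub_add_cancel]
  simp only
  rw [mul_left_comm, ← Complex.exp_add]
  congr 2
  push_cast
  ring

lemma exp_dualLattice {L : Set ℝ} {t : ℝ} (ht : t ∈ dualLattice L) {l₁ l₂ : ℝ} (h₁ : l₁ ∈ L) (h₂ : l₂ ∈ L) :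
    Complex.exp (-(2 * Real.pi * Complex.I * l₁ * t)) = Complex.exp (-(2 * Real.pi * Complex.I * l₂ * t)) := by
  obtain ⟨n, hn⟩ := ht l₁ h₁ l₂ h₂
  rw [Complex.exp_eq_exp_iff_exists_int]
  refine ⟨-n, ?_⟩
  have : ((l₁ : ℂ) - l₂) * t = n := by exact_mod_cast hn
  push_cast
  linear_combination (-(2 * Real.pi * Complex.I)) * this

lemma fourierSeries_shift {L : Set ℝ} (α : L → ℂ) {t : ℝ} (ht : t ∈ dualLattice L) {l : ℝ} (hl : l ∈ L)
    (f : TestFn) : fourierSeries α (shift t f) =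
      Complex.exp (-(2 * Real.pi * Complex.I * l * t)) * fourierSeries α f := by
  rw [fourierSeries, fourierSeries, ← tsum_mul_left]
  refine tsum_congr fun m => ?_
  rw [fourierT_shift, exp_dualLattice ht m.2 hl]
  ring

/-! ### Modulated bump functions -/

/-- The function `f(x) e^{-2πilx}`. -/
noncomputable def modulate (l : ℝ) (f : ℝ → ℂ) (x : ℝ) : ℂ :=
  f x * Complex.exp (-(2 * Real.pi * Complex.I * l * x))

lemma contDiff_modulate (l : ℝ) {f : ℝ → ℂ} (hf : ContDiff ℝ ∞ f) : ContDiff ℝ ∞ (modulate l f) := by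
  have hx : ContDiff ℝ ∞ fun x : ℝ => (x : ℂ) := Complex.ofRealCLM.contDiff
  exact hf.mul (Complex.contDiff_exp.comp (contDiff_const.mul hx).neg)

lemma modulate_zero (l : ℝ) {f : ℝ → ℂ} {u : ℝ} (h : ∀ x, u < |x| → f x = 0) (x : ℝ) (hx : u < |x|) :
    modulate l f x = 0 := by rw [modulate, h x hx, zero_mul]

lemma fourierT_modulate (l : ℝ) (f : ℝ → ℂ) (y : ℝ) : fourierT (modulate l f) y = fourierT f (y - l) := by
  refine MeasureTheory.integral_congr_ae (Filter.Eventually.of_forall fun x => ?_)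
  simp only [modulate]
  rw [mul_assoc, ← Complex.exp_add]
  congr 2
  push_cast
  ring

lemma deriv_modulate (l : ℝ) {f : ℝ → ℂ} (hf : ContDiff ℝ ∞ f) : deriv (modulate l f) =
    fun x => modulate l (deriv f) x + -(2 * Real.pi * Complex.I * l) * modulate l f x := by
  funext x
  have h1 : HasDerivAt (fun x : ℝ => -(2 * Real.pi * Complex.I * l * x : ℂ))
      (-(2 * Real.pi * Complex.I * l)) x := by
    have := ((hasDerivAt_id (x : ℂ)).comp_ofReal.const_mul (2 * Real.pi * Complex.I * l : ℂ)).fun_neg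
    simpa using this
  refine ((hasDerivAt_of_smooth hf x).mul h1.cexp).deriv.trans ?_
  simp only [modulate]
  ring

/-- A derivative falls either on `f` or on the character, where it costs `2π|l|`. The statement is
for all `f` because the induction also uses `f'`. -/
lemma norm_iteratedDeriv_modulate_le (k : ℕ) : ∀ f : ℝ → ℂ, ContDiff ℝ ∞ f → HasCompactSupport f →
    ∃ C : ℝ, 0 < C ∧ ∀ l x : ℝ, ‖iteratedDeriv k (modulate l f) x‖ ≤ C * (1 + |l|) ^ k := by
  induction k with
  | zero =>
    intro f hf hc
    have hT := testNorm_nonneg 0 f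
    refine ⟨testNorm 0 f + 1, by positivity, fun l x => ?_⟩
    have e : ‖Complex.exp (-(2 * Real.pi * Complex.I * l * x))‖ = 1 := by
      rw [Complex.norm_exp]
      simp
    rw [iteratedDeriv_zero, modulate, norm_mul, e]
    have := norm_le_testNorm hf hc 0 x
    simp
    linarith
  | succ k ih =>
    intro f hf hc
    obtain ⟨C, hC, H⟩ := ih f hf hc
    obtain ⟨D, hD, K⟩ := ih (deriv f) (contDiff_deriv hf) hc.deriv
    refine ⟨D + 2 * Real.pi * C, by positivity, fun l x => ?_⟩
    have h1 : ContDiff ℝ ∞ fun x => -(2 * Real.pi * Complex.I * l) * modulate l f x :=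
      contDiff_const.mul (contDiff_modulate l hf)
    rw [iteratedDeriv_succ', deriv_modulate l hf, iteratedDeriv_fun_add
      ((contDiff_modulate l (contDiff_deriv hf)).of_le (mod_cast le_top)).contDiffAt
      (h1.of_le (mod_cast le_top)).contDiffAt, iteratedDeriv_const_mul_field]
    refine (norm_add_le _ _).trans ?_
    rw [norm_mul, norm_neg, norm_two_pi_I_mul]
    have hl : |l| ≤ 1 + |l| := by linarith
    have hl1 : 1 ≤ 1 + |l| := by linarith [abs_nonneg l]
    calc ‖iteratedDeriv k (modulate l (deriv f)) x‖ + 2 * Real.pi * |l| * ‖iteratedDeriv k (modulate l f) x‖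
        ≤ D * (1 + |l|) ^ k * (1 + |l|) + 2 * Real.pi * (1 + |l|) * (C * (1 + |l|) ^ k) := by
          refine add_le_add ((K l x).trans (le_mul_of_one_le_right (by positivity) hl1)) ?_
          have := H l x
          gcongr
      _ = _ := by ring

lemma testNorm_modulate_le (m : ℕ) {f : ℝ → ℂ} (hf : ContDiff ℝ ∞ f) (hc : HasCompactSupport f) :
    ∃ C : ℝ, 0 < C ∧ ∀ l : ℝ, testNorm m (modulate l f) ≤ C * (1 + |l|) ^ m := by
  choose C hC H using fun k => norm_iteratedDeriv_modulate_le k f hf hc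
  have hS : 0 < ∑ k ∈ Finset.range (m + 1), C k := Finset.sum_pos (fun k _ => hC k) ⟨0, by simp⟩
  refine ⟨(m + 1) * ∑ k ∈ Finset.range (m + 1), C k, by positivity, fun l => ?_⟩
  rw [mul_assoc]
  refine testNorm_le (by positivity) fun k hk x => (H k l x).trans ?_
  exact mul_le_mul (Finset.single_le_sum (f := C) (fun i _ => (hC i).le) (Finset.mem_range.2 (by omega)))
    (pow_le_pow_right₀ (by linarith [abs_nonneg l]) hk) (by positivity) hS.le

/-- A smooth function which is `0` on `(-∞, 0]` and `1` on `[1, ∞)`. -/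
noncomputable def step (x : ℝ) : ℂ := (Real.smoothTransition x : ℂ)

lemma contDiff_step : ContDiff ℝ ∞ step :=
  Complex.ofRealCLM.contDiff.comp (Real.smoothTransition.contDiff (n := ⊤))

lemma step_zero {x : ℝ} (hx : x ≤ 0) : step x = 0 := by
  rw [step, Real.smoothTransition.zero_of_nonpos hx, Complex.ofReal_zero]

lemma step_one {x : ℝ} (hx : 1 ≤ x) : step x = 1 := by
  rw [step, Real.smoothTransition.one_of_one_le hx, Complex.ofReal_one]

/-- A smooth bump function whose translates by `p ℤ` form a partition of unity. -/
noncomputable def bump (p x : ℝ) : ℂ := step (x + p) - step x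

lemma contDiff_bump (p : ℝ) : ContDiff ℝ ∞ (bump p) :=
  (contDiff_step.comp (contDiff_id.add contDiff_const)).sub contDiff_step

lemma bump_zero_of_lt {p : ℝ} (hp : 0 < p) {x : ℝ} (hx : 1 < x ∨ x < -p) : bump p x = 0 := by
  rcases hx with h | h
  · rw [bump, step_one h.le, step_one (by linarith), sub_self]
  · rw [bump, step_zero (by linarith), step_zero (by linarith), sub_self]

lemma bump_zero {p : ℝ} (hp : 0 < p) (x : ℝ) (hx : p + 1 < |x|) : bump p x = 0 := by
  refine bump_zero_of_lt hp ?_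
  rcases lt_abs.1 hx with h | h
  · exact Or.inl (by linarith)
  · exact Or.inr (by linarith)

lemma fourierT_comp_add (f : ℝ → ℂ) (p y : ℝ) : fourierT (fun x => f (x + p)) y =
    Complex.exp (-(2 * Real.pi * Complex.I * y * p)) * fourierT f y := by
  rw [fourierT, fourierT, ← MeasureTheory.integral_const_mul,
    ← MeasureTheory.integral_sub_right_eq_self _ p]
  refine MeasureTheory.integral_congr_ae (Filter.Eventually.of_forall fun x => ?_)
  simp only
  rw [sub_add_cancel, mul_left_comm, ← Complex.exp_add]
  congr 2
  push_cast
  ring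

/-- On an interval containing the support the two integrals of `step` cancel except for the one over
`[1, 1 + p]`, where `step` is `1`. -/
lemma integral_bump {p : ℝ} (hp : 0 < p) : ∫ x, bump p x = p := by
  have hs : Continuous step := contDiff_step.continuous
  have hi : ∀ a b, IntervalIntegrable step MeasureTheory.volume a b := fun a b => hs.intervalIntegrable a b
  have h1 : ∫ x, bump p x = ∫ x in (-(p + 1))..1, bump p x := by
    rw [intervalIntegral.integral_of_le (by linarith)]
    refine (MeasureTheory.setIntegral_eq_integral_of_forall_compl_eq_zero fun x hx => ?_).symm
    refine bump_zero_of_lt hp ?_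
    by_contra h
    rw [not_or, not_lt, not_lt] at h
    exact hx ⟨by linarith, h.1⟩
  have h2 : ∫ x in (-(p + 1))..1, step (x + p) = ∫ x in (-(p + 1) + p)..(1 + p), step x :=
    intervalIntegral.integral_comp_add_right _ _
  have h3 : ∫ x in (-(p + 1))..(-(p + 1) + p), step x = 0 := by
    rw [intervalIntegral.integral_congr (g := fun _ => 0) fun x hx => ?_, intervalIntegral.integral_zero]
    rw [Set.uIcc_of_le (by linarith)] at hx
    exact step_zero (by linarith [hx.2])
  have h4 : ∫ x in (1 : ℝ)..(1 + p), step x = p := by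
    rw [intervalIntegral.integral_congr (g := fun _ => 1) fun x hx => ?_, intervalIntegral.integral_const]
    · simp
    rw [Set.uIcc_of_le (by linarith)] at hx
    exact step_one hx.1
  have h5 : IntervalIntegrable (fun x => step (x + p)) MeasureTheory.volume (-(p + 1)) 1 :=
    (hs.comp (continuous_add_const p)).intervalIntegrable _ _
  rw [h1]
  unfold bump
  rw [intervalIntegral.integral_sub h5 (hi _ _), h2,
    ← intervalIntegral.integral_add_adjacent_intervals (hi (-(p + 1)) (-(p + 1) + p)) (hi _ 1),
    ← intervalIntegral.integral_add_adjacent_intervals (hi (-(p + 1) + p) 1) (hi 1 _), h3, h4]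
  ring

/-- This is how the partition of unity under `p ℤ` shows at the frequencies `n/p`. As `step` itself
is not integrable, the argument passes to `bump'`, a difference of translates of `step'` by `p`, and
such a translation acts trivially at these frequencies. -/
lemma fourierT_bump {p : ℝ} (hp : 0 < p) (n : ℤ) :
    fourierT (bump p) (n / p) = if n = 0 then (p : ℂ) else 0 := by
  split_ifs with h
  · rw [h, Int.cast_zero, zero_div, ← integral_bump hp, fourierT]
    simp
  · have hp' : (p : ℂ) ≠ 0 := by exact_mod_cast hp.ne'
    have hn : (n : ℂ) ≠ 0 := by exact_mod_cast h
    have h1 := fourierT_deriv (contDiff_bump p) (bump_zero hp) (n / p)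
    have e : deriv (bump p) = fun x => deriv step (x + p) + -1 * deriv step x := by
      funext x
      have h2 := (hasDerivAt_of_smooth contDiff_step (x + p)).comp_add_const x p
      refine (h2.fun_sub (hasDerivAt_of_smooth contDiff_step x)).deriv.trans ?_
      ring
    have hc : HasCompactSupport (deriv step) := by
      refine hasCompactSupport_of_abs (u := 1) fun x hx => ?_
      rcases lt_abs.1 hx with h | h
      · have : step =ᶠ[𝓝 x] fun _ => 1 := by
          filter_upwards [eventually_gt_nhds h] with y hy using step_one hy.le
        rw [this.deriv_eq, deriv_const]
      · have : step =ᶠ[𝓝 x] fun _ => 0 := by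
          filter_upwards [eventually_lt_nhds (show x < 0 by linarith)] with y hy using step_zero hy.le
        rw [this.deriv_eq, deriv_const]
    have hi : MeasureTheory.Integrable (deriv step) :=
      (contDiff_deriv contDiff_step).continuous.integrable_of_hasCompactSupport hc
    rw [e, fourierT_add (hi.comp_add_right p) (hi.const_mul _), fourierT_const_mul, fourierT_comp_add] at h1
    have e2 : Complex.exp (-(2 * Real.pi * Complex.I * (n / p : ℝ) * p)) = 1 := by
      rw [Complex.exp_eq_one_iff]
      refine ⟨-n, ?_⟩
      push_cast
      field_simp
    rw [e2, one_mul, neg_one_mul, add_neg_cancel] at h1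
    have h3 : -(2 * Real.pi * Complex.I * (n / p : ℝ) : ℂ) ≠ 0 := by
      refine two_pi_I_ne ?_
      exact div_ne_zero (by exact_mod_cast h) hp.ne'
    exact (mul_eq_zero.1 h1.symm).resolve_left h3

/-! ### Poisson summation -/

open scoped FourierTransform in
lemma poisson (f : TestFn) (a : ℝ) {p : ℝ} (hp : 0 < p) (x : ℝ) :
    ∑' k : ℤ, Complex.exp (-(2 * Real.pi * Complex.I * a * (k * p : ℝ))) * f (x - k * p) =
      ∑' n : ℤ, 1 / p * fourierT f (a - n / p) * Complex.exp (-(2 * Real.pi * Complex.I * (a - n / p : ℝ) * x)) := by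
  have hp' : (p : ℂ) ≠ 0 := by exact_mod_cast hp.ne'
  -- Rescaling by `p`, translating by `x` and modulating by the offset `a` reduces the claim to
  -- Poisson summation over `ℤ` at the origin; afterwards `k` is replaced by `-k`.
  set h : ℝ → ℂ := fun t => Complex.exp (2 * Real.pi * Complex.I * a * p * t) * f (x + p * t) with hh
  have hx : ContDiff ℝ ∞ fun x : ℝ => (x : ℂ) := Complex.ofRealCLM.contDiff
  have hs : ContDiff ℝ ∞ h := (Complex.contDiff_exp.comp (contDiff_const.mul hx)).mul
    (f.smooth.comp (contDiff_const.add (contDiff_const.mul contDiff_id)))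
  obtain ⟨u, hu, h0⟩ := f.exists_bound
  have hc : HasCompactSupport h := by
    refine hasCompactSupport_of_abs (u := (u + |x|) / p) fun t ht => ?_
    rw [div_lt_iff₀ hp] at ht
    have h1 : |t| * p ≤ |x + p * t| + |x| := by
      have := abs_sub (x + p * t) x
      rw [add_sub_cancel_left, abs_mul, abs_of_pos hp] at this
      linarith
    rw [hh]
    simp only
    rw [h0 _ (by linarith), mul_zero]
  have h1 := (hc.toSchwartzMap hs).tsum_eq_tsum_fourier 0
  have e1 : ∀ n : ℤ, (hc.toSchwartzMap hs) (0 + n) = h n := fun n => by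
    rw [zero_add]
    rfl
  have e2 : ∀ n : ℤ, 𝓕 (hc.toSchwartzMap hs) n * fourier n ((0 : ℝ) : UnitAddCircle) =
      1 / p * fourierT f (a - n / p) * Complex.exp (-(2 * Real.pi * Complex.I * (a - n / p : ℝ) * x)) := by
    intro n
    have e3 : 𝓕 (hc.toSchwartzMap hs) n = 𝓕 h n := by
      rw [SchwartzMap.fourier_coe]
      rfl
    have e4 := MeasureTheory.Measure.integral_comp_mul_left (fun s : ℝ => f (x + s) *
      Complex.exp (2 * Real.pi * Complex.I * s * (a - n / p : ℝ))) p
    have e5 := MeasureTheory.integral_add_left_eq_self (μ := MeasureTheory.volume) (fun s : ℝ => f s *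
      Complex.exp (2 * Real.pi * Complex.I * (s - x : ℝ) * (a - n / p : ℝ))) x
    rw [e3, Real.fourier_real_eq_integral_exp_smul]
    simp only [add_sub_cancel_left] at e5
    rw [e5] at e4
    have e6 : fourierT f (a - n / p) * Complex.exp (-(2 * Real.pi * Complex.I * (a - n / p : ℝ) * x)) =
        ∫ s : ℝ, f s * Complex.exp (2 * Real.pi * Complex.I * (s - x : ℝ) * (a - n / p : ℝ)) := by
      rw [fourierT, ← MeasureTheory.integral_mul_const]
      refine MeasureTheory.integral_congr_ae (Filter.Eventually.of_forall fun s => ?_)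
      simp only
      rw [mul_assoc, ← Complex.exp_add]
      congr 2
      push_cast
      ring
    rw [mul_assoc, e6, show (fourier n ((0 : ℝ) : UnitAddCircle) : ℂ) = 1 by simp, mul_one]
    have e7 : (1 / p : ℂ) = ((|p⁻¹| : ℝ) : ℂ) := by
      rw [abs_of_pos (by positivity)]
      push_cast
      ring
    rw [e7, ← Complex.real_smul, ← e4]
    refine MeasureTheory.integral_congr_ae (Filter.Eventually.of_forall fun t => ?_)
    simp only [hh, smul_eq_mul]
    rw [← mul_assoc, ← Complex.exp_add, mul_comm]
    congr 2
    push_cast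
    field_simp
    ring
  simp only [e1, e2] at h1
  rw [← h1, ← (Equiv.neg ℤ).tsum_eq]
  refine tsum_congr fun n => ?_
  simp only [hh, Equiv.neg_apply]
  push_cast
  congr 2
  · ring
  · ring

/-! ### Series of test functions -/

lemma testNorm_smul_le (m : ℕ) (c : ℂ) (f : TestFn) :
    testNorm m (c • f : TestFn) ≤ (m + 1) * (‖c‖ * testNorm m f) := by
  have := testNorm_nonneg m f
  refine testNorm_le (by positivity) fun k hk x => ?_
  change ‖iteratedDeriv k (fun x => c * f x) x‖ ≤ _
  rw [iteratedDeriv_const_mul_field, norm_mul]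
  exact mul_le_mul_of_nonneg_left (norm_iteratedDeriv_le_testNorm f.smooth f.hasCompactSupport hk x)
    (norm_nonneg _)

lemma TestFn.coe_sum {ι : Type*} (S : Finset ι) (g : ι → TestFn) (x : ℝ) :
    (∑ i ∈ S, g i : TestFn) x = ∑ i ∈ S, g i x := by
  classical
  induction S using Finset.induction_on with
  | empty => rfl
  | insert i S hi ih =>
    rw [Finset.sum_insert hi, Finset.sum_insert hi, ← ih]
    rfl

lemma iteratedDeriv_tsum_of_summable {ι : Type*} {g : ι → ℝ → ℂ} (hg : ∀ i, ContDiff ℝ ∞ (g i))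
    {v : ℕ → ι → ℝ} (hv : ∀ k, Summable (v k)) (h : ∀ k i x, ‖iteratedDeriv k (g i) x‖ ≤ v k i) (k : ℕ) :
    iteratedDeriv k (fun x => ∑' i, g i x) = fun x => ∑' i, iteratedDeriv k (g i) x := by
  induction k with
  | zero => simp
  | succ k ih =>
    funext x
    rw [iteratedDeriv_succ, ih]
    simp only [iteratedDeriv_succ]
    refine (hasDerivAt_tsum (hv (k + 1)) (fun i y => hasDerivAt_of_smooth (contDiff_iteratedDeriv (hg i) k) y)
      (fun i y => ?_) (y₀ := 0) (Summable.of_norm_bounded (hv k) fun i => h k i 0) x).deriv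
    rw [← iteratedDeriv_succ]
    exact h (k + 1) i y

lemma norm_tsum_sub_sum_le {ι : Type*} {a : ι → ℂ} {v : ι → ℝ} (hv : Summable v) (h : ∀ i, ‖a i‖ ≤ v i)
    (S : Finset ι) : ‖∑' i, a i - ∑ i ∈ S, a i‖ ≤ ∑' i, v i - ∑ i ∈ S, v i := by
  have ha : Summable a := Summable.of_norm_bounded hv h
  have e1 := ha.sum_add_tsum_subtype_compl S
  have e2 := hv.sum_add_tsum_subtype_compl S
  rw [← e1, ← e2, add_sub_cancel_left, add_sub_cancel_left]
  exact tsum_of_norm_bounded ((hv.subtype _).hasSum) fun i => h i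

/-- A distribution may be applied term by term to a series of test functions with supports in a
fixed compact set that converges in all the norms. -/
lemma IsDistribution.hasSum {T : TestFn →ₗ[ℂ] ℂ} (hT : IsDistribution T) {ι : Type*} {g : ι → TestFn}
    {u : ℝ} (hu : 0 < u) (h0 : ∀ i x, u < |x| → g i x = 0)
    (hs : ∀ m, Summable fun i => testNorm m (g i)) {f : TestFn} (hf : ∀ x, f x = ∑' i, g i x) :
    HasSum (fun i => T (g i)) (T f) := by
  obtain ⟨m, c, hc, H⟩ := hT u hu
  have hd := iteratedDeriv_tsum_of_summable (fun i => (g i).smooth) hs fun k i x =>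
    norm_iteratedDeriv_le_testNorm (g i).smooth (g i).hasCompactSupport le_rfl x
  have hf' : (f : ℝ → ℂ) = fun x => ∑' i, g i x := funext hf
  -- On the common support the order of `T` is finite, so `T` of the remainder is controlled by the
  -- tail of the series of norms.
  have hT' : ∀ S : Finset ι, ‖∑ i ∈ S, T (g i) - T f‖ ≤
      c * ((m + 1) * (∑' i, testNorm m (g i) - ∑ i ∈ S, testNorm m (g i))) := by
    intro S
    set G : TestFn := ∑ i ∈ S, g i with hG
    have hG' : (G : ℝ → ℂ) = fun x => ∑ i ∈ S, g i x := funext fun x => TestFn.coe_sum S g x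
    have hfz : ∀ x, u < |x| → f x = 0 := fun x hx => by simp [hf, h0 _ x hx]
    have hz : ∀ x, u < |x| → (f - G : TestFn) x = 0 := fun x hx => by
      change f x - G x = 0
      rw [hfz x hx, hG']
      simp [h0 _ x hx]
    have h1 := H (f - G) (tsupport_subset_iff.2 hz)
    rw [← map_sum, norm_sub_rev, ← map_sub]
    refine h1.trans (mul_le_mul_of_nonneg_left ?_ hc.le)
    have h2 : 0 ≤ ∑' i, testNorm m (g i) - ∑ i ∈ S, testNorm m (g i) :=
      sub_nonneg.2 ((hs m).sum_le_tsum S fun i _ => testNorm_nonneg m _)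
    refine testNorm_le h2 fun k hk x => ?_
    have e : iteratedDeriv k (f - G : TestFn) x =
        ∑' i, iteratedDeriv k (g i) x - ∑ i ∈ S, iteratedDeriv k (g i) x := by
      change iteratedDeriv k (fun x => f x - G x) x = _
      rw [iteratedDeriv_fun_sub (f.smooth.of_le (mod_cast le_top)).contDiffAt
        (G.smooth.of_le (mod_cast le_top)).contDiffAt, hf', hd, hG', iteratedDeriv_fun_sum fun i _ =>
        ((g i).smooth.of_le (mod_cast le_top)).contDiffAt]
    rw [e]
    exact norm_tsum_sub_sum_le (hs m) (fun i => norm_iteratedDeriv_le_testNorm (g i).smooth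
      (g i).hasCompactSupport hk x) S
  rw [HasSum, tendsto_iff_norm_sub_tendsto_zero]
  refine squeeze_zero (fun _ => norm_nonneg _) hT' ?_
  have h3 : Filter.Tendsto (fun S : Finset ι => ∑' i, testNorm m (g i) - ∑ i ∈ S, testNorm m (g i))
      Filter.atTop (𝓝 0) := by
    have := (hs m).hasSum.const_sub (∑' i, testNorm m (g i))
    simpa using this
  simpa using (h3.const_mul (m + 1 : ℝ)).const_mul c

/-! ### Fourier expansion of quasi-periodic distributions on `ℝ` -/

/-- The test function `ψ(x) e^{-2πilx}`, with `ψ` the bump function of period `p`. -/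
noncomputable def bumpTest {p : ℝ} (hp : 0 < p) (l : ℝ) : TestFn :=
  mkTest (modulate l (bump p)) (contDiff_modulate l (contDiff_bump p)) (p + 1)
    (modulate_zero l (bump_zero hp))

/-- The sequence of Fourier coefficients of a quasi-periodic distribution. -/
noncomputable def fourierCoeffs (T : TestFn →ₗ[ℂ] ℂ) {p : ℝ} (hp : 0 < p) (L : Set ℝ) (l : L) : ℂ :=
  1 / p * T (bumpTest hp l)

lemma isShiftedLattice_range (a : ℝ) {p : ℝ} (hp : 0 < p) :
    IsShiftedLattice (Set.range fun n : ℤ => a - n / p) := by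
  refine ⟨a, -(1 / p), neg_ne_zero.2 (by positivity), ?_⟩
  congr 1
  funext n
  ring

lemma fourierCoeffs_mem {T : TestFn →ₗ[ℂ] ℂ} (hT : IsDistribution T) (a : ℝ) {p : ℝ} (hp : 0 < p) :
    fourierCoeffs T hp (Set.range fun n : ℤ => a - n / p) ∈ polyGrowth _ := by
  rw [mem_polyGrowth_iff (isShiftedLattice_range a hp)]
  obtain ⟨m, c, hc, H⟩ := hT (p + 1) (by positivity)
  obtain ⟨C, hC, K⟩ := testNorm_modulate_le m (contDiff_bump p) (hasCompactSupport_of_abs (bump_zero hp))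
  refine ⟨m, 1 / p * (c * C), by positivity, fun l => ?_⟩
  have hp1 : ‖(1 / p : ℂ)‖ = 1 / p := by
    rw [norm_div, norm_one, Complex.norm_real, Real.norm_of_nonneg hp.le]
  rw [fourierCoeffs, norm_mul, hp1, mul_assoc, mul_assoc]
  refine mul_le_mul_of_nonneg_left ?_ (by positivity)
  refine (H _ (tsupport_subset_iff.2 (modulate_zero l (bump_zero hp)))).trans ?_
  exact mul_le_mul_of_nonneg_left (K l) hc.le

lemma fourierT_bumpTest (a : ℝ) {p : ℝ} (hp : 0 < p) (m n : ℤ) :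
    fourierT (bumpTest hp (a - m / p)) (a - n / p) = if n = m then (p : ℂ) else 0 := by
  have h1 : fourierT (bumpTest hp (a - m / p)) (a - n / p) = fourierT (bump p) ((m - n : ℤ) / p) := by
    refine (fourierT_modulate _ _ _).trans ?_
    congr 1
    push_cast
    ring
  rw [h1, fourierT_bump hp]
  congr 1
  rw [sub_eq_zero]
  exact propext eq_comm

/-- The Fourier coefficients are determined by the Fourier series. -/
lemma eq_zero_of_fourierSeries_eq_zero {L : Set ℝ} (hL : IsShiftedLattice L) {α : L → ℂ}
    (h : ∀ f, fourierSeries α f = 0) : α = 0 := by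
  obtain ⟨a, p, hp, rfl⟩ := hL.exists_pos
  funext ⟨_, m, rfl⟩
  have h1 := h (bumpTest hp (a - m / p))
  -- The modulated bump is orthogonal to all frequencies of the lattice except its own, so it
  -- isolates one coefficient.
  rw [fourierSeries, ← (latticeEquiv a hp).tsum_eq, tsum_eq_single m fun n hn => ?_] at h1
  · rw [latticeEquiv_apply, fourierT_bumpTest, if_pos rfl] at h1
    exact (mul_eq_zero.1 h1).resolve_right (by exact_mod_cast hp.ne')
  · rw [latticeEquiv_apply, fourierT_bumpTest, if_neg hn, mul_zero]

/-- The integers in `[-K, K)`. -/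
noncomputable def intBox (K : ℕ) : Finset ℤ := (Finset.range (2 * K)).image fun j : ℕ => (j : ℤ) - K

lemma notMem_intBox {K : ℕ} {k : ℤ} (h : k ∉ intBox K) : k < -K ∨ K ≤ k := by
  by_contra hc
  rw [not_or, not_lt, not_le] at hc
  refine h (Finset.mem_image.2 ⟨(k + K).toNat, Finset.mem_range.2 (by omega), by omega⟩)

/-- Telescoping; the half-open box `[-K, K)` is what makes the end terms come out as `±K`. -/
lemma sum_bump (p : ℝ) (K : ℕ) (x : ℝ) :
    ∑ k ∈ intBox K, bump p (x + k * p) = step (x + K * p) - step (x - K * p) := by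
  rw [intBox, Finset.sum_image fun i _ j _ h => by simpa using h]
  have := Finset.sum_range_sub (fun j : ℕ => step (x + (j - K) * p)) (2 * K)
  rw [show step (x + K * p) = step (x + ((2 * K : ℕ) - K) * p) by push_cast; ring_nf,
    show step (x - K * p) = step (x + ((0 : ℕ) - K) * p) by push_cast; ring_nf, ← this]
  refine Finset.sum_congr rfl fun j _ => ?_
  rw [bump]
  push_cast
  congr 2
  ring

lemma mul_mem_dualLattice (a : ℝ) {p : ℝ} (hp : 0 < p) (k : ℤ) :
    (k * p : ℝ) ∈ dualLattice (Set.range fun n : ℤ => a - n / p) := by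
  rintro _ ⟨m, rfl⟩ _ ⟨n, rfl⟩
  refine ⟨(n - m) * k, ?_⟩
  push_cast
  field_simp
  ring

/-- The partition of unity cuts `f` into pieces, and quasi-periodicity moves all pieces to the
support of one bump. Thus `T f = T G`, where `G` is the bump times the quasi-periodization of `f`.
Poisson summation expands the latter in characters, and `T` may be applied term by term. -/
lemma fourierCoeffs_series {a p : ℝ} (hp : 0 < p) {T : TestFn →ₗ[ℂ] ℂ}
    (hT : IsQuasiPeriodic (Set.range fun n : ℤ => a - n / p) T) (f : TestFn) :
    T f = fourierSeries (fourierCoeffs T hp (Set.range fun n : ℤ => a - n / p)) f := by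
  obtain ⟨u, hu, h0⟩ := f.exists_bound
  -- Large enough that the translates in the box sum to `1` on the support of `f`, and that `f(x -
  -- kp) = 0` on the support of the bump for `k` outside the box.
  obtain ⟨K, hK⟩ := exists_nat_ge ((u + 1 + p) / p)
  rw [div_le_iff₀ hp] at hK
  set e : ℤ → ℂ := fun k => Complex.exp (-(2 * Real.pi * Complex.I * a * (k * p : ℝ))) with he
  have hsh : ∀ k : ℤ, ContDiff ℝ ∞ fun x => f (x - k * p) := fun k =>
    f.smooth.comp (contDiff_id.sub contDiff_const)
  set g : ℤ → TestFn := fun k => mkTest (fun x => bump p x * f (x - k * p))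
    ((contDiff_bump p).mul (hsh k)) (p + 1) fun x hx => by rw [bump_zero hp x hx, zero_mul] with hg
  set G : TestFn := ∑ k ∈ intBox K, e k • g k with hG
  have hTG : T f = T G := by
    have h1 : f = ∑ k ∈ intBox K, shift (k * p) (g k) := by
      ext x
      rw [TestFn.coe_sum]
      have h2 : ∀ k : ℤ, shift (k * p) (g k) x = bump p (x + k * p) * f x := fun k => by
        change bump p (x + k * p) * f (x + k * p - k * p) = _
        rw [add_sub_cancel_right]
      simp only [h2]
      rw [← Finset.sum_mul, sum_bump]
      by_cases hx : u < |x|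
      · rw [h0 x hx, mul_zero]
      · obtain ⟨h3, h4⟩ := abs_le.1 (not_lt.1 hx)
        rw [step_one (by linarith), step_zero (by linarith), sub_zero, one_mul]
    rw [h1, map_sum, hG, map_sum]
    refine Finset.sum_congr rfl fun k _ => ?_
    rw [hT.2 _ (mul_mem_dualLattice a hp k) a ⟨0, by simp⟩, map_smul]
    rfl
  have hGx : ∀ x, G x = ∑' n : ℤ, (1 / p * fourierT f (a - n / p)) * bumpTest hp (a - n / p) x := by
    intro x
    have h1 : G x = bump p x * ∑ k ∈ intBox K, e k * f (x - k * p) := by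
      rw [hG, TestFn.coe_sum, Finset.mul_sum]
      refine Finset.sum_congr rfl fun k _ => ?_
      change e k * (bump p x * f (x - k * p)) = _
      ring
    have h2 : ∀ n : ℤ, (1 / p * fourierT f (a - n / p)) * bumpTest hp (a - n / p) x = bump p x *
        (1 / p * fourierT f (a - n / p) * Complex.exp (-(2 * Real.pi * Complex.I * (a - n / p : ℝ) * x))) := by
      intro n
      rw [bumpTest, mkTest_apply, modulate]
      ring
    simp only [h2]
    rw [tsum_mul_left, ← poisson f a hp x, h1]
    by_cases hx : 1 < x ∨ x < -p
    · rw [bump_zero_of_lt hp hx, zero_mul, zero_mul]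
    · rw [not_or, not_lt, not_lt] at hx
      rw [tsum_eq_sum (s := intBox K) fun k hk => ?_]
      rw [h0, mul_zero]
      rcases notMem_intBox hk with h | h
      · have h3 : (k : ℝ) * p ≤ -K * p := mul_le_mul_of_nonneg_right (by exact_mod_cast h.le) hp.le
        exact lt_abs.2 (Or.inl (by nlinarith [hx.2]))
      · have h3 : (K : ℝ) * p ≤ k * p := mul_le_mul_of_nonneg_right (by exact_mod_cast h) hp.le
        exact lt_abs.2 (Or.inr (by nlinarith [hx.1]))
  set L := Set.range fun n : ℤ => a - n / p with hL
  set h : L → TestFn := fun l => (1 / p * fourierT f l : ℂ) • bumpTest hp l with hh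
  have hGh : ∀ x, G x = ∑' l, h l x := fun x => by
    rw [hGx, ← (latticeEquiv a hp).tsum_eq]
    rfl
  have hs : ∀ m, Summable fun l => testNorm m (h l) := by
    intro m
    obtain ⟨C, hC, H⟩ := testNorm_modulate_le m (contDiff_bump p) (hasCompactSupport_of_abs (bump_zero hp))
    obtain ⟨D, hD, H'⟩ := norm_fourierT_mul_one_add_pow_le (m + 2) hu
    refine Summable.of_nonneg_of_le (fun l => testNorm_nonneg _ _) (fun l => ?_)
      ((isShiftedLattice_range a hp).summable.mul_left ((m + 1) * (1 / p * (D * testNorm (m + 2) f) * C)))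
    have h1 := H' f f.smooth h0 l
    have h2 := H l
    have h3 : 0 < 1 + |(l : ℝ)| := by positivity
    refine (testNorm_smul_le m _ _).trans ?_
    rw [mul_assoc]
    refine mul_le_mul_of_nonneg_left ?_ (by positivity)
    rw [← div_eq_mul_inv, le_div_iff₀ (by positivity), norm_mul, norm_div, norm_one, Complex.norm_real,
      Real.norm_of_nonneg hp.le]
    calc 1 / p * ‖fourierT f l‖ * testNorm m (bumpTest hp l) * (1 + |(l : ℝ)|) ^ 2
        ≤ 1 / p * ‖fourierT f l‖ * (C * (1 + |(l : ℝ)|) ^ m) * (1 + |(l : ℝ)|) ^ 2 := by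
          gcongr
          exact h2
      _ = 1 / p * (‖fourierT f l‖ * (1 + |(l : ℝ)|) ^ (m + 2)) * C := by ring
      _ ≤ _ := by gcongr
  have h1 := hT.1.hasSum (u := p + 1) (by positivity) (g := h) (fun l x hx => by
    change _ * modulate l (bump p) x = 0
    rw [modulate_zero l (bump_zero hp) x hx, mul_zero]) hs hGh
  rw [hTG, fourierSeries, ← h1.tsum_eq]
  refine tsum_congr fun l => ?_
  rw [hh, map_smul, fourierCoeffs, smul_eq_mul]
  ring

/-! ### Distributions supported at the origin -/

lemma contDiff_taylorPoly (N : ℕ) (G : ℝ → ℂ) : ContDiff ℝ ∞ (taylorPoly N G) := by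
  have hx : ContDiff ℝ ∞ fun x : ℝ => (x : ℂ) := Complex.ofRealCLM.contDiff
  exact ContDiff.sum fun k _ => contDiff_const.mul (hx.pow k)

lemma iteratedDeriv_taylorPoly (j : ℕ) : ∀ (N : ℕ) (G : ℝ → ℂ), j < N →
    iteratedDeriv j (taylorPoly N G) 0 = iteratedDeriv j G 0 := by
  induction j with
  | zero =>
    intro N G h
    obtain ⟨N, rfl⟩ := Nat.exists_eq_succ_of_ne_zero h.ne'
    rw [iteratedDeriv_zero, iteratedDeriv_zero, taylorPoly, Finset.sum_range_succ']
    simp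
  | succ j ih =>
    intro N G h
    obtain ⟨N, rfl⟩ := Nat.exists_eq_succ_of_ne_zero (by omega : N ≠ 0)
    rw [iteratedDeriv_succ', iteratedDeriv_succ', ← ih N (deriv G) (by omega)]
    congr 1
    funext x
    exact (hasDerivAt_taylorPoly N G x).deriv

lemma iteratedDeriv_pow_zero (j : ℕ) : ∀ k : ℕ, iteratedDeriv j (fun x : ℝ => (x : ℂ) ^ k) 0 =
    if j = k then (k.factorial : ℂ) else 0 := by
  induction j with
  | zero =>
    intro k
    rcases k with _ | k <;> simp
  | succ j ih =>
    intro k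
    rcases k with _ | k
    · simp [iteratedDeriv_succ']
    · have h : deriv (fun x : ℝ => (x : ℂ) ^ (k + 1)) =
          fun x : ℝ => ((k + 1 : ℕ) : ℂ) * (x : ℂ) ^ k := by
        funext x
        have := (hasDerivAt_pow (k + 1) (x : ℂ)).comp_ofReal.deriv
        simpa using this
      rw [iteratedDeriv_succ', h, iteratedDeriv_const_mul_field, ih, Nat.factorial_succ]
      by_cases hjk : j = k <;> simp [hjk]

/-- The function `χ(x / ε) f(x)` with the cutoff function `χ`. -/
noncomputable def localize {ε : ℝ} (hε : 0 < ε) (f : ℝ → ℂ) (hf : ContDiff ℝ ∞ f) : TestFn :=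
  mkTest (fun x => cutoff (ε⁻¹ * x) * f x)
    ((contDiff_cutoff.comp (contDiff_const.mul contDiff_id)).mul hf) (2 * ε) fun x hx => by
      rw [cutoff_zero, zero_mul]
      rw [abs_mul, abs_of_pos (inv_pos.2 hε), inv_mul_eq_div, le_div_iff₀ hε]
      exact hx.le

lemma localize_eq {ε : ℝ} (hε : 0 < ε) {f : ℝ → ℂ} (hf : ContDiff ℝ ∞ f) {x : ℝ} (hx : |x| ≤ ε) :
    localize hε f hf x = f x := by
  rw [localize, mkTest_apply, cutoff_one, one_mul]
  rw [abs_mul, abs_of_pos (inv_pos.2 hε), inv_mul_eq_div]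
  exact (div_le_one hε).2 hx

/-- Each derivative that hits the cutoff costs `ε⁻¹`, while `R = O(ε^N)` on its support `|x| ≤ 2ε`;
a derivative that hits `R` lowers `N` by one. So `χ`, `R` and `N` all vary in the induction. -/
lemma norm_iteratedDeriv_localize_le (k : ℕ) : ∀ (N : ℕ), k ≤ N → ∀ χ : ℝ → ℂ, ContDiff ℝ ∞ χ →
    (∀ x, 2 < |x| → χ x = 0) → ∀ R : ℝ → ℂ, ContDiff ℝ ∞ R → (∀ j < N, iteratedDeriv j R 0 = 0) →
      ∃ C : ℝ, 0 ≤ C ∧ ∀ ε : ℝ, 0 < ε → ε ≤ 1 → ∀ x,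
        ‖iteratedDeriv k (fun x => χ (ε⁻¹ * x) * R x) x‖ ≤ C * ε ^ (N - k) := by
  induction k with
  | zero =>
    intro N _ χ hχ h0 R hR hz
    obtain ⟨B, hB⟩ := (isCompact_Icc (a := -2) (b := (2 : ℝ))).exists_bound_of_continuousOn
      (contDiff_iteratedDeriv hR N).continuous.continuousOn
    have hT : ∀ x, taylorPoly N R x = 0 := fun x =>
      Finset.sum_eq_zero fun j hj => by rw [hz j (Finset.mem_range.1 hj), zero_div, zero_mul]
    have hA := testNorm_nonneg 0 χ
    have hB0 : 0 ≤ B := (norm_nonneg _).trans (hB 0 (by simp))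
    refine ⟨testNorm 0 χ * (B * 2 ^ N), by positivity, fun ε hε hε1 x => ?_⟩
    rw [iteratedDeriv_zero]
    by_cases hx : |x| ≤ 2 * ε
    · have h1 := norm_sub_taylorPoly_le N hR (r := 2) (fun y hy => hB y (abs_le.1 hy)) x (by linarith)
      rw [hT, sub_zero] at h1
      rw [norm_mul, mul_assoc, mul_assoc, Nat.sub_zero, ← mul_pow]
      refine mul_le_mul (norm_le_testNorm hχ (hasCompactSupport_of_abs h0) 0 _) (h1.trans ?_)
        (norm_nonneg _) hA
      gcongr
    · rw [h0, zero_mul, norm_zero]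
      · positivity
      · rw [abs_mul, abs_of_pos (inv_pos.2 hε), inv_mul_eq_div, lt_div_iff₀ hε]
        exact not_le.1 hx
  | succ k ih =>
    intro N hkN χ hχ h0 R hR hz
    have h1 : ∀ x, 2 < |x| → deriv χ x = 0 := fun x hx => by
      rw [(eventually_zero_of_lt_abs h0 hx).deriv_eq]
      simp
    obtain ⟨C, hC, H⟩ := ih N (by omega) (deriv χ) (contDiff_deriv hχ) h1 R hR hz
    obtain ⟨D, hD, K⟩ := ih (N - 1) (by omega) χ hχ h0 (deriv R) (contDiff_deriv hR) fun j hj => by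
      rw [← iteratedDeriv_succ']
      exact hz _ (by omega)
    refine ⟨C + D, by positivity, fun ε hε hε1 x => ?_⟩
    have hs : ∀ {f g : ℝ → ℂ}, ContDiff ℝ ∞ f → ContDiff ℝ ∞ g → ContDiff ℝ ∞ fun x => f (ε⁻¹ * x) * g x :=
      fun hf hg => (hf.comp (contDiff_const.mul contDiff_id)).mul hg
    have hd : deriv (fun x => χ (ε⁻¹ * x) * R x) = fun x => ((ε⁻¹ : ℝ) : ℂ) * (deriv χ (ε⁻¹ * x) * R x) +
        χ (ε⁻¹ * x) * deriv R x := by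
      funext x
      have h2 : HasDerivAt (fun x => χ (ε⁻¹ * x)) ((ε⁻¹ : ℝ) • deriv χ (ε⁻¹ * x)) x := by
        have := (hasDerivAt_of_smooth hχ (ε⁻¹ * x)).scomp x ((hasDerivAt_id x).const_mul ε⁻¹)
        rw [mul_one] at this
        exact this
      refine (h2.fun_mul (hasDerivAt_of_smooth hR x)).deriv.trans ?_
      rw [Complex.real_smul]
      ring
    have h3 : ContDiff ℝ ∞ fun x => ((ε⁻¹ : ℝ) : ℂ) * (deriv χ (ε⁻¹ * x) * R x) :=
      contDiff_const.mul (hs (contDiff_deriv hχ) hR)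
    rw [iteratedDeriv_succ', hd, iteratedDeriv_fun_add (h3.of_le (mod_cast le_top)).contDiffAt
      ((hs hχ (contDiff_deriv hR)).of_le (mod_cast le_top)).contDiffAt, iteratedDeriv_const_mul_field]
    refine (norm_add_le _ _).trans ?_
    rw [norm_mul, Complex.norm_real, Real.norm_of_nonneg (inv_pos.2 hε).le, add_mul]
    refine add_le_add ?_ ?_
    · refine (mul_le_mul_of_nonneg_left (H ε hε hε1 x) (inv_pos.2 hε).le).trans (le_of_eq ?_)
      rw [show N - k = N - (k + 1) + 1 by omega, pow_succ]
      field_simp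
    · rw [show N - (k + 1) = N - 1 - k by omega]
      exact K ε hε hε1 x

/-- A distribution vanishing on all functions that vanish near the origin is a combination of
derivatives of the Dirac distribution. -/
lemma IsDistribution.eq_sum_deltaDeriv {T : TestFn →ₗ[ℂ] ℂ} (hT : IsDistribution T)
    (h : ∀ f : TestFn, (∃ ε : ℝ, 0 < ε ∧ ∀ x, |x| < ε → f x = 0) → T f = 0) :
    ∃ β : ℕ →₀ ℂ, ∀ f, T f = β.sum fun m b => b * deltaDeriv m f := by
  obtain ⟨m, c, hc, H⟩ := hT 2 two_pos
  have heq : ∀ f g : TestFn, (∃ ε : ℝ, 0 < ε ∧ ∀ x, |x| < ε → f x = g x) → T f = T g := by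
    rintro f g ⟨ε, hε, hfg⟩
    have := h (f - g) ⟨ε, hε, fun x hx => sub_eq_zero.2 (hfg x hx)⟩
    rw [map_sub] at this
    exact sub_eq_zero.1 this
  -- `T` has order `m` on functions supported in `[-2, 2]`. Its value only depends on the germ at
  -- `0`, so the cutoff scale `ε` may shrink; flatness to order `m + 1` leaves a factor `ε`, and the
  -- value is `0`.
  have hflat : ∀ (R : ℝ → ℂ) (hR : ContDiff ℝ ∞ R), (∀ j < m + 1, iteratedDeriv j R 0 = 0) →
      T (localize one_pos R hR) = 0 := by
    intro R hR hz
    choose C hC K using fun k : Fin (m + 1) => norm_iteratedDeriv_localize_le k (m + 1) k.2.le cutoff contDiff_cutoff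
      (fun x hx => cutoff_zero hx.le) R hR hz
    set S := ∑ k, C k with hS
    have hS0 : 0 ≤ S := Finset.sum_nonneg fun k _ => hC k
    have hb : ∀ ε : ℝ, 0 < ε → ε ≤ 1 → ‖T (localize one_pos R hR)‖ ≤ c * ((m + 1) * S) * ε := by
      intro ε hε hε1
      rw [heq _ (localize hε R hR) ⟨ε, hε, fun x hx => by
        rw [localize_eq hε hR hx.le, localize_eq one_pos hR (hx.le.trans hε1)]⟩]
      have h1 := H (localize hε R hR) (tsupport_subset_iff.2 fun x hx => by
        rw [localize, mkTest_apply, cutoff_zero, zero_mul]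
        rw [abs_mul, abs_of_pos (inv_pos.2 hε), inv_mul_eq_div, le_div_iff₀ hε]
        nlinarith)
      refine h1.trans ?_
      rw [mul_assoc, mul_assoc]
      refine mul_le_mul_of_nonneg_left (testNorm_le (by positivity) fun k hk x => ?_) hc.le
      refine (K ⟨k, by omega⟩ ε hε hε1 x).trans ?_
      refine mul_le_mul (Finset.single_le_sum (f := C) (fun i _ => hC i) (Finset.mem_univ _)) ?_ (by positivity) hS0
      rw [show m + 1 - k = (m - k) + 1 by omega, pow_succ]
      exact mul_le_of_le_one_left hε.le (pow_le_one₀ hε.le hε1)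
    have h2 : Filter.Tendsto (fun ε : ℝ => c * ((m + 1) * S) * ε) (𝓝[>] 0) (𝓝 0) := by
      have : Filter.Tendsto (fun ε : ℝ => c * ((m + 1) * S) * ε) (𝓝 0) (𝓝 (c * ((m + 1) * S) * 0)) :=
        (continuous_const.mul continuous_id).tendsto 0
      rw [mul_zero] at this
      exact this.mono_left nhdsWithin_le_nhds
    refine norm_le_zero_iff.1 (ge_of_tendsto h2 ?_)
    filter_upwards [Ioc_mem_nhdsGT (zero_lt_one' ℝ)] with ε hε using hb ε hε.1 hε.2
  have hx : ∀ k : ℕ, ContDiff ℝ ∞ fun x : ℝ => (x : ℂ) ^ k := fun k => Complex.ofRealCLM.contDiff.pow k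
  set b : ℕ → ℂ := fun k => if k < m + 1 then (-1) ^ k / k.factorial * T (localize one_pos _ (hx k)) else 0 with hb
  refine ⟨Finsupp.onFinset (Finset.range (m + 1)) b fun k hk => ?_, fun f => ?_⟩
  · by_contra hk'
    exact hk (if_neg fun h => hk' (Finset.mem_range.2 h))
  · rw [Finsupp.onFinset_sum _ fun _ => zero_mul _]
    have hR : ContDiff ℝ ∞ fun x => f x - taylorPoly (m + 1) f x := f.smooth.sub (contDiff_taylorPoly _ _)
    -- Near `0`, `f` is its Taylor polynomial plus a remainder flat to order `m + 1`; only the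
    -- monomials contribute.
    have h1 : T f = T (localize one_pos _ hR + ∑ k ∈ Finset.range (m + 1),
        (iteratedDeriv k f 0 / k.factorial) • localize one_pos _ (hx k)) := by
      refine heq _ _ ⟨1, one_pos, fun x hx1 => ?_⟩
      change f x = localize one_pos _ hR x + (∑ k ∈ Finset.range (m + 1),
        (iteratedDeriv k f 0 / k.factorial) • localize one_pos _ (hx k) : TestFn) x
      rw [TestFn.coe_sum, localize_eq one_pos hR hx1.le]
      have h2 : ∑ k ∈ Finset.range (m + 1), ((iteratedDeriv k f 0 / k.factorial) •
          localize one_pos _ (hx k) : TestFn) x = taylorPoly (m + 1) f x := by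
        refine Finset.sum_congr rfl fun k _ => ?_
        change _ * localize one_pos _ (hx k) x = _
        rw [localize_eq one_pos (hx k) hx1.le]
      rw [h2, sub_add_cancel]
    rw [h1, map_add, hflat _ hR fun j hj => ?_, zero_add, map_sum]
    · refine Finset.sum_congr rfl fun k hk => ?_
      rw [map_smul, smul_eq_mul, hb, deltaDeriv]
      simp only
      rw [if_pos (Finset.mem_range.1 hk)]
      have : ((-1 : ℂ) ^ k) * (-1) ^ k = 1 := by rw [← mul_pow]; simp
      linear_combination (-(iteratedDeriv k f 0 / k.factorial * T (localize one_pos _ (hx k)))) * this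
    · rw [iteratedDeriv_fun_sub (f.smooth.of_le (mod_cast le_top)).contDiffAt
        ((contDiff_taylorPoly _ _).of_le (mod_cast le_top)).contDiffAt, iteratedDeriv_taylorPoly j _ _ hj, sub_self]

/-- The derivatives of the Dirac distribution are linearly independent. -/
lemma eq_zero_of_sum_deltaDeriv {β : ℕ →₀ ℂ}
    (h : ∀ f, (β.sum fun m b => b * deltaDeriv m f) = 0) : β = 0 := by
  ext k
  have hx : ContDiff ℝ ∞ fun x : ℝ => (x : ℂ) ^ k := Complex.ofRealCLM.contDiff.pow k
  -- Localized monomials form a dual family: on `x^k` only the `k`-th derivative at `0` is nonzero.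
  have h1 := h (localize one_pos _ hx)
  have h2 : ∀ j, deltaDeriv j (localize one_pos _ hx) = if j = k then (-1) ^ k * (k.factorial : ℂ) else 0 := by
    intro j
    have : (localize one_pos _ hx : ℝ → ℂ) =ᶠ[𝓝 0] fun x => (x : ℂ) ^ k := by
      filter_upwards [Metric.ball_mem_nhds (0 : ℝ) one_pos] with x hx1
      refine localize_eq one_pos hx ?_
      simpa using (Metric.mem_ball.1 hx1).le
    rw [deltaDeriv, (iteratedDeriv_congr_of_eventuallyEq this j).eq_of_nhds, iteratedDeriv_pow_zero]
    split_ifs with hj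
    · rw [hj]
    · rw [mul_zero]
  simp only [h2, mul_ite, mul_zero] at h1
  rw [Finsupp.sum_ite_eq'] at h1
  have hk : (-1 : ℂ) ^ k * (k.factorial : ℂ) ≠ 0 :=
    mul_ne_zero (pow_ne_zero _ (by norm_num)) (by exact_mod_cast k.factorial_ne_zero)
  split_ifs at h1 with hm
  · exact (mul_eq_zero.1 h1).resolve_right hk
  · exact Finsupp.notMem_support_iff.1 hm

/-! ### The functionals `λ_{α,β}` -/

/-- The linear functional given by a function that respects the combinations `a • f + g`. -/
def linearOfAddSmul {V : Type*} [AddCommGroup V] [Module ℂ V] (T : V → ℂ)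
    (h : ∀ (a : ℂ) (f g : V), T (a • f + g) = a * T f + T g) : V →ₗ[ℂ] ℂ :=
  have h0 : T 0 = 0 := by
    have := h 1 0 0
    rw [smul_zero, zero_add] at this
    linear_combination -this
  { toFun := T
    map_add' := fun f g => by
      have := h 1 f g
      rwa [one_smul, one_mul] at this
    map_smul' := fun a f => by
      have := h a f 0
      rwa [add_zero, h0, add_zero] at this }

lemma deltaInf_add_smul {μ ν : ℂ} (m : ℕ) (a : ℂ) (F G : PSeries μ ν) :
    deltaInf μ m (a • F + G : PSeries μ ν) = a * deltaInf μ m F + deltaInf μ m G := by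
  have hs : ∀ F : PSeries μ ν, ContDiff ℝ ∞ (stdChart ν (angInvol μ (ang F))) := fun F =>
    contDiff_chart ν _ (IsQP.invol (PSeries.isQP F.2)).1
  have e : stdChart ν (angInvol μ (ang (a • F + G : PSeries μ ν))) = fun x =>
      a * stdChart ν (angInvol μ (ang F)) x + stdChart ν (angInvol μ (ang G)) x := by
    funext x
    change _ * (_ * (a * (F : Cover → ℂ) _ + (G : Cover → ℂ) _)) = _
    simp only [stdChart, chart, angInvol, ang]
    ring
  rw [deltaInf_eq (a • F + G).2, deltaInf_eq F.2, deltaInf_eq G.2, e,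
    iteratedDeriv_fun_add ((contDiff_const.mul (hs F)).of_le (mod_cast le_top)).contDiffAt
      ((hs G).of_le (mod_cast le_top)).contDiffAt, iteratedDeriv_const_mul_field]
  ring

/-- The functional `δ_∞^{(m)}` on `I^∞_{μ,ν}`. -/
noncomputable def deltaInfL (μ ν : ℂ) (m : ℕ) : PSeries μ ν →ₗ[ℂ] ℂ :=
  linearOfAddSmul (fun F => deltaInf μ m F) (deltaInf_add_smul m)

lemma eq_iota_add {μ ν : ℂ} (F : PSeries μ ν) :
    F = iota μ ν (partFst ν (ang F) (PSeries.isQP F.2).1) +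
      involL μ ν (iota μ ν (partSnd μ ν (ang F) (PSeries.isQP F.2).1)) :=
  Subtype.ext (isPartition_part F.2).symm

lemma isPSDistribution_deltaInfL (μ ν : ℂ) (m : ℕ) : IsPSDistribution (deltaInfL μ ν m) := by
  obtain ⟨n, C, hC, H⟩ := testNorm_partSnd_le μ ν m
  refine (isPSDistribution_iff _).2 ⟨n, C, fun F => ?_⟩
  have hF : ContDiff ℝ ∞ (ang (F : Cover → ℂ)) := (PSeries.isQP F.2).1
  have e : deltaInfL μ ν m F = deltaDeriv m (partSnd μ ν _ hF) := by
    conv_lhs => rw [eq_iota_add F]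
    rw [map_add]
    change deltaInf μ m (iotaFun μ ν _) + deltaInf μ m (invol μ (iotaFun μ ν _)) = _
    rw [deltaInf_iota, deltaInf_invol_iota, zero_add]
  rw [e, deltaDeriv, norm_mul, norm_pow, norm_neg, norm_one, one_pow, one_mul]
  exact (norm_iteratedDeriv_le_testNorm (partSnd μ ν _ hF).smooth (partSnd μ ν _ hF).hasCompactSupport
    le_rfl 0).trans (H _ hF)

/-- The functional `F ↦ ∑ α(l) J_l(F)`. -/
noncomputable def jacquetSeries (μ ν : ℂ) {L : Set ℝ} (hL : IsShiftedLattice L) (α : polyGrowth L) :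
    PSeries μ ν →ₗ[ℂ] ℂ :=
  linearOfAddSmul (fun F => ∑' l : L, α.1 l * jacquet μ ν l F) fun a F G => by
    have h := (jacquet_series hL μ ν α.2).1
    rw [← tsum_mul_left, ← ((h F).mul_left a).tsum_add (h G)]
    refine tsum_congr fun l => ?_
    rw [jacquet_add_smul]
    ring

/-- The map `(α, β) ↦ λ_{α,β}`, with values in the linear functionals on `I^∞_{μ,ν}`. -/
noncomputable def expansionL (μ ν : ℂ) {L : Set ℝ} (hL : IsShiftedLattice L) :
    (polyGrowth L × (ℕ →₀ ℂ)) →ₗ[ℂ] (PSeries μ ν →ₗ[ℂ] ℂ) :=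
  LinearMap.coprod
    { toFun := jacquetSeries μ ν hL
      map_add' := fun α β => LinearMap.ext fun F => by
        have h := fun α : polyGrowth L => (jacquet_series hL μ ν α.2).1 F
        refine Eq.trans (tsum_congr fun l => ?_) ((h α).tsum_add (h β))
        exact add_mul _ _ _
      map_smul' := fun a α => LinearMap.ext fun F => by
        refine Eq.trans (tsum_congr fun l => ?_) tsum_mul_left
        exact mul_assoc _ _ _ }
    (Finsupp.linearCombination ℂ (deltaInfL μ ν))

lemma expansionL_apply (μ ν : ℂ) {L : Set ℝ} (hL : IsShiftedLattice L) (α : polyGrowth L) (β : ℕ →₀ ℂ)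
    (F : PSeries μ ν) : expansionL μ ν hL (α, β) F = fourierExpansion μ ν α.1 β F := by
  rw [expansionL, LinearMap.coprod_apply, LinearMap.add_apply, Finsupp.linearCombination_apply,
    Finsupp.sum, LinearMap.sum_apply]
  rfl

lemma expansionL_iota (μ ν : ℂ) {L : Set ℝ} (hL : IsShiftedLattice L) (α : polyGrowth L) (β : ℕ →₀ ℂ)
    (f : TestFn) : restr (expansionL μ ν hL (α, β)) f = fourierSeries α.1 f := by
  change expansionL μ ν hL (α, β) (iota μ ν f) = _
  rw [expansionL_apply, fourierExpansion]
  change (∑' l : L, α.1 l * jacquet μ ν l (iotaFun μ ν f)) +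
    (β.sum fun m b => b * deltaInf μ m (iotaFun μ ν f)) = _
  simp only [jacquet_iota, deltaInf_iota, mul_zero]
  rw [Finsupp.sum, Finset.sum_const_zero, add_zero]
  rfl

lemma isPSDistribution_expansionL (μ ν : ℂ) {L : Set ℝ} (hL : IsShiftedLattice L) (α : polyGrowth L)
    (β : ℕ →₀ ℂ) : IsPSDistribution (expansionL μ ν hL (α, β)) := by
  rw [expansionL, LinearMap.coprod_apply, Finsupp.linearCombination_apply]
  refine IsPSDistribution.add ?_ ?_
  · exact (isPSDistribution_iff _).2 (jacquet_series hL μ ν α.2).2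
  · exact Finset.sum_induction _ IsPSDistribution (fun _ _ => IsPSDistribution.add) IsPSDistribution.zero
      fun m _ => (isPSDistribution_deltaInfL μ ν m).smul _

lemma expansionL_mem (μ ν : ℂ) {L : Set ℝ} (hL : IsShiftedLattice L) (x : polyGrowth L × (ℕ →₀ ℂ)) :
    expansionL μ ν hL x ∈ quasiPeriodic μ ν L := by
  obtain ⟨α, β⟩ := x
  have h := isPSDistribution_expansionL μ ν hL α β
  refine ⟨h, isDistribution_restr h, fun t ht l hl f => ?_⟩
  rw [expansionL_iota, expansionL_iota, fourierSeries_shift α.1 ht hl]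

/-! ### Bijectivity -/

/-- If `f` vanishes near `0`, then `ι(f)_∞` is supported away from the point at infinity of the
standard chart, so its standard coordinate has compact support. -/
lemma exists_iota_eq_invol (μ ν : ℂ) {f : TestFn} {ε : ℝ} (hε : 0 < ε) (hf : ∀ x, |x| < ε → f x = 0) :
    ∃ g : TestFn, iota μ ν g = involL μ ν (iota μ ν f) := by
  have hQ : IsQP μ (ang (iotaFun μ ν f)) := PSeries.isQP (iotaFun_mem μ ν f)
  refine ⟨mkTest (stdChart ν (angInvol μ (ang (iotaFun μ ν f)))) (contDiff_chart ν _ hQ.invol.1) (1 / ε)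
    fun x hx => ?_, ?_⟩
  · have hx0 : x ≠ 0 := by
      rintro rfl
      rw [abs_zero] at hx
      exact absurd hx (not_lt.2 (by positivity))
    rw [stdChart_angInvol_eq_fInf ν hQ hx0, stdChart_iota, fInf_of_ne μ ν f hx0, hf, mul_zero, mul_zero]
    rw [abs_div, abs_neg, abs_one]
    exact (one_div_lt hε (abs_pos.2 hx0)).1 hx
  · refine Subtype.ext (PSeries.ext_ang (iotaFun_mem μ ν _) (PSeries.invol_mem (iotaFun_mem μ ν f)) ?_)
    refine IsQP.ext_chart ν (-(Real.pi / 2)) (PSeries.isQP (iotaFun_mem μ ν _))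
      (PSeries.isQP (PSeries.invol_mem (iotaFun_mem μ ν f))) fun x _ => ?_
    have h1 := congrFun (stdChart_iota μ ν (stdChart ν (angInvol μ (ang (iotaFun μ ν f))))) x
    refine h1.trans ?_
    rw [← PSeries.ang_invol (iotaFun_mem μ ν f)]
    rfl

/-- The functional `f ↦ λ(ι(f)_∞)` vanishes on `f` that are `0` near the origin, since these
functions lie in the image of `ι`. So it is a combination of derivatives of the Dirac distribution,
and a partition carries this to all `F`. -/
lemma exists_sum_deltaInf {μ ν : ℂ} {lam : PSeries μ ν →ₗ[ℂ] ℂ} (h : IsPSDistribution lam)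
    (h0 : restr lam = 0) : ∃ β : ℕ →₀ ℂ, lam = Finsupp.linearCombination ℂ (deltaInfL μ ν) β := by
  obtain ⟨β, hβ⟩ := (isDistribution_restr_invol h).eq_sum_deltaDeriv (by
    rintro f ⟨ε, hε, hf⟩
    obtain ⟨g, hg⟩ := exists_iota_eq_invol μ ν hε hf
    change lam (involL μ ν (iota μ ν f)) = 0
    rw [← hg]
    exact LinearMap.congr_fun h0 g)
  refine ⟨β, LinearMap.ext fun F => ?_⟩
  obtain ⟨f₁, f₂, hF⟩ : ∃ f₁ f₂ : TestFn, F = iota μ ν f₁ + involL μ ν (iota μ ν f₂) :=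
    ⟨_, _, eq_iota_add F⟩
  rw [hF, map_add, map_add]
  have h1 : lam (iota μ ν f₁) = 0 := LinearMap.congr_fun h0 f₁
  have h2 : lam (involL μ ν (iota μ ν f₂)) = _ := hβ f₂
  rw [h1, h2, Finsupp.linearCombination_apply, Finsupp.sum, Finsupp.sum, LinearMap.sum_apply,
    LinearMap.sum_apply]
  have h3 : ∀ m, deltaInfL μ ν m (iota μ ν f₁) = 0 := fun m => deltaInf_iota μ ν m f₁
  have h4 : ∀ m, deltaInfL μ ν m (involL μ ν (iota μ ν f₂)) = deltaDeriv m f₂ := fun m =>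
    deltaInf_invol_iota μ ν m f₂
  simp only [LinearMap.smul_apply, h3, h4, smul_eq_mul, mul_zero, Finset.sum_const_zero]

/-- The restriction to the image of `ι` sees only `α`; once `α = 0`, the values on `ι(f)_∞` see only
`β`. -/
lemma expansionL_injective (μ ν : ℂ) {L : Set ℝ} (hL : IsShiftedLattice L) :
    Function.Injective (expansionL μ ν hL) := by
  rw [← LinearMap.ker_eq_bot, LinearMap.ker_eq_bot']
  rintro ⟨α, β⟩ h
  have hα : α = 0 := Subtype.ext (eq_zero_of_fourierSeries_eq_zero hL fun f => by
    rw [← expansionL_iota μ ν hL α β, h]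
    rfl)
  have hβ : β = 0 := eq_zero_of_sum_deltaDeriv fun f => by
    have h1 := LinearMap.congr_fun h (involL μ ν (iota μ ν f))
    rw [hα, expansionL_apply, fourierExpansion] at h1
    have h2 : ∀ m, deltaInf μ m (involL μ ν (iota μ ν f)) = deltaDeriv m f := fun m => deltaInf_invol_iota μ ν m f
    simpa [h2] using h1
  rw [hα, hβ]
  rfl

/-- The Fourier coefficients of `T^λ` give `α`. What remains of `λ` vanishes on the image of `ι`, so
it is accounted for by delta functionals. -/
lemma exists_expansionL_eq {μ ν : ℂ} {L : Set ℝ} (hL : IsShiftedLattice L) {lam : PSeries μ ν →ₗ[ℂ] ℂ}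
    (h : lam ∈ quasiPeriodic μ ν L) : ∃ x, expansionL μ ν hL x = lam := by
  obtain ⟨a, p, hp, hLp⟩ := hL.exists_pos
  subst hLp
  set α : polyGrowth _ := ⟨_, fourierCoeffs_mem h.2.1 a hp⟩ with hα
  have h0 : restr (lam - expansionL μ ν hL (α, 0)) = 0 := by
    ext f
    change restr lam f - restr (expansionL μ ν hL (α, 0)) f = 0
    rw [expansionL_iota, fourierCoeffs_series hp h.2 f, sub_self]
  have h1 : IsPSDistribution (lam - expansionL μ ν hL (α, 0)) :=
    ((quasiPeriodic μ ν _).sub_mem h (expansionL_mem μ ν hL (α, 0))).1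
  obtain ⟨β, hβ⟩ := exists_sum_deltaInf h1 h0
  refine ⟨(α, β), ?_⟩
  rw [sub_eq_iff_eq_add] at hβ
  rw [hβ, expansionL, LinearMap.coprod_apply, LinearMap.coprod_apply, map_zero, add_zero, add_comm]

end QuasiAuto

theorem mainTheorem6 (L : Set ℝ) (hL : QuasiAuto.IsShiftedLattice L) (μ ν : ℂ) :
    (∀ α ∈ QuasiAuto.polyGrowth L,
      (∀ f : QuasiAuto.TestFn, Summable fun l : L => α l * QuasiAuto.fourierT f l) ∧
      (∀ F : QuasiAuto.PSeries μ ν, Summable fun l : L => α l * QuasiAuto.jacquet μ ν l F)) ∧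
    ∃ Φ : (QuasiAuto.polyGrowth L × (ℕ →₀ ℂ)) →ₗ[ℂ] QuasiAuto.quasiPeriodic μ ν L,
      (∀ (α : QuasiAuto.polyGrowth L) (β : ℕ →₀ ℂ) (F : QuasiAuto.PSeries μ ν),
        (Φ (α, β)).1 F = QuasiAuto.fourierExpansion μ ν α.1 β F) ∧
      (∀ (α : QuasiAuto.polyGrowth L) (β : ℕ →₀ ℂ) (f : QuasiAuto.TestFn),
        QuasiAuto.restr (Φ (α, β)).1 f = QuasiAuto.fourierSeries α.1 f) ∧
      Function.Bijective Φ := by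
  refine ⟨fun α hα => ⟨QuasiAuto.summable_fourierT hL hα, (QuasiAuto.jacquet_series hL μ ν hα).1⟩,
    LinearMap.codRestrict _ (QuasiAuto.expansionL μ ν hL) (QuasiAuto.expansionL_mem μ ν hL),
    QuasiAuto.expansionL_apply μ ν hL, QuasiAuto.expansionL_iota μ ν hL, fun x y h => ?_, fun lam => ?_⟩
  · exact QuasiAuto.expansionL_injective μ ν hL (congrArg Subtype.val h)
  · obtain ⟨x, hx⟩ := QuasiAuto.exists_expansionL_eq hL lam.2
    exact ⟨x, Subtype.ext hx⟩
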